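/- An arrangement of pseudocircles is a finite family of simple closed curves in the plane (or on the sphere) such that any two of them are either disjoint or meet in exactly two points, where they cross. It is simple if no three curves have a common point, and intersecting if every two curves intersect. Its arrangement graph has the intersection points as vertices and the arcs of the curves between consecutive intersection points as edges; the cells are the connected components of the complement of the union of the curves. The arrangement is called $\triangle$-saturated if every edge is incident to exactly one triangular cell, and $4$-chromatic if its arrangement graph has chromatic number $4$. For a $\triangle$-saturated arrangement $\mathcal A$ with a pentagonal cell $P$, a corona extension of $\mathcal A$ at $P$ is an arrangement of pseudocircles obtained from $\mathcal A$ by adding one pseudocircle $D$ such that $D$ encloses $P$ (that is, $D$ is disjoint from the closure of $P$ and separates $P$ from every vertex of $\mathcal A$ that is not on the boundary of $P$), $D$ intersects exactly those pseudocircles that bound $P$, and it does so only at interior points of edges incident to vertices of $P$. Theorem. There is an infinite family of simple $4$-chromatic arrangements of pseudocircles, each of which is obtained from an intersecting arrangement of pseudocircles by adding only one additional pseudocircle. More precisely, for infinitely many $n$ there are a simple intersecting $\triangle$-saturated arrangement $\mathcal A$ of $n$ pseudocircles with a pentagonal cell $P$, and a corona extension $\mathcal A^+$ of $\mathcal A$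 at $P$, such that $\mathcal A^+$ is simple and $4$-chromatic. -/

import Mathlib

/-!
Arrangements of pseudocircles in the plane `ℂ`, their arrangement graphs and their cells.
An arrangement is a family `C : ι → Set ℂ` of simple closed curves, given by their point sets.
-/

namespace Pseudocircle

/-- A simple closed curve in the plane: an injective continuous image of the circle. -/
def IsSimpleClosedCurve (S : Set ℂ) : Prop :=
  ∃ γ : Circle → ℂ, Continuous γ ∧ Function.Injective γ ∧ Set.range γ = S

/-- The set `S` separates the points `x` and `y`: both lie off `S`, in different
connected components of the complement of `S`. -/
def Separates (S : Set ℂ) (x y : ℂ) : Prop :=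
  x ∉ S ∧ y ∉ S ∧ connectedComponentIn Sᶜ x ≠ connectedComponentIn Sᶜ y

/-- An arrangement of pseudocircles: simple closed curves, any two of which are either disjoint
or meet in exactly two points, where they cross.  When `C i` and `C j` meet in exactly two points,
`C j` consists of these points and two open arcs; the curves cross (at both points) if and only if
the two arcs lie on different sides of `C i`, i.e. `C i` separates two points of `C j`. -/
structure IsArrangement {ι : Type*} (C : ι → Set ℂ) : Prop where
  simpleClosed : ∀ i, IsSimpleClosedCurve (C i)
  pairwise : ∀ i j, i ≠ j → C i ∩ C j = ∅ ∨
    ((C i ∩ C j).ncard = 2 ∧ ∃ x ∈ C j, ∃ y ∈ C j, Separates (C i) x y)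

/-- No three curves pass through a common point. -/
def IsSimple {ι : Type*} (C : ι → Set ℂ) : Prop :=
  ∀ i j k, i ≠ j → i ≠ k → j ≠ k → C i ∩ C j ∩ C k = ∅

/-- Every two curves intersect. -/
def IsIntersecting {ι : Type*} (C : ι → Set ℂ) : Prop :=
  ∀ i j, i ≠ j → (C i ∩ C j).Nonempty

/-- The vertices: the intersection points of the arrangement. -/
def vertices {ι : Type*} (C : ι → Set ℂ) : Set ℂ :=
  {p | ∃ i j, i ≠ j ∧ p ∈ C i ∧ p ∈ C j}

/-- The edges (without their end points): the connected components of the curves after the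
removal of all vertices. -/
def edges {ι : Type*} (C : ι → Set ℂ) : Set (Set ℂ) :=
  {e | ∃ i, ∃ x ∈ C i \ vertices C, e = connectedComponentIn (C i \ vertices C) x}

/-- The arrangement graph: two distinct vertices are adjacent if they are the end points of
a common edge.  (Parallel edges are merged, which does not affect colorings.) -/
def arrangementGraph {ι : Type*} (C : ι → Set ℂ) : SimpleGraph (vertices C) where
  Adj u v := u ≠ v ∧ ∃ e ∈ edges C, (u : ℂ) ∈ closure e ∧ (v : ℂ) ∈ closure e
  symm := ⟨fun _ _ h => ⟨h.1.symm, h.2.imp fun _ he => ⟨he.1, he.2.2, he.2.1⟩⟩⟩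
  loopless := ⟨fun _ h => h.1 rfl⟩

/-- The cells (faces): the connected components of the complement of the union of the curves. -/
def cells {ι : Type*} (C : ι → Set ℂ) : Set (Set ℂ) :=
  {F | ∃ x ∈ (⋃ i, C i)ᶜ, F = connectedComponentIn (⋃ i, C i)ᶜ x}

/-- The edges incident to a cell `F`, i.e. those on its boundary. -/
def boundaryEdges {ι : Type*} (C : ι → Set ℂ) (F : Set ℂ) : Set (Set ℂ) :=
  {e ∈ edges C | e ⊆ closure F}

/-- `F` is a `k`-gonal cell: a cell with exactly `k` boundary edges.  (It is used for
intersecting arrangements, where the boundary of a cell is a cycle of the arrangement graph.) -/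
def IsGonalCell {ι : Type*} (C : ι → Set ℂ) (k : ℕ) (F : Set ℂ) : Prop :=
  F ∈ cells C ∧ (boundaryEdges C F).encard = k

/-- Every edge is incident to exactly one triangular cell. -/
def IsTriangleSaturated {ι : Type*} (C : ι → Set ℂ) : Prop :=
  ∀ e ∈ edges C, ∃! F : Set ℂ, IsGonalCell C 3 F ∧ e ∈ boundaryEdges C F

/-- The family `C` together with one additional curve `D`, which has the index `none`. -/
def addCurve {ι : Type*} (C : ι → Set ℂ) (D : Set ℂ) : Option ι → Set ℂ :=
  fun o => o.elim D C

/-- `C` together with the additional pseudocircle `D` is a corona extension of the arrangement `C`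
at the pentagonal cell `P`: the curve `D` encloses `P`, intersects exactly the pseudocircles
that bound `P`, and does so only at (interior points of) edges incident to vertices of `P`.
Here `D` encloses `P` if it is disjoint from the closed cell and separates the cell from all
vertices of `C` that are not on the boundary of `P` (this notion does not depend on whether
the arrangement is drawn in the plane or on the sphere). -/
structure IsCoronaExtension {ι : Type*} (C : ι → Set ℂ) (P D : Set ℂ) : Prop where
  pentagon : IsGonalCell C 5 P
  arrangement : IsArrangement (addCurve C D)
  disjoint_cell : Disjoint D (closure P)
  encloses : ∀ x ∈ P, ∀ v ∈ vertices C, v ∉ closure P → Separates D x v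
  meets_iff : ∀ i, (D ∩ C i).Nonempty ↔ ∃ e ∈ boundaryEdges C P, e ⊆ C i
  meets_at : ∀ i, ∀ p ∈ D ∩ C i, ∃ e ∈ edges C, p ∈ e ∧
    ∃ v ∈ vertices C, v ∈ closure P ∧ v ∈ closure e

end Pseudocircle

/-! Curves around the origin are encoded by a cyclic word: a ray sweeping once around meets the
curves in positions `0, …, N - 1`, and the letter `q` records a crossing in the gap between the
positions `q - 1` and `q`. A cell in a gap lies between two successive occurrences of its letter; it
has two edges plus one for each letter of a neighbouring gap in between. If exactly the odd gaps
consist of triangles and `N` is even, every edge borders one odd gap, so the arrangement is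
triangle-saturated as soon as the innermost and outermost cells are not triangles. The innermost
cell is the pentagon `P`.

Infinitely many words. The icosidodecahedron (six great circles) gives the first one. Given a word
with `N = 2m + 2` wires, a wire not incident to `P` is replaced by a cable of `2m + 1` wires
(`SaturatedWord.cable`). At each crossing of the old wire the cable wires take one step of a zigzag.
The old wire has `2(N - 1)` crossings, which is exactly the period of the zigzag; hence the cable
closes up and any two of its wires cross twice. The new word has `2N - 2` wires and leaves `P`
unchanged.

Three colors do not suffice. Fix a color and count its vertices modulo two. In a three-colored
triangle exactly one vertex has this color; adding these relations around an odd gap relates the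
even letters below and above it (`letterSum_add`). There is no letter `N`, so descending from the
top shows that the sum for the letter `2` vanishes. In the lowest gap the corona replaces each
triangle by a smaller one and adds a triangle at every vertex of `P`; adding both relations shows
that the sum for the letter `1` vanishes too (`letterSum_one`). So every color occurs an odd number
of times on the pentagon. Neighbours on a 5-cycle differ, so it occurs at most twice, hence once,
and `1 + 1 + 1 ≠ 5`.

Four colors suffice. Crossings with even letters are pairwise non-adjacent and share one color. The
occurrences of each odd letter form a cycle, colored with the remaining three colors so that the
vertices of the corona can be colored as well.

Geometry. The wires are realized as graphs of piecewise linear functions in logarithmic polar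
coordinates. Inside and outside of such a curve are explicit open sets, and edges and cells are
determined as explicit clopen preconnected sets. -/

/-! ### Sweep words -/

namespace Wiring

/-- The letter `q` exchanges the positions `q - 1` and `q`. -/
def swapLetter (q x : ℕ) : ℕ := if x + 1 = q then q else if x = q then q - 1 else x

/-- The letter `q` exchanges the wires at the positions `x` and `y`. -/
abbrev Exchanges (q x y : ℕ) : Prop := (x + 1 = q ∧ y = q) ∨ (y + 1 = q ∧ x = q)

/-- The final position of the wire that starts at `x`. -/
def runAt : ℕ → List ℕ → ℕ
  | x, [] => x
  | x, q :: w => runAt (swapLetter q x) w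

/-- The number of crossings of the wires that start at `x` and `y`. -/
def cross : ℕ → ℕ → List ℕ → ℕ
  | _, _, [] => 0
  | x, y, q :: w => (if Exchanges q x y then 1 else 0) + cross (swapLetter q x) (swapLetter q y) w

/-- The number of letters `p` that move the wire that starts at `x`. -/
def visits (p : ℕ) : ℕ → List ℕ → ℕ
  | _, [] => 0
  | x, q :: w => (if q = p ∧ (x + 1 = q ∨ x = q) then 1 else 0) + visits p (swapLetter q x) w

/-- The gap counters after the letter `q`: the counter of a gap is the number of letters of
neighbouring gaps since the last letter of that gap. -/
def bump (κ : ℕ → ℕ) (q : ℕ) : ℕ → ℕ :=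
  fun p => if p = q then 0 else if p = q + 1 ∨ p + 1 = q then κ p + 1 else κ p

/-- The letter `q` closes a cell with an admissible number of edges. -/
def Admissible (N : ℕ) (κ : ℕ → ℕ) (q : ℕ) : Prop :=
  0 < q ∧ q < N ∧ (q % 2 = 1 → κ q = 1) ∧ (q % 2 = 0 → 2 ≤ κ q)

/-- The cell closed by the letter `q` has `κ q + 2` edges. So admissibility means triangles in the
odd gaps and at least four edges in the even ones. -/
def Valid (N : ℕ) : (ℕ → ℕ) → List ℕ → Prop
  | _, [] => True
  | κ, q :: w => Admissible N κ q ∧ Valid N (bump κ q) w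

def counters : (ℕ → ℕ) → List ℕ → (ℕ → ℕ)
  | κ, [] => κ
  | κ, q :: w => counters (bump κ q) w

theorem runAt_append (x : ℕ) (u v : List ℕ) : runAt x (u ++ v) = runAt (runAt x u) v := by
  induction u generalizing x with
  | nil => rfl
  | cons q u ih => exact ih _

theorem cross_append (x y : ℕ) (u v : List ℕ) :
    cross x y (u ++ v) = cross x y u + cross (runAt x u) (runAt y u) v := by
  induction u generalizing x y with
  | nil => simp [cross, runAt]
  | cons q u ih => simp [cross, runAt, ih, add_assoc]

theorem visits_append (p x : ℕ) (u v : List ℕ) :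
    visits p x (u ++ v) = visits p x u + visits p (runAt x u) v := by
  induction u generalizing x with
  | nil => simp [visits, runAt]
  | cons q u ih => simp [visits, runAt, ih, add_assoc]

theorem counters_append (κ : ℕ → ℕ) (u v : List ℕ) :
    counters κ (u ++ v) = counters (counters κ u) v := by
  induction u generalizing κ with
  | nil => rfl
  | cons q u ih => exact ih _

theorem valid_append (N : ℕ) (κ : ℕ → ℕ) (u v : List ℕ) :
    Valid N κ (u ++ v) ↔ Valid N κ u ∧ Valid N (counters κ u) v := by
  induction u generalizing κ with
  | nil => simp [Valid, counters]
  | cons q u ih => simp [Valid, counters, ih, and_assoc]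

theorem swapLetter_injective (q : ℕ) : Function.Injective (swapLetter q) := by
  intro x y h
  unfold swapLetter at h
  grind

theorem swapLetter_cases (q x : ℕ) : (x + 1 = q ∧ swapLetter q x = q) ∨
    (x = q ∧ swapLetter q x = q - 1) ∨ (x + 1 ≠ q ∧ x ≠ q ∧ swapLetter q x = x) := by
  unfold swapLetter
  split_ifs <;> omega

theorem swapLetter_lt {q N x : ℕ} (hq : q < N) (hx : x < N) : swapLetter q x < N := by
  unfold swapLetter
  grind

theorem cross_comm (x y : ℕ) (w : List ℕ) : cross x y w = cross y x w := by
  induction w generalizing x y with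
  | nil => rfl
  | cons q w ih => simp only [cross, ih, Exchanges, or_comm]

/-! ### Runs of letters -/

/-- The letters `s, s + 2, …`, `m` of them. -/
def pairSwaps (s : ℕ) : ℕ → List ℕ
  | 0 => []
  | m + 1 => s :: pairSwaps (s + 2) m

/-- The letters `a, a + 1, …`, `n` of them. -/
def upRun (a : ℕ) : ℕ → List ℕ
  | 0 => []
  | n + 1 => a :: upRun (a + 1) n

/-- The letters `a + n - 1, …, a + 1, a`. -/
def downRun (a : ℕ) : ℕ → List ℕ
  | 0 => []
  | n + 1 => (a + n) :: downRun a n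

theorem runAt_pairSwaps (s m x : ℕ) (hs : 0 < s) : runAt x (pairSwaps s m) =
    if s ≤ x + 1 ∧ x + 1 < s + 2 * m then (if (x + 1 - s) % 2 = 0 then x + 1 else x - 1) else x := by
  induction m generalizing s x with
  | zero => simp only [pairSwaps, runAt]; split_ifs <;> omega
  | succ m ih =>
    simp only [pairSwaps, runAt, ih (s + 2) _ (by omega)]
    unfold swapLetter
    split_ifs <;> omega

theorem cross_pairSwaps (s m x y : ℕ) (hs : 0 < s) : cross x y (pairSwaps s m) =
    if (s ≤ x + 1 ∧ x + 1 < s + 2 * m ∧ (x + 1 - s) % 2 = 0 ∧ y = x + 1) ∨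
      (s ≤ y + 1 ∧ y + 1 < s + 2 * m ∧ (y + 1 - s) % 2 = 0 ∧ x = y + 1) then 1 else 0 := by
  induction m generalizing s x y with
  | zero => rw [if_neg (by omega)]; rfl
  | succ m ih =>
    simp only [pairSwaps, cross, ih (s + 2) _ _ (by omega)]
    unfold Exchanges
    have hx := swapLetter_cases s x
    have hy := swapLetter_cases s y
    generalize swapLetter s x = x' at *
    generalize swapLetter s y = y' at *
    rcases hx with hx | hx | hx <;> rcases hy with hy | hy | hy <;> split_ifs <;> omega

theorem runAt_upRun (a n x : ℕ) (ha : 0 < a) : runAt x (upRun a n) =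
    if x + 1 = a then x + n else if a ≤ x ∧ x < a + n then x - 1 else x := by
  induction n generalizing a x with
  | zero => simp only [upRun, runAt]; split_ifs <;> omega
  | succ n ih =>
    simp only [upRun, runAt, ih (a + 1) _ (by omega)]
    unfold swapLetter
    split_ifs <;> omega

theorem cross_upRun (a n x y : ℕ) (ha : 0 < a) : cross x y (upRun a n) =
    if (x + 1 = a ∧ a ≤ y ∧ y < a + n) ∨ (y + 1 = a ∧ a ≤ x ∧ x < a + n) then 1 else 0 := by
  induction n generalizing a x y with
  | zero => rw [if_neg (by omega)]; rfl
  | succ n ih =>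
    simp only [upRun, cross, ih (a + 1) _ _ (by omega)]
    unfold Exchanges
    have hx := swapLetter_cases a x
    have hy := swapLetter_cases a y
    generalize swapLetter a x = x' at *
    generalize swapLetter a y = y' at *
    rcases hx with hx | hx | hx <;> rcases hy with hy | hy | hy <;> split_ifs <;> omega

theorem runAt_downRun (a n x : ℕ) (ha : 0 < a) : runAt x (downRun a n) =
    if x + 1 = a + n then x - n else if a ≤ x + 1 ∧ x + 1 < a + n then x + 1 else x := by
  induction n generalizing x with
  | zero => simp only [downRun, runAt]; split_ifs <;> omega
  | succ n ih =>
    simp only [downRun, runAt, ih]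
    unfold swapLetter
    split_ifs <;> omega

theorem cross_downRun (a n x y : ℕ) (ha : 0 < a) : cross x y (downRun a n) =
    if (x + 1 = a + n ∧ a ≤ y + 1 ∧ y + 1 < a + n) ∨ (y + 1 = a + n ∧ a ≤ x + 1 ∧ x + 1 < a + n)
    then 1 else 0 := by
  induction n generalizing x y with
  | zero => rw [if_neg (by omega)]; rfl
  | succ n ih =>
    simp only [downRun, cross, ih]
    unfold Exchanges
    have hx := swapLetter_cases (a + n) x
    have hy := swapLetter_cases (a + n) y
    generalize swapLetter (a + n) x = x' at *
    generalize swapLetter (a + n) y = y' at *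
    rcases hx with hx | hx | hx <;> rcases hy with hy | hy | hy <;> split_ifs <;> omega

/-- All letters of the run are odd: an odd gap is affected only by its own letter, and an even gap
is never reset, so its counter can only grow. -/
theorem counters_pairSwaps (s m : ℕ) (κ : ℕ → ℕ) (p : ℕ) (hs : s % 2 = 1) :
    (p % 2 = 1 → counters κ (pairSwaps s m) p = if s ≤ p ∧ p < s + 2 * m then 0 else κ p) ∧
    (p % 2 = 0 → κ p ≤ counters κ (pairSwaps s m) p) := by
  induction m generalizing s κ with
  | zero => simp [pairSwaps, counters]
  | succ m ih =>
    simp only [pairSwaps, counters]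
    obtain ⟨h1, h2⟩ := ih (s + 2) (bump κ s) (by omega)
    refine ⟨fun h => ?_, fun h => ?_⟩
    · rw [h1 h]; unfold bump; split_ifs <;> omega
    · refine le_trans ?_ (h2 h); unfold bump; split_ifs <;> omega

theorem valid_pairSwaps (N s m : ℕ) (κ : ℕ → ℕ) (hs : s % 2 = 1) (hN : s + 2 * m ≤ N + 1)
    (hκ : ∀ p, p % 2 = 1 → s ≤ p → p < s + 2 * m → κ p = 1) : Valid N κ (pairSwaps s m) := by
  induction m generalizing s κ with
  | zero => trivial
  | succ m ih =>
    refine ⟨⟨by omega, by omega, fun _ => hκ s hs le_rfl (by omega), by omega⟩,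
      ih (s + 2) _ (by omega) (by omega) fun p hp h1 h2 => ?_⟩
    unfold bump
    rw [if_neg (by omega), if_neg (by omega)]
    exact hκ p hp (by omega) (by omega)

theorem counters_upRun (a n : ℕ) (κ : ℕ → ℕ) (p : ℕ) (ha : 0 < a) (hn : 0 < n) :
    counters κ (upRun a n) p = if p + 1 = a then κ p + 1 else if a ≤ p ∧ p + 1 < a + n then 1
      else if p + 1 = a + n then 0 else if p = a + n then κ p + 1 else κ p := by
  induction n generalizing a κ with
  | zero => omega
  | succ n ih =>
    rcases Nat.eq_zero_or_pos n with rfl | hn'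
    · simp only [upRun, counters, bump]; split_ifs <;> omega
    · simp only [upRun, counters, ih (a + 1) _ (by omega) hn']
      unfold bump
      split_ifs <;> omega

/-- Every gap after the first gains exactly one, from the preceding letter, before its own letter
comes. This is why odd gaps must start at `0` and even ones at `1` or more. -/
theorem valid_upRun (N a n : ℕ) (κ : ℕ → ℕ) (ha : 0 < a) (hN : a + n ≤ N)
    (h0 : 0 < n → Admissible N κ a)
    (h1 : ∀ p, a < p → p < a + n → (p % 2 = 1 → κ p = 0) ∧ (p % 2 = 0 → 1 ≤ κ p)) :
    Valid N κ (upRun a n) := by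
  induction n generalizing a κ with
  | zero => trivial
  | succ n ih =>
    refine ⟨h0 (by omega), ih (a + 1) _ (by omega) (by omega) (fun hn => ?_) fun p h2 h3 => ?_⟩
    · have := h1 (a + 1) (by omega) (by omega)
      refine ⟨by omega, by omega, fun h => ?_, fun h => ?_⟩ <;> unfold bump <;>
        rw [if_neg (by omega), if_pos (by omega)]
      · rw [this.1 h]
      · have := this.2 h; omega
    · have := h1 p (by omega) (by omega)
      unfold bump
      rw [if_neg (by omega), if_neg (by omega)]
      exact this

theorem counters_downRun (a n : ℕ) (κ : ℕ → ℕ) (p : ℕ) (hn : 0 < n) :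
    counters κ (downRun a n) p = if p + 1 = a then κ p + 1 else if p = a then 0
      else if a < p ∧ p < a + n then 1 else if p = a + n then κ p + 1 else κ p := by
  induction n generalizing κ with
  | zero => omega
  | succ n ih =>
    rcases Nat.eq_zero_or_pos n with rfl | hn'
    · simp only [downRun, counters, bump]; split_ifs <;> omega
    · simp only [downRun, counters, ih _ hn']
      unfold bump
      split_ifs <;> omega

theorem valid_downRun (N a n : ℕ) (κ : ℕ → ℕ) (ha : 0 < a) (hN : a + n ≤ N)
    (h0 : 0 < n → Admissible N κ (a + n - 1))
    (h1 : ∀ p, a ≤ p → p + 1 < a + n → (p % 2 = 1 → κ p = 0) ∧ (p % 2 = 0 → 1 ≤ κ p)) :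
    Valid N κ (downRun a n) := by
  induction n generalizing κ with
  | zero => trivial
  | succ n ih =>
    refine ⟨h0 (by omega), ih _ (by omega) (fun hn => ?_) fun p h2 h3 => ?_⟩
    · have := h1 (a + n - 1) (by omega) (by omega)
      refine ⟨by omega, by omega, fun h => ?_, fun h => ?_⟩ <;> unfold bump <;>
        rw [if_neg (by omega), if_pos (by omega)]
      · rw [this.1 h]
      · have := this.2 h; omega
    · have := h1 p (by omega) (by omega)
      unfold bump
      rw [if_neg (by omega), if_neg (by omega)]
      exact this

end Wiring

/-! ### Replacing a wire by a cable -/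

namespace Wiring

/-- The height in a cable of `n` wires of the wire with phase `φ`. -/
def zigzag (n φ : ℕ) : ℕ := if φ < n then φ else 2 * n - 1 - φ

/-- Phases are residues modulo `2 * n`. A wire climbs during the phases below `n` and descends
afterwards; it pauses for one step at the top and at the bottom, where the swaps of the odd gaps
miss it. -/
def nextPhase (n φ : ℕ) : ℕ := if φ + 1 = 2 * n then 0 else φ + 1

/-- The exchanges inside the cable with `2 * m + 1` wires and lowest position `l`:
all odd inner gaps. -/
def cableSwaps (m l : ℕ) : List ℕ := pairSwaps (if l % 2 = 0 then l + 1 else l + 2) m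

/-- The letters that replace the letter `q` when the wire at position `l` is replaced by a cable of
`2 * m + 1` wires. -/
def block (m l q : ℕ) : List ℕ :=
  if q < l then [q]
  else if q = l then cableSwaps m l ++ upRun l (2 * m + 1)
  else if q = l + 1 then cableSwaps m l ++ downRun (l + 1) (2 * m + 1)
  else [q + 2 * m]

/-- The word in which the wire that starts at `l` is replaced by a cable. -/
def cableWord (m : ℕ) : ℕ → List ℕ → List ℕ
  | _, [] => []
  | l, q :: w => block m l q ++ cableWord m (swapLetter q l) w

/-- The new position of an old wire. -/
def lift (m l x : ℕ) : ℕ := if x < l then x else x + 2 * m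

abbrev Touches (q x : ℕ) : Prop := x + 1 = q ∨ x = q

theorem runAt_cableSwaps (m l x : ℕ) : runAt x (cableSwaps m l) =
    if l % 2 = 0 then
      (if l ≤ x ∧ x < l + 2 * m then (if (x - l) % 2 = 0 then x + 1 else x - 1) else x)
    else (if l + 1 ≤ x ∧ x < l + 1 + 2 * m then (if (x - l) % 2 = 0 then x - 1 else x + 1) else x) := by
  unfold cableSwaps
  rw [runAt_pairSwaps _ _ _ (by split_ifs <;> omega)]
  split_ifs <;> omega

theorem cross_cableSwaps (m l x y : ℕ) : cross x y (cableSwaps m l) =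
    if (l ≤ x ∧ x < l + 2 * m + l % 2 ∧ x % 2 = 0 ∧ y = x + 1) ∨
      (l ≤ y ∧ y < l + 2 * m + l % 2 ∧ y % 2 = 0 ∧ x = y + 1) then 1 else 0 := by
  unfold cableSwaps
  rw [cross_pairSwaps _ _ _ _ (by split_ifs <;> omega)]
  by_cases hl : l % 2 = 0
  · simp only [hl, if_true]
    congr 1
    simp only [eq_iff_iff]
    omega
  · simp only [hl, if_false]
    congr 1
    simp only [eq_iff_iff]
    omega

theorem zigzag_lt (n φ : ℕ) (hn : 0 < n) : zigzag n φ < n := by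
  unfold zigzag
  split_ifs <;> omega

/-- An odd letter moves the wire at an even position up and the one at an odd position down. The
parity condition says precisely that climbing wires occupy even positions and descending wires odd
ones. -/
theorem runAt_zigzag_cableSwaps (m l φ : ℕ) (hφ : φ < 2 * (2 * m + 1)) (h : φ % 2 = l % 2) :
    runAt (l + zigzag (2 * m + 1) φ) (cableSwaps m l) =
      l + zigzag (2 * m + 1) (nextPhase (2 * m + 1) φ) := by
  rw [runAt_cableSwaps]
  unfold zigzag nextPhase
  split_ifs <;> omega

theorem runAt_block_lift (m l q x : ℕ) (hq : 0 < q) (hx : x ≠ l) :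
    runAt (lift m l x) (block m l q) = lift m (swapLetter q l) (swapLetter q x) := by
  have hs : runAt (lift m l x) (cableSwaps m l) = lift m l x := by
    rw [runAt_cableSwaps]
    unfold lift
    split_ifs <;> omega
  unfold block
  have h1 := swapLetter_cases q l
  have h2 := swapLetter_cases q x
  split_ifs with c1 c2 c3
  · simp only [runAt]; unfold lift swapLetter; split_ifs <;> omega
  · rw [runAt_append, hs, runAt_upRun _ _ _ (by omega)]
    generalize swapLetter q l = l' at *
    generalize swapLetter q x = x' at *
    unfold lift; split_ifs <;> omega
  · rw [runAt_append, hs, runAt_downRun _ _ _ (by omega)]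
    generalize swapLetter q l = l' at *
    generalize swapLetter q x = x' at *
    unfold lift; split_ifs <;> omega
  · simp only [runAt]; unfold lift swapLetter; split_ifs <;> omega

/-- A letter that moves the old wire causes one zigzag step; then the foreign wire traverses the
cable, which shifts the whole cable by one position. Any other letter leaves the cable alone. -/
theorem runAt_block_zigzag (m l q φ : ℕ) (hq : 0 < q) (hφ : φ < 2 * (2 * m + 1))
    (h : φ % 2 = l % 2) :
    runAt (l + zigzag (2 * m + 1) φ) (block m l q) = swapLetter q l +
      zigzag (2 * m + 1) (if Touches q l then nextPhase (2 * m + 1) φ else φ) := by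
  have h0 := zigzag_lt (2 * m + 1) φ (by omega)
  have h0' := zigzag_lt (2 * m + 1) (nextPhase (2 * m + 1) φ) (by omega)
  have h1 := swapLetter_cases q l
  unfold block Touches
  split_ifs with c1 c2 c3 c4 c5 c6 <;> try omega
  · simp only [runAt]
    have := swapLetter_cases q (l + zigzag (2 * m + 1) φ)
    omega
  · rw [runAt_append, runAt_zigzag_cableSwaps _ _ _ hφ h, runAt_upRun _ _ _ (by omega)]
    split_ifs <;> omega
  · rw [runAt_append, runAt_zigzag_cableSwaps _ _ _ hφ h, runAt_downRun _ _ _ (by omega)]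
    split_ifs <;> omega
  · simp only [runAt]
    have := swapLetter_cases (q + 2 * m) (l + zigzag (2 * m + 1) φ)
    omega

theorem cross_block_lift_lift (m l q x y : ℕ) (hq : 0 < q) (hx : x ≠ l) (hy : y ≠ l) :
    cross (lift m l x) (lift m l y) (block m l q) = if Exchanges q x y then 1 else 0 := by
  have hs : ∀ x, x ≠ l → runAt (lift m l x) (cableSwaps m l) = lift m l x := by
    intro x hx
    rw [runAt_cableSwaps]
    unfold lift
    split_ifs <;> omega
  have hc : cross (lift m l x) (lift m l y) (cableSwaps m l) = 0 := by
    rw [cross_cableSwaps, if_neg]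
    unfold lift
    split_ifs <;> omega
  have hx' : (x < l ∧ lift m l x = x) ∨ (l < x ∧ lift m l x = x + 2 * m) := by
    unfold lift; split_ifs <;> omega
  have hy' : (y < l ∧ lift m l y = y) ∨ (l < y ∧ lift m l y = y + 2 * m) := by
    unfold lift; split_ifs <;> omega
  unfold block
  split_ifs with c1 c2 c3 c4 c5 c6 c7 <;>
    simp only [cross_append, hs x hx, hs y hy, hc, cross] <;>
    (try rw [cross_upRun _ _ _ _ (by omega)]) <;> (try rw [cross_downRun _ _ _ _ (by omega)]) <;>
    generalize lift m l x = x' at * <;> generalize lift m l y = y' at * <;>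
    first
      | (rw [if_pos (by omega)]) | (rw [if_neg (by omega)])

theorem cross_block_lift_zigzag (m l q x φ : ℕ) (hq : 0 < q) (hx : x ≠ l)
    (hφ : φ < 2 * (2 * m + 1)) (h : φ % 2 = l % 2) :
    cross (lift m l x) (l + zigzag (2 * m + 1) φ) (block m l q) =
      if Exchanges q x l then 1 else 0 := by
  have h0 := zigzag_lt (2 * m + 1) φ (by omega)
  have h0' := zigzag_lt (2 * m + 1) (nextPhase (2 * m + 1) φ) (by omega)
  have hx' : (x < l ∧ lift m l x = x) ∨ (l < x ∧ lift m l x = x + 2 * m) := by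
    unfold lift; split_ifs <;> omega
  have hs : runAt (lift m l x) (cableSwaps m l) = lift m l x := by
    rw [runAt_cableSwaps]
    split_ifs <;> omega
  have hc : cross (lift m l x) (l + zigzag (2 * m + 1) φ) (cableSwaps m l) = 0 := by
    rw [cross_cableSwaps, if_neg (by omega)]
  unfold block
  split_ifs with c1 c2 c3 c4 c5 c6 c7 <;>
    simp only [cross_append, hs, runAt_zigzag_cableSwaps _ _ _ hφ h, hc, cross] <;>
    (try rw [cross_upRun _ _ _ _ (by omega)]) <;> (try rw [cross_downRun _ _ _ _ (by omega)]) <;>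
    generalize lift m l x = x' at * <;>
    first
      | (rw [if_pos (by omega)]) | (rw [if_neg (by omega)])

/-- A swap exchanges a climbing wire at some height `φ` with a descending wire at height `2 * n - 1
- ψ = φ + 1`, where `n = 2 * m + 1`; this is the equation for `φ + ψ`. The runs only move a foreign
wire through the cable and contribute no crossing within it. -/
theorem cross_block_zigzag_zigzag (m l q φ ψ : ℕ) (hq : 0 < q)
    (hφ : φ < 2 * (2 * m + 1)) (h : φ % 2 = l % 2) (hψ : ψ < 2 * (2 * m + 1)) (h' : ψ % 2 = l % 2)
    (hne : φ ≠ ψ) :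
    cross (l + zigzag (2 * m + 1) φ) (l + zigzag (2 * m + 1) ψ) (block m l q) =
      if Touches q l ∧ φ + ψ + 2 = 2 * (2 * m + 1) then 1 else 0 := by
  have h0 := zigzag_lt (2 * m + 1) φ (by omega)
  have h1 := zigzag_lt (2 * m + 1) ψ (by omega)
  have h2 := zigzag_lt (2 * m + 1) (nextPhase (2 * m + 1) φ) (by omega)
  have h3 := zigzag_lt (2 * m + 1) (nextPhase (2 * m + 1) ψ) (by omega)
  have hc : cross (l + zigzag (2 * m + 1) φ) (l + zigzag (2 * m + 1) ψ) (cableSwaps m l) =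
      if φ + ψ + 2 = 2 * (2 * m + 1) then 1 else 0 := by
    rw [cross_cableSwaps]
    congr 1
    simp only [eq_iff_iff]
    unfold zigzag
    split_ifs <;> omega
  have hu : cross (l + zigzag (2 * m + 1) (nextPhase (2 * m + 1) φ))
      (l + zigzag (2 * m + 1) (nextPhase (2 * m + 1) ψ)) (upRun l (2 * m + 1)) = 0 ∨ l = 0 := by
    rcases Nat.eq_zero_or_pos l with rfl | hl
    · exact Or.inr rfl
    · rw [cross_upRun _ _ _ _ hl, if_neg (by omega)]; exact Or.inl rfl
  have hd : cross (l + zigzag (2 * m + 1) (nextPhase (2 * m + 1) φ))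
      (l + zigzag (2 * m + 1) (nextPhase (2 * m + 1) ψ)) (downRun (l + 1) (2 * m + 1)) = 0 := by
    rw [cross_downRun _ _ _ _ (by omega), if_neg (by omega)]
  unfold block Touches
  by_cases c1 : q < l
  · rw [if_pos c1, if_neg (by omega)]
    simp only [cross]
    rw [if_neg (by omega)]
  by_cases c2 : q = l
  · rw [if_neg c1, if_pos c2, cross_append, runAt_zigzag_cableSwaps _ _ _ hφ h,
      runAt_zigzag_cableSwaps _ _ _ hψ h', hc, hu.resolve_right (by omega)]
    simp [c2]
  by_cases c3 : q = l + 1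
  · rw [if_neg c1, if_neg c2, if_pos c3, cross_append, runAt_zigzag_cableSwaps _ _ _ hφ h,
      runAt_zigzag_cableSwaps _ _ _ hψ h', hc, hd]
    simp [c3]
  · rw [if_neg c1, if_neg c2, if_neg c3, if_neg (by omega)]
    simp only [cross]
    rw [if_neg (by omega)]

end Wiring

/-! ### Admissibility of the letters of the cabled word -/

namespace Wiring

/-- The counters `κ'` of a word with a cable at position `l` agree with the counters `κ` of the
original word. -/
def Compatible (m l : ℕ) (κ κ' : ℕ → ℕ) : Prop := ∀ p,
  (p ≤ l → (p % 2 = 1 → κ' p = κ p) ∧ κ p ≤ κ' p) ∧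
  (l < p → p < l + 2 * m + 1 → (p % 2 = 1 → κ' p = 1) ∧ 1 ≤ κ' p) ∧
  (l + 2 * m + 1 ≤ p → (p % 2 = 1 → κ' p = κ (p - 2 * m)) ∧ κ (p - 2 * m) ≤ κ' p)

theorem counters_cableSwaps (m l : ℕ) (κ : ℕ → ℕ) (p : ℕ) :
    (p % 2 = 1 → counters κ (cableSwaps m l) p =
      if l < p ∧ p < l + 2 * m + 1 then 0 else κ p) ∧
    (p % 2 = 0 → κ p ≤ counters κ (cableSwaps m l) p) := by
  unfold cableSwaps
  have h := counters_pairSwaps (if l % 2 = 0 then l + 1 else l + 2) m κ p (by split_ifs <;> omega)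
  refine ⟨fun hp => ?_, h.2⟩
  rw [h.1 hp]
  split_ifs <;> omega

theorem valid_cableSwaps (N m l : ℕ) (κ : ℕ → ℕ) (hN : l + 2 * m < N)
    (hκ : ∀ p, p % 2 = 1 → l < p → p < l + 2 * m + 1 → κ p = 1) :
    Valid N κ (cableSwaps m l) := by
  unfold cableSwaps
  refine valid_pairSwaps _ _ _ _ (by split_ifs <;> omega) (by split_ifs <;> omega) ?_
  intro p hp h1 h2
  refine hκ p hp ?_ ?_ <;> split_ifs at h1 h2 <;> omega

theorem bump_cases (κ : ℕ → ℕ) (q p : ℕ) : (p = q ∧ bump κ q p = 0) ∨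
    ((p = q + 1 ∨ p + 1 = q) ∧ bump κ q p = κ p + 1) ∨
    (p ≠ q ∧ p ≠ q + 1 ∧ p + 1 ≠ q ∧ bump κ q p = κ p) := by
  unfold bump
  split_ifs <;> omega

/-- The inner swaps close triangles in the odd gaps of the cable and reset their counters. The run
then closes, in each further inner gap, a cell whose counter was raised once by the preceding
letter, and leaves the inner counters equal to `1`. Outside the cable, the swaps (odd letters) can
only raise even counters; this is harmless and explains why even gaps are compared by an inequality.
-/
theorem compatible_block {N m l q : ℕ} {κ κ' : ℕ → ℕ} (hl : l < N) (hκ : Compatible m l κ κ')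
    (hq : Admissible N κ q) : Valid (N + 2 * m) κ' (block m l q) ∧
      Compatible m (swapLetter q l) (bump κ q) (counters κ' (block m l q)) := by
  obtain ⟨hq0, hqN, hodd, heven⟩ := hq
  unfold block
  split_ifs with c1 c2 c3
  · have hl' : swapLetter q l = l ∨ (q + 1 = l + 1 ∧ False) := by
      have := swapLetter_cases q l; omega
    have hl' : swapLetter q l = l := by omega
    refine ⟨⟨⟨hq0, by omega, ?_, ?_⟩, trivial⟩, ?_⟩
    · intro h; have := (hκ q).1 (by omega); omega
    · intro h; have := (hκ q).1 (by omega); omega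
    · rw [hl']
      intro p
      have h3 := bump_cases κ' q p
      simp only [counters]
      refine ⟨fun h => ?_, fun h h' => ?_, fun h => ?_⟩
      · have h1 := (hκ p).1 h
        have h2 := bump_cases κ q p
        clear hκ
        omega
      · have h1 := (hκ p).2.1 h h'
        clear hκ
        omega
      · have h1 := (hκ p).2.2 h
        have h4 := bump_cases κ q (p - 2 * m)
        clear hκ
        omega
  · have hl' : swapLetter q l + 1 = l := by
      have := swapLetter_cases q l; omega
    have hs := counters_cableSwaps m l κ'
    have hv := valid_cableSwaps (N + 2 * m) m l κ' (by omega)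
      fun p hp h1 h2 => ((hκ p).2.1 h1 h2).1 hp
    set κ₁ := counters κ' (cableSwaps m l)
    refine ⟨(valid_append _ _ _ _).2 ⟨hv, valid_upRun _ _ _ _ (by omega) (by omega)
      (fun _ => ⟨by omega, by omega, fun h => ?_, fun h => ?_⟩)
      fun p h1 h2 => ⟨fun h => ?_, fun h => ?_⟩⟩, fun p => ?_⟩
    · have h1 := (hκ l).1 le_rfl
      have h2 := (hs l).1 h
      rw [if_neg (by omega)] at h2
      have h3 := h1.1 h
      subst c2
      rw [hodd h] at h3
      exact h2.trans h3
    · have h1 := (hκ l).1 le_rfl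
      have h2 := (hs l).2 h
      subst c2
      have := heven h
      change 2 ≤ κ₁ q
      omega
    · have h2' := (hs p).1 h
      rw [if_pos (by omega)] at h2'
      exact h2'
    · have h1' := (hκ p).2.1 h1 (by omega)
      have h2' := (hs p).2 h
      change 1 ≤ κ₁ p
      omega
    · rw [counters_append, show counters κ' (cableSwaps m l) = κ₁ from rfl,
        counters_upRun l (2 * m + 1) κ₁ p (by omega) (by omega)]
      have h5 := hs p
      refine ⟨fun h => ?_, fun h h' => ?_, fun h => ?_⟩
      · have h1 := (hκ p).1 (by omega)
        have h2 := bump_cases κ q p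
        rw [if_neg (by omega)] at h5
        clear hκ hs hv
        split_ifs <;> omega
      · rw [if_neg (by omega), if_pos (by omega)]
        exact ⟨fun _ => rfl, le_rfl⟩
      · have h4 := bump_cases κ q (p - 2 * m)
        rcases (by omega : p = l + 2 * m ∨ l + 2 * m + 1 ≤ p) with h6 | h6
        · rw [if_neg (by omega), if_neg (by omega), if_pos (by omega)]
          clear hκ hs hv h5
          omega
        · have h1 := (hκ p).2.2 h6
          rw [if_neg (by omega)] at h5
          rw [if_neg (by omega), if_neg (by omega), if_neg (by omega)]
          clear hκ hs hv
          split_ifs <;> omega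
  · have hl' : swapLetter q l = l + 1 := by
      have := swapLetter_cases q l; omega
    have hs := counters_cableSwaps m l κ'
    have hv := valid_cableSwaps (N + 2 * m) m l κ' (by omega)
      fun p hp h1 h2 => ((hκ p).2.1 h1 h2).1 hp
    set κ₁ := counters κ' (cableSwaps m l)
    have e : l + 1 + (2 * m + 1) - 1 = l + 2 * m + 1 := by omega
    have e' : l + 2 * m + 1 - 2 * m = q := by omega
    have h1 := (hκ (l + 2 * m + 1)).2.2 le_rfl
    rw [e'] at h1
    refine ⟨(valid_append _ _ _ _).2 ⟨hv, valid_downRun _ _ _ _ (by omega) (by omega)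
      (fun _ => ?_)
      fun p h1 h2 => ⟨fun h => ?_, fun h => ?_⟩⟩, fun p => ?_⟩
    · rw [e]
      refine ⟨by omega, by omega, fun h => ?_, fun h => ?_⟩
      · have h2 := (hs (l + 2 * m + 1)).1 h
        rw [if_neg (by omega)] at h2
        have h3 := h1.1 h
        rw [hodd (by omega)] at h3
        exact h2.trans h3
      · have h2 := (hs (l + 2 * m + 1)).2 h
        have := heven (by omega)
        change 2 ≤ κ₁ _
        omega
    · have h2' := (hs p).1 h
      rw [if_pos (by omega)] at h2'
      exact h2'
    · have h1' := (hκ p).2.1 (by omega) (by omega)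
      have h2' := (hs p).2 h
      change 1 ≤ κ₁ p
      omega
    · rw [counters_append, show counters κ' (cableSwaps m l) = κ₁ from rfl,
        counters_downRun (l + 1) (2 * m + 1) κ₁ p (by omega)]
      have h5 := hs p
      refine ⟨fun h => ?_, fun h h' => ?_, fun h => ?_⟩
      · have h2 := bump_cases κ q p
        rcases (by omega : p = l + 1 ∨ p ≤ l) with h6 | h6
        · rw [if_neg (by omega), if_pos (by omega)]
          clear hκ hs hv h5
          omega
        · have h1 := (hκ p).1 h6
          rw [if_neg (by omega)] at h5
          rw [if_neg (by omega : ¬ p = l + 1), if_neg (by omega : ¬ (l + 1 < p ∧ _)),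
            if_neg (by omega : ¬ p = l + 1 + (2 * m + 1))]
          clear hκ hs hv
          split_ifs <;> omega
      · rw [if_neg (by omega), if_neg (by omega), if_pos (by omega)]
        exact ⟨fun _ => rfl, le_rfl⟩
      · have h4 := bump_cases κ q (p - 2 * m)
        have h1 := (hκ p).2.2 (by omega)
        rw [if_neg (by omega)] at h5
        rw [if_neg (by omega), if_neg (by omega), if_neg (by omega)]
        clear hκ hs hv
        split_ifs <;> omega
  · have hl' : swapLetter q l = l := by
      have := swapLetter_cases q l; omega
    have e' : q + 2 * m - 2 * m = q := by omega
    have h1 := (hκ (q + 2 * m)).2.2 (by omega)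
    rw [e'] at h1
    refine ⟨⟨⟨by omega, by omega, ?_, ?_⟩, trivial⟩, ?_⟩
    · intro h; have := hodd (by omega); have := h1.1 h; omega
    · intro h; have := heven (by omega); omega
    · rw [hl']
      intro p
      have h3 := bump_cases κ' (q + 2 * m) p
      simp only [counters]
      refine ⟨fun h => ?_, fun h h' => ?_, fun h => ?_⟩
      · have h1 := (hκ p).1 h
        have h2 := bump_cases κ q p
        clear hκ
        omega
      · have h1 := (hκ p).2.1 h h'
        clear hκ
        omega
      · have h1 := (hκ p).2.2 h
        have h4 := bump_cases κ q (p - 2 * m)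
        clear hκ
        omega

theorem Valid.letter_pos {N : ℕ} {κ : ℕ → ℕ} {w : List ℕ} (h : Valid N κ w) :
    ∀ q ∈ w, 0 < q ∧ q < N := by
  induction w generalizing κ with
  | nil => simp
  | cons q w ih =>
    intro x hx
    rcases List.mem_cons.1 hx with rfl | hx
    · exact ⟨h.1.1, h.1.2.1⟩
    · exact ih h.2 x hx

theorem compatible_cableWord {N m l : ℕ} {κ κ' : ℕ → ℕ} {w : List ℕ} (hl : l < N)
    (hκ : Compatible m l κ κ') (hw : Valid N κ w) : Valid (N + 2 * m) κ' (cableWord m l w) ∧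
      Compatible m (runAt l w) (counters κ w) (counters κ' (cableWord m l w)) := by
  induction w generalizing l κ κ' with
  | nil => exact ⟨trivial, hκ⟩
  | cons q w ih =>
    obtain ⟨h1, h2⟩ := compatible_block hl hκ hw.1
    obtain ⟨h3, h4⟩ := ih (swapLetter_lt hw.1.2.1 hl) h2 hw.2
    refine ⟨(valid_append _ _ _ _).2 ⟨h1, h3⟩, ?_⟩
    rw [cableWord, counters_append]
    exact h4

/-- The number of letters that move the wire that starts at `x`. -/
def touches : ℕ → List ℕ → ℕ
  | _, [] => 0
  | x, q :: w => (if Touches q x then 1 else 0) + touches (swapLetter q x) w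

theorem cross_self (x : ℕ) (w : List ℕ) : cross x x w = 0 := by
  induction w generalizing x with
  | nil => rfl
  | cons q w ih =>
    simp only [cross, ih]
    rw [if_neg (by omega)]

theorem swapLetter_swapLetter {q : ℕ} (hq : 0 < q) (x : ℕ) :
    swapLetter q (swapLetter q x) = x := by
  unfold swapLetter
  split_ifs <;> omega

/-- Each letter that moves the wire exchanges it with exactly one other wire. -/
theorem sum_cross_eq_touches (N l : ℕ) (w : List ℕ) (hl : l < N) (hw : ∀ q ∈ w, 0 < q ∧ q < N) :
    ∑ x ∈ Finset.range N, cross x l w = touches l w := by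
  induction w generalizing l with
  | nil => simp [cross, touches]
  | cons q w ih =>
    obtain ⟨hq, hqN⟩ := hw q (by simp)
    simp only [cross, touches, Finset.sum_add_distrib]
    rw [← ih (swapLetter q l) (swapLetter_lt hqN hl) fun p hp => hw p (by simp [hp])]
    congr 1
    · by_cases h : Touches q l
      · rw [if_pos h, Finset.sum_eq_single (swapLetter q l)]
        · rw [if_pos]
          have := swapLetter_cases q l
          unfold Touches at h
          omega
        · intro x hx hne
          rw [if_neg]
          have := swapLetter_cases q l
          unfold Touches at h
          omega
        · intro hx
          exact absurd (Finset.mem_range.2 (swapLetter_lt hqN hl)) hx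
      · rw [if_neg h]
        refine Finset.sum_eq_zero fun x _ => if_neg ?_
        unfold Touches at h
        omega
    -- The rest of the word starts from permuted positions; the sum is reindexed along the
    -- involution `swapLetter q`.
    · refine Finset.sum_nbij (swapLetter q) ?_ ?_ ?_ fun _ _ => rfl
      · intro x hx
        exact Finset.mem_range.2 (swapLetter_lt hqN (Finset.mem_range.1 hx))
      · exact (swapLetter_injective q).injOn
      · intro x hx
        exact ⟨swapLetter q x, Finset.mem_coe.2 (Finset.mem_range.2 (swapLetter_lt hqN
          (Finset.mem_range.1 (Finset.mem_coe.1 hx)))), swapLetter_swapLetter hq x⟩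

theorem runAt_ne {x y : ℕ} (h : x ≠ y) (w : List ℕ) : runAt x w ≠ runAt y w := by
  induction w generalizing x y with
  | nil => exact h
  | cons q w ih => exact ih fun e => h (swapLetter_injective q e)

/-! ### Positions, crossings and bottom visits in the cabled word -/

section CableWord

variable {m l : ℕ} {w : List ℕ}

theorem runAt_cableWord_lift {x : ℕ} (hw : ∀ q ∈ w, 0 < q) (hx : x ≠ l) :
    runAt (lift m l x) (cableWord m l w) = lift m (runAt l w) (runAt x w) := by
  induction w generalizing l x with
  | nil => rfl
  | cons q w ih =>
    rw [cableWord, runAt_append, runAt_block_lift _ _ _ _ (hw q (by simp)) hx,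
      ih (fun p hp => hw p (by simp [hp])) fun e => hx (swapLetter_injective q e)]
    rfl

/-- The phase after `t` columns. -/
def phaseAfter (n φ t : ℕ) : ℕ := (φ + t) % (2 * n)

theorem phaseAfter_zero {n φ : ℕ} (h : φ < 2 * n) : phaseAfter n φ 0 = φ := Nat.mod_eq_of_lt h

theorem phaseAfter_nextPhase {n φ : ℕ} (t : ℕ) :
    phaseAfter n (nextPhase n φ) t = phaseAfter n φ (1 + t) := by
  unfold phaseAfter nextPhase
  split_ifs with h1
  · rw [show φ + (1 + t) = 0 + t + 2 * n by omega, Nat.add_mod_right]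
  · congr 1; omega

theorem nextPhase_lt {n φ : ℕ} (h : φ < 2 * n) : nextPhase n φ < 2 * n := by
  unfold nextPhase; split_ifs <;> omega

theorem nextPhase_parity {n φ l q : ℕ} (h : φ % 2 = l % 2) (hq : 0 < q) :
    (if Touches q l then nextPhase n φ else φ) % 2 = swapLetter q l % 2 := by
  unfold nextPhase swapLetter Touches
  split_ifs <;> omega

theorem runAt_cableWord_zigzag {φ : ℕ} (hw : ∀ q ∈ w, 0 < q) (hφ : φ < 2 * (2 * m + 1))
    (h : φ % 2 = l % 2) : runAt (l + zigzag (2 * m + 1) φ) (cableWord m l w) =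
      runAt l w + zigzag (2 * m + 1) (phaseAfter (2 * m + 1) φ (touches l w)) := by
  induction w generalizing l φ with
  | nil => simp only [runAt, cableWord, touches, phaseAfter_zero hφ]
  | cons q w ih =>
    have hq := hw q (by simp)
    have hlt : (if Touches q l then nextPhase (2 * m + 1) φ else φ) < 2 * (2 * m + 1) := by
      split_ifs
      · exact nextPhase_lt hφ
      · exact hφ
    rw [cableWord, runAt_append, runAt_block_zigzag _ _ _ _ hq hφ h,
      ih (fun p hp => hw p (by simp [hp])) hlt (nextPhase_parity h hq)]
    simp only [runAt, touches]
    congr 2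
    split_ifs
    · exact phaseAfter_nextPhase _
    · rw [zero_add]

theorem cross_cableWord_lift_lift {x y : ℕ} (hw : ∀ q ∈ w, 0 < q) (hx : x ≠ l) (hy : y ≠ l) :
    cross (lift m l x) (lift m l y) (cableWord m l w) = cross x y w := by
  induction w generalizing l x y with
  | nil => rfl
  | cons q w ih =>
    have hq := hw q (by simp)
    rw [cableWord, cross_append, cross_block_lift_lift _ _ _ _ _ hq hx hy,
      runAt_block_lift _ _ _ _ hq hx, runAt_block_lift _ _ _ _ hq hy,
      ih (fun p hp => hw p (by simp [hp])) (fun e => hx (swapLetter_injective q e))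
        fun e => hy (swapLetter_injective q e)]
    rfl

theorem cross_cableWord_lift_zigzag {x φ : ℕ} (hw : ∀ q ∈ w, 0 < q) (hx : x ≠ l)
    (hφ : φ < 2 * (2 * m + 1)) (h : φ % 2 = l % 2) :
    cross (lift m l x) (l + zigzag (2 * m + 1) φ) (cableWord m l w) = cross x l w := by
  induction w generalizing l x φ with
  | nil => rfl
  | cons q w ih =>
    have hq := hw q (by simp)
    have hlt : (if Touches q l then nextPhase (2 * m + 1) φ else φ) < 2 * (2 * m + 1) := by
      split_ifs
      · exact nextPhase_lt hφ
      · exact hφ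
    rw [cableWord, cross_append, cross_block_lift_zigzag _ _ _ _ _ hq hx hφ h,
      runAt_block_lift _ _ _ _ hq hx, runAt_block_zigzag _ _ _ _ hq hφ h,
      ih (fun p hp => hw p (by simp [hp])) (fun e => hx (swapLetter_injective q e)) hlt
        (nextPhase_parity h hq)]
    rfl

/-- All phases advance simultaneously, once per crossing of the old wire, so the crossings inside
the cable are counted column by column. -/
theorem cross_cableWord_zigzag_zigzag {φ ψ : ℕ} (hw : ∀ q ∈ w, 0 < q)
    (hφ : φ < 2 * (2 * m + 1)) (h : φ % 2 = l % 2) (hψ : ψ < 2 * (2 * m + 1)) (h' : ψ % 2 = l % 2)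
    (hne : φ ≠ ψ) :
    cross (l + zigzag (2 * m + 1) φ) (l + zigzag (2 * m + 1) ψ) (cableWord m l w) =
      ∑ t ∈ Finset.range (touches l w), if phaseAfter (2 * m + 1) φ t + phaseAfter (2 * m + 1) ψ t
        + 2 = 2 * (2 * m + 1) then 1 else 0 := by
  induction w generalizing l φ ψ with
  | nil => rfl
  | cons q w ih =>
    have hq := hw q (by simp)
    have hlt : ∀ φ < 2 * (2 * m + 1),
        (if Touches q l then nextPhase (2 * m + 1) φ else φ) < 2 * (2 * m + 1) := by
      intro φ hφ
      split_ifs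
      · exact nextPhase_lt hφ
      · exact hφ
    rw [cableWord, cross_append, cross_block_zigzag_zigzag _ _ _ _ _ hq hφ h hψ h' hne,
      runAt_block_zigzag _ _ _ _ hq hφ h, runAt_block_zigzag _ _ _ _ hq hψ h',
      ih (fun p hp => hw p (by simp [hp])) (hlt φ hφ) (nextPhase_parity h hq) (hlt ψ hψ)
        (nextPhase_parity h' hq)]
    · simp only [touches]
      split_ifs with h1 h2 h3
      · rw [add_comm 1 (touches _ _), Finset.sum_range_succ', add_comm, phaseAfter_zero hφ,
          phaseAfter_zero hψ, if_pos h1.2]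
        simp only [phaseAfter_nextPhase, phaseAfter_nextPhase, add_comm 1]
      · exact absurd h1.1 h2
      · rw [add_comm 1 (touches _ _), Finset.sum_range_succ', add_comm, phaseAfter_zero hφ,
          phaseAfter_zero hψ, if_neg fun e => h1 ⟨h3, e⟩]
        simp only [phaseAfter_nextPhase, phaseAfter_nextPhase, add_comm 1]
      · rw [zero_add, zero_add]
    · unfold nextPhase
      split_ifs <;> omega

/-- The two phases are distinct residues, so the equation is equivalent to `φ + ψ + 2 * t + 2 ≡ 0`
modulo `2 * n`. As `φ + ψ` is even, this is a congruence for `t` modulo `n`, with two solutions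
among `2 * n` columns. -/
theorem sum_phases_eq_two {n φ ψ : ℕ} (hφ : φ < ψ) (hψ : ψ < 2 * n) (h : φ % 2 = ψ % 2) :
    ∑ t ∈ Finset.range (2 * n), (if phaseAfter n φ t + phaseAfter n ψ t + 2 = 2 * n then 1 else 0)
      = 2 := by
  have hmod : ∀ φ < 2 * n, ∀ t < 2 * n, phaseAfter n φ t =
      if φ + t < 2 * n then φ + t else φ + t - 2 * n := by
    intro φ h1 t h2
    unfold phaseAfter
    split_ifs with h3
    · exact Nat.mod_eq_of_lt h3
    · rw [Nat.mod_eq_sub_mod (by omega), Nat.mod_eq_of_lt (by omega)]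
  set s := (φ + ψ) / 2 + 1 with hs
  rw [← Finset.sum_filter, Finset.sum_const, smul_eq_mul, mul_one]
  -- The solutions are the residues of `-s` modulo `n` that lie below `2 * n`; they are `n` apart.
  have : Finset.filter (fun t => phaseAfter n φ t + phaseAfter n ψ t + 2 = 2 * n)
      (Finset.range (2 * n)) = {2 * n - s, if s ≤ n then n - s else 3 * n - s} := by
    ext t
    simp only [Finset.mem_filter, Finset.mem_range, Finset.mem_insert, Finset.mem_singleton]
    constructor
    · rintro ⟨h1, h2⟩
      rw [hmod φ (by omega) t h1, hmod ψ hψ t h1] at h2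
      split_ifs at h2 ⊢ <;> omega
    · intro h1
      have h2 : t < 2 * n := by split_ifs at h1 <;> omega
      refine ⟨h2, ?_⟩
      rw [hmod φ (by omega) t h2, hmod ψ hψ t h2]
      split_ifs at h1 ⊢ <;> omega
  rw [this, Finset.card_pair]
  split_ifs <;> omega

theorem not_mem_pairSwaps {s p : ℕ} (h : p < s) (k : ℕ) : p ∉ pairSwaps s k := by
  induction k generalizing s with
  | zero => simp [pairSwaps]
  | succ k ih => simp only [pairSwaps, List.mem_cons, not_or]; exact ⟨by omega, ih (by omega)⟩

theorem not_mem_upRun {a p : ℕ} (h : p < a) (k : ℕ) : p ∉ upRun a k := by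
  induction k generalizing a with
  | zero => simp [upRun]
  | succ k ih => simp only [upRun, List.mem_cons, not_or]; exact ⟨by omega, ih (by omega)⟩

theorem not_mem_downRun {a p : ℕ} (h : p < a) (k : ℕ) : p ∉ downRun a k := by
  induction k with
  | zero => simp [downRun]
  | succ k ih => simp only [downRun, List.mem_cons, not_or]; exact ⟨by omega, ih⟩

theorem mem_upRun (a k : ℕ) : a + k ∈ upRun a (k + 1) := by
  induction k generalizing a with
  | zero => simp [upRun]
  | succ k ih =>
    rw [upRun, List.mem_cons, show a + (k + 1) = a + 1 + k by omega]
    exact Or.inr (ih _)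

theorem visits_eq_zero {p : ℕ} (x : ℕ) {u : List ℕ} (h : p ∉ u) : visits p x u = 0 := by
  induction u generalizing x with
  | nil => rfl
  | cons q u ih =>
    simp only [List.mem_cons, not_or] at h
    simp only [visits, ih _ h.2]
    rw [if_neg (by omega)]

/-- The swaps use letters above `l ≥ 1`. A run starts at `l` only when `q = l`, in which case `l ≠
1`, and otherwise at `l + 1`. -/
theorem one_not_mem_block {q : ℕ} (hl : 0 < l) (hq : 0 < q) (h1 : q ≠ 1) : 1 ∉ block m l q := by
  unfold block cableSwaps
  split_ifs <;>
    simp only [List.mem_append, not_or, List.mem_singleton] <;>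
    first
    | omega
    | exact ⟨not_mem_pairSwaps (by omega) _, not_mem_upRun (by omega) _⟩
    | exact ⟨not_mem_pairSwaps (by omega) _, not_mem_downRun (by omega) _⟩

/-- The distinguished wire never reaches the bottom position. -/
theorem swapLetter_pos_of_visits {q : ℕ} (hl : 0 < l) (h : visits 1 l (q :: w) = 0) :
    0 < swapLetter q l ∧ visits 1 (swapLetter q l) w = 0 ∧ ¬ (q = 1 ∧ Touches q l) := by
  simp only [visits] at h
  have := swapLetter_cases q l
  split_ifs at h with h1
  · omega
  · refine ⟨by omega, by omega, h1⟩

theorem visits_cableWord_lift {x : ℕ} (hw : ∀ q ∈ w, 0 < q) (hx : x ≠ l) (hl : 0 < l)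
    (h : visits 1 l w = 0) : visits 1 (lift m l x) (cableWord m l w) = visits 1 x w := by
  induction w generalizing l x with
  | nil => rfl
  | cons q w ih =>
    have hq := hw q (by simp)
    obtain ⟨h1, h2, h3⟩ := swapLetter_pos_of_visits hl h
    rw [cableWord, visits_append, runAt_block_lift _ _ _ _ hq hx,
      ih (fun p hp => hw p (by simp [hp])) (fun e => hx (swapLetter_injective q e)) h1 h2]
    simp only [visits]
    congr 1
    by_cases c : q = 1
    · subst c
      rw [block, if_pos (by omega)]
      simp only [visits]
      unfold lift
      split_ifs <;> omega
    · rw [visits_eq_zero _ (one_not_mem_block hl hq c), if_neg (by omega)]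

theorem visits_cableWord_zigzag {φ : ℕ} (hw : ∀ q ∈ w, 0 < q) (hl : 0 < l)
    (h : visits 1 l w = 0) (hφ : φ < 2 * (2 * m + 1)) (hp : φ % 2 = l % 2) :
    visits 1 (l + zigzag (2 * m + 1) φ) (cableWord m l w) = 0 := by
  induction w generalizing l φ with
  | nil => rfl
  | cons q w ih =>
    have hq := hw q (by simp)
    have hlt : (if Touches q l then nextPhase (2 * m + 1) φ else φ) < 2 * (2 * m + 1) := by
      split_ifs
      · exact nextPhase_lt hφ
      · exact hφ
    obtain ⟨h1, h2, h3⟩ := swapLetter_pos_of_visits hl h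
    rw [cableWord, visits_append, runAt_block_zigzag _ _ _ _ hq hφ hp,
      ih (fun p hp => hw p (by simp [hp])) h1 h2 hlt (nextPhase_parity hp hq)]
    by_cases c : q = 1
    · subst c
      rw [block, if_pos (by omega)]
      simp only [visits]
      rw [if_neg (by omega)]
    · rw [visits_eq_zero _ (one_not_mem_block hl hq c)]

theorem count_one_cableWord (hw : ∀ q ∈ w, 0 < q) (hl : 0 < l)
    (h : visits 1 l w = 0) : (cableWord m l w).count 1 = w.count 1 := by
  induction w generalizing l with
  | nil => rfl
  | cons q w ih =>
    have hq := hw q (by simp)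
    obtain ⟨h1, h2, h3⟩ := swapLetter_pos_of_visits hl h
    rw [cableWord, List.count_append, ih (fun p hp => hw p (by simp [hp])) h1 h2]
    by_cases c : q = 1
    · subst c
      rw [block, if_pos (by omega)]
      simp [add_comm]
    · rw [List.count_eq_zero_of_not_mem (one_not_mem_block hl hq c), List.count_cons_of_ne c]
      simp

theorem count_top_cableWord {N : ℕ} (hw : ∀ q ∈ w, 0 < q ∧ q < N) (hl : l < N) :
    w.count (N - 1) ≤ (cableWord m l w).count (N + 2 * m - 1) := by
  induction w generalizing l with
  | nil => simp
  | cons q w ih =>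
    obtain ⟨hq, hqN⟩ := hw q (by simp)
    rw [cableWord, List.count_append]
    have hrec := ih (fun p hp => hw p (by simp [hp])) (swapLetter_lt hqN hl)
    by_cases c : q = N - 1
    · have : N + 2 * m - 1 ∈ block m l q := by
        unfold block
        split_ifs with c1 c2 c3
        · omega
        · rw [show N + 2 * m - 1 = l + 2 * m by omega]
          exact List.mem_append_right _ (mem_upRun _ _)
        · rw [show N + 2 * m - 1 = l + 1 + 2 * m by omega]
          exact List.mem_append_right _ (by simp [downRun])
        · simp; omega
      have hpos := List.count_pos_iff.2 this
      subst c
      rw [List.count_cons_self]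
      omega
    · rw [List.count_cons_of_ne c]
      omega

end CableWord

end Wiring

/-! ### Saturated words and the induction on the number of wires -/

namespace Wiring

/-- A cyclic sweep word of an arrangement of `N` wires, any two of which cross exactly twice, in
which exactly the odd gaps consist of triangles. The bottom cell is a pentagon, and the wire that
starts at `l` is not incident to it. -/
structure SaturatedWord (N l : ℕ) (w : List ℕ) : Prop where
  even : N % 2 = 0
  l_pos : 0 < l
  l_lt : l < N
  closed : ∀ x < N, runAt x w = x
  cross_two : ∀ x < N, ∀ y < N, x ≠ y → cross x y w = 2
  valid : ∃ κ, Valid N κ w ∧ ∀ p, (p % 2 = 1 → counters κ w p = κ p) ∧ κ p ≤ counters κ w p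
  bottom : w.count 1 = 5
  top : 4 ≤ w.count (N - 1)
  visits : ∀ x < N, visits 1 x w = 0 ∨ visits 1 x w = 2
  visits_l : Wiring.visits 1 l w = 0

theorem Valid.le_pos {N : ℕ} {κ : ℕ → ℕ} {w : List ℕ} (h : Valid N κ w) :
    ∀ q ∈ w, 0 < q := fun q hq => (h.letter_pos q hq).1

theorem SaturatedWord.touches_eq {N l : ℕ} {w : List ℕ} (h : SaturatedWord N l w) :
    touches l w = 2 * (N - 1) := by
  obtain ⟨κ, hκ, -⟩ := h.valid
  rw [← sum_cross_eq_touches N l w h.l_lt hκ.letter_pos,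
    ← Finset.sum_erase_add _ _ (Finset.mem_range.2 h.l_lt), cross_self, add_zero,
    Finset.sum_congr rfl (g := fun _ => 2), Finset.sum_const,
    Finset.card_erase_of_mem (Finset.mem_range.2 h.l_lt)]
  · simp [mul_comm]
  · intro x hx
    simp only [Finset.mem_erase, Finset.mem_range] at hx
    exact h.cross_two x hx.2 l h.l_lt hx.1

/-- Every position outside the cable comes from an old wire, and every position inside it from a
phase of the right parity. The last implication keeps track of the range of the old position. -/
theorem exists_lift_or_zigzag (m l x : ℕ) : (∃ y, y ≠ l ∧ x = lift m l y ∧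
      (x < 2 * m + 2 + 2 * m → l < 2 * m + 2 → y < 2 * m + 2)) ∨
    ∃ φ, φ < 2 * (2 * m + 1) ∧ φ % 2 = l % 2 ∧ x = l + zigzag (2 * m + 1) φ := by
  by_cases h1 : x < l
  · refine Or.inl ⟨x, h1.ne, by rw [lift, if_pos h1], by omega⟩
  by_cases h2 : l + 2 * m < x
  · refine Or.inl ⟨x - 2 * m, by omega, by rw [lift, if_neg (by omega)]; omega, by omega⟩
  -- Even positions belong to climbing wires, odd positions to descending ones.
  · refine Or.inr ⟨if x % 2 = 0 then x - l else 2 * (2 * m + 1) - 1 - (x - l), ?_, ?_, ?_⟩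
    · split_ifs <;> omega
    · split_ifs <;> omega
    · unfold zigzag
      split_ifs <;> omega

/-- The size of the cable is forced: the old wire has `2 * (2 * m + 1)` crossings, which is one full
period of the phases of `2 * m + 1` cable wires. So every cable wire returns to its start and any
two meet twice. The gap `1` is not affected because the old wire never comes there. -/
theorem SaturatedWord.cable {m l : ℕ} {w : List ℕ} (h : SaturatedWord (2 * m + 2) l w) :
    SaturatedWord (2 * m + 2 + 2 * m) l (cableWord m l w) := by
  obtain ⟨κ, hκ, hκ'⟩ := h.valid
  have hw := hκ.le_pos
  have hl := h.closed l h.l_lt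
  have hper : ∀ φ < 2 * (2 * m + 1), phaseAfter (2 * m + 1) φ (touches l w) = φ := by
    intro φ hφ
    rw [h.touches_eq, show 2 * (2 * m + 2 - 1) = 2 * (2 * m + 1) by omega, phaseAfter,
      Nat.add_mod_right, Nat.mod_eq_of_lt hφ]
  have h_two : ∀ φ ψ, φ < ψ → ψ < 2 * (2 * m + 1) → φ % 2 = l % 2 → ψ % 2 = l % 2 →
      cross (l + zigzag (2 * m + 1) φ) (l + zigzag (2 * m + 1) ψ) (cableWord m l w) = 2 := by
    intro φ ψ h1 h2 h3 h4
    rw [cross_cableWord_zigzag_zigzag hw (h1.trans h2) h3 h2 h4 h1.ne, h.touches_eq,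
      show 2 * (2 * m + 2 - 1) = 2 * (2 * m + 1) by omega]
    exact sum_phases_eq_two h1 h2 (h3.trans h4.symm)
  refine ⟨by omega, h.l_pos, by have := h.l_lt; omega, fun x hx => ?_, fun x hx y hy hne => ?_,
    ?_, ?_, ?_, fun x hx => ?_, ?_⟩
  · rcases exists_lift_or_zigzag m l x with ⟨y, h1, rfl, h2⟩ | ⟨φ, h1, h2, rfl⟩
    · rw [runAt_cableWord_lift hw h1, hl, h.closed y (h2 hx h.l_lt)]
    · rw [runAt_cableWord_zigzag hw h1 h2, hl, hper φ h1]
  · rcases exists_lift_or_zigzag m l x with ⟨x, h1, rfl, h2⟩ | ⟨φ, h1, h2, rfl⟩ <;>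
      rcases exists_lift_or_zigzag m l y with ⟨y, h3, rfl, h4⟩ | ⟨ψ, h3, h4, rfl⟩
    · rw [cross_cableWord_lift_lift hw h1 h3]
      exact h.cross_two _ (h2 hx h.l_lt) _ (h4 hy h.l_lt) fun e => hne (by rw [e])
    · rw [cross_cableWord_lift_zigzag hw h1 h3 h4]
      exact h.cross_two _ (h2 hx h.l_lt) _ h.l_lt h1
    · rw [cross_comm, cross_cableWord_lift_zigzag hw h3 h1 h2]
      exact h.cross_two _ (h4 hy h.l_lt) _ h.l_lt h3
    · rcases lt_trichotomy φ ψ with h5 | h5 | h5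
      · exact h_two _ _ h5 h3 h2 h4
      · exact absurd (by rw [h5]) hne
      · rw [cross_comm]
        exact h_two _ _ h5 h1 h4 h2
  -- Inside the cable the initial counters have the value that a run through the cable leaves
  -- behind.
  · let κ' : ℕ → ℕ := fun p => if p ≤ l then κ p else if p < l + 2 * m + 1 then 1 else κ (p - 2 * m)
    have hc : Compatible m l κ κ' := by
      intro p
      refine ⟨fun h => ?_, fun h h' => ?_, fun h => ?_⟩
      · simp only [κ', if_pos h]; simp
      · simp only [κ', if_neg (not_le.2 h), if_pos h']; simp
      · simp only [κ', if_neg (by omega : ¬ p ≤ l), if_neg (by omega : ¬ p < l + 2 * m + 1)]; simp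
    obtain ⟨h1, h2⟩ := compatible_cableWord h.l_lt hc hκ
    rw [hl] at h2
    refine ⟨κ', h1, fun p => ?_⟩
    have h4 := hκ' p
    have h5 := hκ' (p - 2 * m)
    generalize counters κ' (cableWord m l w) = κ₁ at h2 ⊢
    have h6 : κ' p = if p ≤ l then κ p else if p < l + 2 * m + 1 then 1 else κ (p - 2 * m) := rfl
    split_ifs at h6 with h7 h8
    · have h3 := (h2 p).1 h7
      omega
    · have h3 := (h2 p).2.1 (by omega) h8
      omega
    · have h3 := (h2 p).2.2 (by omega)
      omega
  · rw [count_one_cableWord hw h.l_pos h.visits_l, h.bottom]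
  · exact h.top.trans (count_top_cableWord hκ.letter_pos h.l_lt)
  · rcases exists_lift_or_zigzag m l x with ⟨y, h1, rfl, h2⟩ | ⟨φ, h1, h2, rfl⟩
    · rw [visits_cableWord_lift hw h1 h.l_pos h.visits_l]
      exact h.visits y (h2 hx h.l_lt)
    · exact Or.inl (visits_cableWord_zigzag hw h.l_pos h.visits_l h1 h2)
  · rcases exists_lift_or_zigzag m l l with ⟨y, h1, h3, h2⟩ | ⟨φ, h1, h2, h3⟩
    · unfold lift at h3
      split_ifs at h3 <;> omega
    · have := visits_cableWord_zigzag (m := m) hw h.l_pos h.visits_l h1 h2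
      rwa [← h3] at this

theorem counters_of_far {κ : ℕ → ℕ} {w : List ℕ} {p : ℕ} (h : ∀ q ∈ w, q + 1 < p) :
    counters κ w p = κ p := by
  induction w generalizing κ with
  | nil => rfl
  | cons q w ih =>
    have hq := h q (by simp)
    rw [counters, ih fun x hx => h x (by simp [hx])]
    unfold bump
    rw [if_neg (by omega), if_neg (by omega)]

instance decidableValid (N : ℕ) : ∀ (κ : ℕ → ℕ) (w : List ℕ), Decidable (Valid N κ w)
  | _, [] => isTrue trivial
  | κ, q :: w =>
    @instDecidableAnd _ _ (by unfold Admissible; infer_instance) (decidableValid N (bump κ q) w)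

/-- The sweep word of the icosidodecahedron. -/
def icosidodecahedronWord : List ℕ :=
  [3, 2, 1, 3, 4, 5, 3, 2, 1, 3, 4, 5, 3, 2, 1, 3, 4, 5, 3, 2, 1, 3, 4, 5, 3, 2, 1, 3, 4, 5]

theorem saturatedWord_icosidodecahedron : SaturatedWord 6 2 icosidodecahedronWord where
  even := rfl
  l_pos := by norm_num
  l_lt := by norm_num
  closed := by decide
  cross_two := by decide
  valid := by
    -- The word repeats `3, 2, 1, 3, 4, 5` five times; on the gaps `1` to `5` these are the counters
    -- that one round leaves behind.
    refine ⟨fun p => if p = 3 ∨ p = 4 then 1 else if p = 2 then 2 else 0, by decide, fun p => ?_⟩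
    by_cases hp : p < 7
    · revert p
      decide
    · rw [counters_of_far]
      · simp
      · have : ∀ q ∈ icosidodecahedronWord, q + 1 < 7 := by decide
        exact fun q hq => (this q hq).trans_le (by omega)
  bottom := by decide
  top := by decide
  visits := by decide
  visits_l := by decide

theorem exists_saturatedWord (n : ℕ) : ∃ N ≥ n, ∃ l w, 6 ≤ N ∧ SaturatedWord N l w := by
  induction n with
  | zero => exact ⟨6, by omega, 2, _, le_rfl, saturatedWord_icosidodecahedron⟩
  | succ n ih =>
    obtain ⟨N, h1, l, w, h2, h3⟩ := ih
    obtain ⟨m, rfl⟩ : ∃ m, N = 2 * m + 2 := ⟨N / 2 - 1, by have := h3.even; omega⟩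
    -- The number of wires grows from `N` to `2 * N - 2`, which is larger because `6 ≤ N`.
    exact ⟨_, by omega, l, _, by omega, h3.cable⟩

end Wiring

/-! ### Periodic diagrams -/

namespace Wiring

/-- A periodic wiring diagram of `N` wires: at time `k` the letter `ev k` is applied (`0` means that
nothing happens), `σ k i` is the position of the wire `i` between the times `k` and `k + 1`. -/
structure Diagram (N : ℕ) (K : ℤ) (ev : ℤ → ℕ) (σ : ℤ → Fin N → ℕ) : Prop where
  six_le : 6 ≤ N
  even : N % 2 = 0
  K_pos : 0 < K
  K_mod : K % 4 = 0
  ev_lt : ∀ k, ev k < N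
  ev_mod : ∀ k, ev k ≠ 0 → k % 4 = 2
  ev_per : ∀ k, ev (k + K) = ev k
  σ_per : ∀ k i, σ (k + K) i = σ k i
  σ_lt : ∀ k i, σ k i < N
  σ_inj : ∀ k, Function.Injective (σ k)
  step : ∀ k i, σ k i = swapLetter (ev k) (σ (k - 1) i)
  cross_two : ∀ i j, i ≠ j →
    ((Finset.Ico 0 K).filter fun k => Exchanges (ev k) (σ k i) (σ k j)).card = 2
  -- The condition `ev k ≠ 0` matters for `p = 1`, where idle times would otherwise count as letters
  -- of a neighbouring gap.
  cell : ∀ p u v, 0 < p → u < v → ev u = p → ev v = p → (∀ k, u < k → k < v → ev k ≠ p) →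
    (((Finset.Ioo u v).filter fun k => ev k = p + 1 ∨ (ev k + 1 = p ∧ ev k ≠ 0)).card = 1 ↔
      p % 2 = 1)
  bottom : ((Finset.Ico 0 K).filter fun k => ev k = 1).card = 5
  top : 4 ≤ ((Finset.Ico 0 K).filter fun k => ev k = N - 1).card
  visits : ∀ i, ((Finset.Ico 0 K).filter fun k => ev k = 1 ∧ σ k i ≤ 1).card = 0 ∨
    ((Finset.Ico 0 K).filter fun k => ev k = 1 ∧ σ k i ≤ 1).card = 2

/-! ### The periodic continuation of a word -/

section Unroll

variable (w : List ℕ)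

/-- The letters of the periodic continuation of `w`. -/
def letterAt (t : ℤ) : ℕ := w.getD (t % w.length).toNat 0

def stateAt (t : ℤ) (x : ℕ) : ℕ := runAt x (w.take (t % w.length).toNat)

theorem cross_eq_sum (x y : ℕ) : cross x y w = ∑ t ∈ Finset.range w.length,
    if Exchanges (w.getD t 0) (runAt x (w.take t)) (runAt y (w.take t)) then 1 else 0 := by
  induction w generalizing x y with
  | nil => rfl
  | cons q w ih =>
    rw [cross, ih, List.length_cons, Finset.sum_range_succ', add_comm]
    rfl

theorem visits_eq_sum (p x : ℕ) : visits p x w = ∑ t ∈ Finset.range w.length,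
    if w.getD t 0 = p ∧ (runAt x (w.take t) + 1 = w.getD t 0 ∨ runAt x (w.take t) = w.getD t 0)
      then 1 else 0 := by
  induction w generalizing x with
  | nil => rfl
  | cons q w ih =>
    rw [visits, ih, List.length_cons, Finset.sum_range_succ', add_comm]
    rfl

theorem count_eq_sum (p : ℕ) : w.count p = ∑ t ∈ Finset.range w.length,
    if w.getD t 0 = p then 1 else 0 := by
  induction w with
  | nil => rfl
  | cons q w ih =>
    rw [List.count_cons, ih, List.length_cons, Finset.sum_range_succ']
    simp

variable {w}

theorem letterAt_add (t c : ℤ) : letterAt w (t + c * w.length) = letterAt w t := by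
  simp [letterAt]

theorem letterAt_natCast {t : ℕ} (h : t < w.length) : letterAt w t = w.getD t 0 := by
  rw [letterAt, Int.emod_eq_of_lt (by omega) (by omega), Int.toNat_natCast]

theorem stateAt_natCast {t : ℕ} (h : t < w.length) (x : ℕ) :
    stateAt w t x = runAt x (w.take t) := by
  rw [stateAt, Int.emod_eq_of_lt (by omega) (by omega), Int.toNat_natCast]

theorem letterAt_mem (hw : w ≠ []) (t : ℤ) : letterAt w t ∈ w := by
  have h0 : 0 < w.length := List.length_pos_iff.2 hw
  have h1 := Int.emod_nonneg t (by omega : (w.length : ℤ) ≠ 0)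
  have h2 := Int.emod_lt_of_pos t (by omega : 0 < (w.length : ℤ))
  rw [letterAt, List.getD_eq_getElem _ _ (by omega)]
  exact List.getElem_mem _

theorem stateAt_succ (hw : w ≠ []) {x : ℕ} (hx : runAt x w = x) (t : ℤ) :
    stateAt w (t + 1) x = swapLetter (letterAt w t) (stateAt w t x) := by
  have h0 : 0 < w.length := List.length_pos_iff.2 hw
  have h1 := Int.emod_nonneg t (by omega : (w.length : ℤ) ≠ 0)
  have h2 := Int.emod_lt_of_pos t (by omega : 0 < (w.length : ℤ))
  obtain ⟨r, hr⟩ := Int.eq_ofNat_of_zero_le h1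
  have hr' : r < w.length := by omega
  have h3 : runAt x (w.take (r + 1)) = swapLetter (letterAt w t) (stateAt w t x) := by
    rw [letterAt, stateAt, hr, Int.toNat_natCast, List.getD_eq_getElem _ _ hr',
      List.take_succ_eq_append_getElem hr', runAt_append]
    rfl
  rw [← h3, stateAt, Int.add_emod, hr]
  rcases Nat.lt_or_ge (r + 1) w.length with h | h
  · congr 2
    have : (1 : ℤ) % w.length = 1 := Int.emod_eq_of_lt (by omega) (by omega)
    rw [this, Int.emod_eq_of_lt (by omega) (by omega)]
    omega
  · have hr1 : r + 1 = w.length := by omega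
    have : ((r : ℤ) + 1 % w.length) % w.length = 0 := by
      rw [Int.add_emod_emod, show (r : ℤ) + 1 = w.length by omega, Int.emod_self]
    rw [this, hr1, List.take_length, hx]
    rfl

theorem stateAt_lt {N : ℕ} (hw : ∀ q ∈ w, q < N) {x : ℕ} (hx : x < N) (t : ℤ) :
    stateAt w t x < N := by
  unfold stateAt
  have h : ∀ u : List ℕ, (∀ q ∈ u, q < N) → ∀ x < N, runAt x u < N := by
    intro u
    induction u with
    | nil => exact fun _ x hx => hx
    | cons q u ih =>
      intro h x hx
      exact ih (fun p hp => h p (by simp [hp])) _ (swapLetter_lt (h q (by simp)) hx)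
  exact h _ (fun q hq => hw q (List.mem_of_mem_take hq)) x hx

/-- The counters of the periodic continuation of `w`. -/
def countersAt (w : List ℕ) (κ : ℕ → ℕ) : ℕ → (ℕ → ℕ)
  | 0 => κ
  | t + 1 => bump (countersAt w κ t) (letterAt w t)

theorem countersAt_eq_counters (κ : ℕ → ℕ) {t : ℕ} (ht : t ≤ w.length) :
    countersAt w κ t = counters κ (w.take t) := by
  induction t with
  | zero => rfl
  | succ t ih =>
    rw [countersAt, ih (by omega), List.take_succ_eq_append_getElem (by omega), counters_append,
      letterAt_natCast (by omega), List.getD_eq_getElem _ _ (by omega)]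
    rfl

/-- The letters repeat and `bump` respects both equality and order, so the comparison after one
period propagates to all later times. -/
theorem countersAt_mono {κ : ℕ → ℕ}
    (hκ : ∀ p, (p % 2 = 1 → counters κ w p = κ p) ∧ κ p ≤ counters κ w p) (t p : ℕ) :
    (p % 2 = 1 → countersAt w κ (t + w.length) p = countersAt w κ t p) ∧
      countersAt w κ t p ≤ countersAt w κ (t + w.length) p := by
  induction t generalizing p with
  | zero =>
    rw [zero_add, countersAt_eq_counters κ le_rfl, List.take_length]
    exact hκ p
  | succ t ih =>
    rw [show t + 1 + w.length = t + w.length + 1 by omega, countersAt, countersAt]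
    have : letterAt w ((t + w.length : ℕ) : ℤ) = letterAt w t := by
      have := letterAt_add (w := w) t 1
      rwa [one_mul] at this
    rw [this]
    have h1 := ih p
    have h2 := bump_cases (countersAt w κ t) (letterAt w t) p
    have h3 := bump_cases (countersAt w κ (t + w.length)) (letterAt w t) p
    omega

theorem admissible_countersAt {N : ℕ} {κ : ℕ → ℕ} (hw : w ≠ []) (h : Valid N κ w)
    (hκ : ∀ p, (p % 2 = 1 → counters κ w p = κ p) ∧ κ p ≤ counters κ w p) (t : ℕ) :
    Admissible N (countersAt w κ t) (letterAt w t) := by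
  have h0 : 0 < w.length := List.length_pos_iff.2 hw
  induction t using Nat.strong_induction_on with
  | _ t ih =>
    rcases Nat.lt_or_ge t w.length with ht | ht
    · rw [countersAt_eq_counters κ ht.le, letterAt_natCast ht]
      rw [← List.take_append_drop t w, valid_append] at h
      have h2 := h.2
      rw [List.drop_eq_getElem_cons ht] at h2
      rw [List.getD_eq_getElem _ _ ht]
      exact h2.1
    · obtain ⟨h1, h2, h3, h4⟩ := ih (t - w.length) (by omega)
      have e : letterAt w t = letterAt w ((t - w.length : ℕ) : ℤ) := by
        have := letterAt_add (w := w) ((t - w.length : ℕ) : ℤ) 1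
        rw [← this]
        congr 1
        push_cast [ht]
        ring
      have h5 := countersAt_mono hκ (t - w.length) (letterAt w t)
      rw [Nat.sub_add_cancel ht] at h5
      rw [← e] at h1 h2 h3 h4
      refine ⟨h1, h2, fun h => ?_, fun h => ?_⟩
      · rw [h5.1 h, h3 h]
      · exact (h4 h).trans h5.2

/-- Once the letter `p` has occurred, its counter no longer depends on the initial values and is an
honest count. -/
theorem countersAt_eq_card (κ : ℕ → ℕ) {a b p : ℕ} (hab : a < b) (ha : letterAt w a = p)
    (hb : ∀ t, a < t → t < b → letterAt w t ≠ p) : countersAt w κ b p =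
      ((Finset.Ioo a b).filter fun t : ℕ => letterAt w t = p + 1 ∨ letterAt w t + 1 = p).card := by
  induction b, hab using Nat.le_induction with
  | base =>
    have : Finset.Ioo a (a + 1) = ∅ := by ext; simp
    rw [Nat.succ_eq_add_one, countersAt, this, ha]
    simp [bump]
  | succ b hab ih =>
    have hab' : a < b := hab
    have : Finset.Ioo a (b + 1) = insert b (Finset.Ioo a b) := by
      ext; simp only [Finset.mem_Ioo, Finset.mem_insert]; omega
    rw [countersAt, this, Finset.filter_insert]
    have h1 := ih fun t h1 h2 => hb t h1 (by omega)
    have h2 := hb b hab' (by omega)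
    have h3 := bump_cases (countersAt w κ b) (letterAt w b) p
    split_ifs with h4
    · rw [Finset.card_insert_of_notMem (by simp), ← h1]
      omega
    · omega

theorem card_filter_Ico_four_mul (M : ℕ) (P : ℤ → Prop) [DecidablePred P] (f : ℕ → Prop)
    [DecidablePred f] (hP : ∀ k, P k → k % 4 = 2) (hf : ∀ t < M, P (4 * t + 2) ↔ f t) :
    ((Finset.Ico 0 (4 * (M : ℤ))).filter P).card = ∑ t ∈ Finset.range M, if f t then 1 else 0 := by
  rw [← Finset.sum_filter, Finset.sum_const, smul_eq_mul, mul_one]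
  symm
  refine Finset.card_bij (fun t _ => 4 * (t : ℤ) + 2) ?_ ?_ ?_
  · intro t ht
    simp only [Finset.mem_filter, Finset.mem_range] at ht
    simp only [Finset.mem_filter, Finset.mem_Ico]
    exact ⟨by omega, (hf t ht.1).2 ht.2⟩
  · intro a _ b _ h
    omega
  · intro k hk
    simp only [Finset.mem_filter, Finset.mem_Ico] at hk
    have h4 := hP k hk.2
    have hk' : k = 4 * ((k / 4).toNat : ℤ) + 2 := by omega
    refine ⟨(k / 4).toNat, ?_, hk'.symm⟩
    simp only [Finset.mem_filter, Finset.mem_range]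
    refine ⟨by omega, (hf _ (by omega)).1 ?_⟩
    rw [← hk']
    exact hk.2

end Unroll

/-- The letters at the times `4 * t + 2`. -/
def timedLetter (w : List ℕ) (k : ℤ) : ℕ := if k % 4 = 2 then letterAt w (k / 4) else 0

/-- The shift by `2` makes the position at the time `4 * t + 2` the one after the letter number `t`.
Stretching the times by four leaves `4 * t + 1` and `4 * t + 3` free for the vertices on the
additional curve. -/
def timedPosition (N : ℕ) (w : List ℕ) (k : ℤ) (i : Fin N) : ℕ := stateAt w ((k + 2) / 4) i

theorem timedLetter_four_mul (w : List ℕ) (t : ℤ) :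
    timedLetter w (4 * t + 2) = letterAt w t := by
  rw [timedLetter, if_pos (by omega)]
  congr 1
  omega

theorem exchanges_swapLetter {q : ℕ} (hq : 0 < q) (x y : ℕ) :
    Exchanges q (swapLetter q x) (swapLetter q y) ↔ Exchanges q x y := by
  have h1 := swapLetter_cases q x
  have h2 := swapLetter_cases q y
  unfold Exchanges
  omega

theorem SaturatedWord.diagram {N l : ℕ} {w : List ℕ} (h : SaturatedWord N l w) (hN : 6 ≤ N) :
    Diagram N (4 * w.length) (timedLetter w) (timedPosition N w) := by
  have hne : w ≠ [] := by
    rintro rfl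
    simpa using h.bottom
  have h0 : 0 < w.length := List.length_pos_iff.2 hne
  obtain ⟨κ, hκ, hκ'⟩ := h.valid
  have hmem := letterAt_mem hne
  have hpos : ∀ t, 0 < letterAt w t := fun t => (hκ.letter_pos _ (hmem t)).1
  have hlt : ∀ t, letterAt w t < N := fun t => (hκ.letter_pos _ (hmem t)).2
  have hsucc : ∀ t, ∀ x < N, stateAt w (t + 1) x = swapLetter (letterAt w t) (stateAt w t x) :=
    fun t x hx => stateAt_succ hne (h.closed x hx) t
  have hposition : ∀ (t : ℤ) (i : Fin N), timedPosition N w (4 * t + 2) i =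
      swapLetter (letterAt w t) (stateAt w t i) := by
    intro t i
    rw [timedPosition, ← hsucc t i i.2]
    congr 1
    omega
  have hmod : ∀ k, timedLetter w k ≠ 0 → k % 4 = 2 := by
    intro k hk
    by_contra h
    exact hk (if_neg h)
  refine ⟨hN, h.even, by omega, by omega, fun k => ?_, hmod, fun k => ?_,
    fun k i => ?_, fun k i => ?_, fun k => ?_, fun k i => ?_, fun i j hij => ?_, ?_, ?_, ?_,
    fun i => ?_⟩
  · unfold timedLetter
    split_ifs
    · exact hlt _
    · omega
  · unfold timedLetter
    rw [show (k + 4 * w.length) % 4 = k % 4 by omega,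
      show (k + 4 * w.length) / 4 = k / 4 + 1 * w.length by omega, letterAt_add]
  · unfold timedPosition stateAt
    rw [show (k + 4 * w.length + 2) / 4 = (k + 2) / 4 + w.length by omega, Int.add_emod_right]
  · exact stateAt_lt (fun q hq => (hκ.letter_pos q hq).2) i.2 _
  · intro i j hij
    by_contra hne
    exact runAt_ne (fun e => hne (Fin.ext e)) _ hij
  · by_cases hk : k % 4 = 2
    · obtain ⟨t, rfl⟩ : ∃ t, k = 4 * t + 2 := ⟨k / 4, by omega⟩
      rw [hposition, timedLetter_four_mul, timedPosition]
      congr 2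
      omega
    · rw [timedLetter, if_neg hk, timedPosition, timedPosition]
      have : ∀ x, swapLetter 0 x = x := fun x => by have := swapLetter_cases 0 x; omega
      rw [this]
      congr 1
      omega
  · rw [card_filter_Ico_four_mul w.length _ (fun t => Exchanges (w.getD t 0)
      (runAt i (w.take t)) (runAt j (w.take t)))
      (fun k hk => hmod k fun e => ?_) fun t ht => ?_]
    · rw [← cross_eq_sum]
      exact h.cross_two i i.2 j j.2 fun e => hij (Fin.ext e)
    · rw [e] at hk
      unfold Exchanges at hk
      omega
    · rw [hposition, hposition, timedLetter_four_mul, exchanges_swapLetter (hpos _),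
        letterAt_natCast ht, stateAt_natCast ht, stateAt_natCast ht]
  · intro p u v hp huv hu hv hbetween
    obtain ⟨a, rfl⟩ : ∃ t, u = 4 * t + 2 := ⟨u / 4, by have := hmod u (by omega); omega⟩
    obtain ⟨b, rfl⟩ : ∃ t, v = 4 * t + 2 := ⟨v / 4, by have := hmod v (by omega); omega⟩
    rw [timedLetter_four_mul] at hu hv
    -- The counters are defined at natural times only, so the cell is moved there by whole periods.
    obtain ⟨c, hc⟩ : ∃ c : ℤ, 0 ≤ a + c * w.length := by
      refine ⟨|a|, ?_⟩
      have h1 : |a| * 1 ≤ |a| * w.length :=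
        mul_le_mul_of_nonneg_left (by omega) (abs_nonneg a)
      have h2 := neg_abs_le a
      linarith
    obtain ⟨a', ha'⟩ := Int.eq_ofNat_of_zero_le hc
    obtain ⟨b', hb'⟩ := Int.eq_ofNat_of_zero_le (by omega : 0 ≤ b + c * w.length)
    have hshift : ∀ t : ℤ, letterAt w t = letterAt w (t + c * w.length) :=
      fun t => (letterAt_add t c).symm
    have hadm := admissible_countersAt hne hκ hκ' b'
    rw [hshift, hb'] at hv
    rw [hshift, ha'] at hu
    rw [hv] at hadm
    have hcard := countersAt_eq_card κ (w := w) (b := b') (p := p) (by omega) hu fun t h1 h2 e => by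
      refine hbetween (4 * (t - c * w.length) + 2) (by omega) (by omega) ?_
      rw [timedLetter_four_mul, hshift, sub_add_cancel, e]
    have : ((Finset.Ioo (4 * a + 2) (4 * b + 2)).filter fun k => timedLetter w k = p + 1 ∨
        (timedLetter w k + 1 = p ∧ timedLetter w k ≠ 0)).card = countersAt w κ b' p := by
      rw [hcard]
      symm
      refine Finset.card_bij (fun t _ => 4 * ((t : ℤ) - c * w.length) + 2) ?_ ?_ ?_
      · intro t ht
        simp only [Finset.mem_filter, Finset.mem_Ioo] at ht ⊢
        rw [timedLetter_four_mul, hshift, sub_add_cancel]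
        have := hpos t
        omega
      · intro a _ b _ h
        omega
      · intro k hk
        simp only [Finset.mem_filter, Finset.mem_Ioo] at hk
        have h4 := hmod k (by omega)
        have hk' : k = 4 * (((k / 4 + c * w.length).toNat : ℤ) - c * w.length) + 2 := by omega
        refine ⟨(k / 4 + c * w.length).toNat, ?_, hk'.symm⟩
        rw [hk', timedLetter_four_mul, hshift, sub_add_cancel] at hk
        simp only [Finset.mem_filter, Finset.mem_Ioo]
        omega
    rw [this]
    obtain ⟨-, -, h1, h2⟩ := hadm
    omega
  · rw [card_filter_Ico_four_mul w.length _ (fun t => w.getD t 0 = 1)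
      (fun k hk => hmod k (by omega)) fun t ht => ?_]
    · rw [← count_eq_sum]
      exact h.bottom
    · rw [timedLetter_four_mul, letterAt_natCast ht]
  · rw [card_filter_Ico_four_mul w.length _ (fun t => w.getD t 0 = N - 1)
      (fun k hk => hmod k (by omega)) fun t ht => ?_]
    · rw [← count_eq_sum]
      exact h.top
    · rw [timedLetter_four_mul, letterAt_natCast ht]
  · rw [card_filter_Ico_four_mul w.length _ (fun t => w.getD t 0 = 1 ∧
      (runAt i (w.take t) + 1 = w.getD t 0 ∨ runAt i (w.take t) = w.getD t 0))
      (fun k hk => hmod k (by omega)) fun t ht => ?_]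
    · rw [← visits_eq_sum]
      exact h.visits i i.2
    · rw [hposition, timedLetter_four_mul, letterAt_natCast ht, stateAt_natCast ht]
      have := swapLetter_cases (w.getD t 0) (runAt i (w.take t))
      omega

end Wiring

open Set

/-! ### Closed curves in polar coordinates -/

namespace Pseudocircle

/-- The point with angle `2πx / K` and absolute value `exp r`. -/
noncomputable def polar (K x r : ℝ) : ℂ := Complex.exp (r + (2 * Real.pi * x / K : ℝ) * Complex.I)

theorem continuous_polar (K : ℝ) : Continuous fun p : ℝ × ℝ => polar K p.1 p.2 := by
  unfold polar
  fun_prop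

theorem polar_ne_zero (K x r : ℝ) : polar K x r ≠ 0 := Complex.exp_ne_zero _

theorem polar_eq_iff {K : ℝ} (hK : 0 < K) {x r x' r' : ℝ} :
    polar K x r = polar K x' r' ↔ r = r' ∧ ∃ m : ℤ, x = x' + m * K := by
  unfold polar
  rw [Complex.exp_eq_exp_iff_exists_int]
  have hpi := Real.pi_pos
  constructor
  · rintro ⟨n, hn⟩
    have hre := congrArg Complex.re hn
    have him := congrArg Complex.im hn
    simp at hre him
    refine ⟨hre, n, ?_⟩
    field_simp at him
    nlinarith
  · rintro ⟨rfl, m, rfl⟩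
    refine ⟨m, ?_⟩
    push_cast
    have : (K : ℂ) ≠ 0 := by exact_mod_cast hK.ne'
    field_simp
    ring

theorem exists_polar_eq {K : ℝ} (hK : 0 < K) {z : ℂ} (hz : z ≠ 0) : ∃ x r, z = polar K x r := by
  refine ⟨K * (Complex.log z).im / (2 * Real.pi), (Complex.log z).re, ?_⟩
  unfold polar
  have hpi := Real.pi_pos
  have : 2 * Real.pi * (K * (Complex.log z).im / (2 * Real.pi)) / K = (Complex.log z).im := by
    field_simp
  rw [this, Complex.re_add_im, Complex.exp_log hz]

/-- Up to a linear change of coordinates, `polar` is the complex exponential, which is an open map.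
-/
theorem isOpen_polar_image {K : ℝ} (hK : 0 < K) {U : Set (ℝ × ℝ)} (hU : IsOpen U) :
    IsOpen ((fun p : ℝ × ℝ => polar K p.1 p.2) '' U) := by
  have hpi := Real.pi_pos
  have : (fun p : ℝ × ℝ => polar K p.1 p.2) '' U =
      Complex.exp '' ((fun z : ℂ => (K * z.im / (2 * Real.pi), z.re)) ⁻¹' U) := by
    ext w
    constructor
    · rintro ⟨⟨x, r⟩, hp, rfl⟩
      refine ⟨r + (2 * Real.pi * x / K : ℝ) * Complex.I, ?_, rfl⟩
      have h1 : K * (2 * Real.pi * x / K) / (2 * Real.pi) = x := by field_simp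
      generalize 2 * Real.pi * x / K = y at h1 ⊢
      have h2 : ((r : ℂ) + (y : ℝ) * Complex.I).im = y := by simp
      have h3 : ((r : ℂ) + (y : ℝ) * Complex.I).re = r := by simp
      rw [mem_preimage, h2, h3, h1]
      exact hp
    · rintro ⟨z, hz, rfl⟩
      refine ⟨_, hz, ?_⟩
      unfold polar
      have : 2 * Real.pi * (K * z.im / (2 * Real.pi)) / K = z.im := by field_simp
      simp only [this, Complex.re_add_im]
  rw [this]
  exact Complex.isOpenMap_exp _ (hU.preimage (by fun_prop))

/-- The radial profile of a closed curve around the origin. -/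
structure IsProfile (K : ℝ) (f : ℝ → ℝ) : Prop where
  continuous : Continuous f
  periodic : Function.Periodic f K
  nonneg : ∀ x, 0 ≤ f x

def curve (K : ℝ) (f : ℝ → ℝ) : Set ℂ := range fun x => polar K x (f x)

def inside (K : ℝ) (f : ℝ → ℝ) : Set ℂ := {z | z = 0 ∨ ∃ x r, r < f x ∧ z = polar K x r}

def outside (K : ℝ) (f : ℝ → ℝ) : Set ℂ := {z | ∃ x r, f x < r ∧ z = polar K x r}

section Profile

variable {K : ℝ} {f : ℝ → ℝ}

theorem IsProfile.add_int_mul (hf : IsProfile K f) (x : ℝ) (m : ℤ) : f (x + m * K) = f x :=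
  hf.periodic.int_mul m x

theorem polar_mem_curve (hK : 0 < K) (hf : IsProfile K f) {x r : ℝ} :
    polar K x r ∈ curve K f ↔ r = f x := by
  constructor
  · rintro ⟨y, hy⟩
    obtain ⟨h1, m, h2⟩ := (polar_eq_iff hK).1 hy
    rw [← h1, h2, hf.add_int_mul]
  · rintro rfl
    exact ⟨x, rfl⟩

theorem polar_mem_inside (hK : 0 < K) (hf : IsProfile K f) {x r : ℝ} :
    polar K x r ∈ inside K f ↔ r < f x := by
  constructor
  · rintro (h | ⟨y, s, h1, h2⟩)
    · exact absurd h (polar_ne_zero _ _ _)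
    · obtain ⟨h3, m, h4⟩ := (polar_eq_iff hK).1 h2
      rwa [h3, h4, hf.add_int_mul]
  · intro h
    exact Or.inr ⟨x, r, h, rfl⟩

theorem polar_mem_outside (hK : 0 < K) (hf : IsProfile K f) {x r : ℝ} :
    polar K x r ∈ outside K f ↔ f x < r := by
  constructor
  · rintro ⟨y, s, h1, h2⟩
    obtain ⟨h3, m, h4⟩ := (polar_eq_iff hK).1 h2
    rwa [h3, h4, hf.add_int_mul]
  · intro h
    exact ⟨x, r, h, rfl⟩

theorem isOpen_outside (hK : 0 < K) (hf : IsProfile K f) : IsOpen (outside K f) := by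
  have : outside K f = (fun p : ℝ × ℝ => polar K p.1 p.2) '' {p | f p.1 < p.2} := by
    ext z
    constructor
    · rintro ⟨x, r, h, rfl⟩
      exact ⟨(x, r), h, rfl⟩
    · rintro ⟨p, h, rfl⟩
      exact ⟨p.1, p.2, h, rfl⟩
  rw [this]
  exact isOpen_polar_image hK
    (isOpen_lt (hf.continuous.comp continuous_fst) continuous_snd)

theorem isOpen_inside (hK : 0 < K) (hf : IsProfile K f) : IsOpen (inside K f) := by
  -- Polar coordinates miss the origin. Profiles are nonnegative, so the unit disc lies inside and
  -- provides a neighbourhood of it.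
  have : inside K f = Metric.ball 0 1 ∪
      (fun p : ℝ × ℝ => polar K p.1 p.2) '' {p | p.2 < f p.1} := by
    ext z
    constructor
    · rintro (rfl | ⟨x, r, h, rfl⟩)
      · exact Or.inl (by simp)
      · exact Or.inr ⟨(x, r), h, rfl⟩
    · rintro (h | ⟨p, h, rfl⟩)
      · by_cases hz : z = 0
        · exact Or.inl hz
        · obtain ⟨x, r, rfl⟩ := exists_polar_eq hK hz
          refine Or.inr ⟨x, r, lt_of_lt_of_le ?_ (hf.nonneg x), rfl⟩
          rw [mem_ball_zero_iff, polar, Complex.norm_exp] at h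
          simp at h
          exact h
      · exact Or.inr ⟨p.1, p.2, h, rfl⟩
  rw [this]
  exact Metric.isOpen_ball.union (isOpen_polar_image hK
    (isOpen_lt continuous_snd (hf.continuous.comp continuous_fst)))

theorem inside_union_outside (hK : 0 < K) (hf : IsProfile K f) :
    inside K f ∪ outside K f = (curve K f)ᶜ := by
  ext z
  by_cases hz : z = 0
  · subst hz
    refine iff_of_true (Or.inl (Or.inl rfl)) ?_
    rintro ⟨x, hx⟩
    exact polar_ne_zero _ _ _ hx
  · obtain ⟨x, r, rfl⟩ := exists_polar_eq hK hz
    rw [mem_union, polar_mem_inside hK hf, polar_mem_outside hK hf, mem_compl_iff,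
      polar_mem_curve hK hf]
    exact lt_or_lt_iff_ne

theorem disjoint_inside_outside (hK : 0 < K) (hf : IsProfile K f) :
    Disjoint (inside K f) (outside K f) := by
  rw [Set.disjoint_left]
  rintro z hz ⟨x, r, h, rfl⟩
  exact lt_asymm h ((polar_mem_inside hK hf).1 hz)

/-- The two explicit sides are disjoint open sets covering the complement; the Jordan curve theorem
is not needed. -/
theorem separates_of_mem (hK : 0 < K) (hf : IsProfile K f) {a b : ℂ} (ha : a ∈ inside K f)
    (hb : b ∈ outside K f) : Separates (curve K f) a b := by
  have ha' : a ∈ (curve K f)ᶜ := by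
    rw [← inside_union_outside hK hf]; exact Or.inl ha
  have hb' : b ∈ (curve K f)ᶜ := by
    rw [← inside_union_outside hK hf]; exact Or.inr hb
  refine ⟨ha', hb', fun h => ?_⟩
  have h1 : connectedComponentIn (curve K f)ᶜ a ⊆ inside K f :=
    isPreconnected_connectedComponentIn.subset_left_of_subset_union (isOpen_inside hK hf)
      (isOpen_outside hK hf) (disjoint_inside_outside hK hf)
      (by rw [inside_union_outside hK hf]; exact connectedComponentIn_subset _ _)
      ⟨a, mem_connectedComponentIn ha', ha⟩
  rw [h] at h1
  exact Set.disjoint_left.1 (disjoint_inside_outside hK hf) (h1 (mem_connectedComponentIn hb')) hb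

theorem isSimpleClosedCurve_curve (hK : 0 < K) (hf : IsProfile K f) :
    IsSimpleClosedCurve (curve K f) := by
  have : Fact (0 < K) := ⟨hK⟩
  have hper : Function.Periodic (fun x => polar K x (f x)) K := by
    intro x
    rw [polar_eq_iff hK]
    exact ⟨hf.periodic x, 1, by simp⟩
  have hcont : Continuous (hper.lift : AddCircle K → ℂ) := by
    refine Continuous.quotient_lift ?_ _
    exact (continuous_polar K).comp (continuous_id.prodMk hf.continuous)
  refine ⟨hper.lift ∘ (AddCircle.homeomorphCircle hK.ne').symm,
    hcont.comp (Homeomorph.continuous _), ?_, ?_⟩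
  · refine Function.Injective.comp ?_ (Homeomorph.injective _)
    intro a b
    induction a using QuotientAddGroup.induction_on with | _ a => ?_
    induction b using QuotientAddGroup.induction_on with | _ b => ?_
    intro h
    obtain ⟨-, m, hm⟩ := (polar_eq_iff hK).1 h
    rw [QuotientAddGroup.eq]
    exact AddSubgroup.mem_zmultiples_iff.2 ⟨-m, by simp [hm]⟩
  · rw [Set.range_comp, (Homeomorph.surjective _).range_eq, Set.image_univ]
    ext z
    constructor
    · rintro ⟨a, rfl⟩
      induction a using QuotientAddGroup.induction_on with | _ a => exact ⟨a, rfl⟩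
    · rintro ⟨x, rfl⟩
      exact ⟨(x : AddCircle K), rfl⟩

end Profile

/-- A relatively clopen preconnected subset is a connected component. -/
theorem connectedComponentIn_eq_of_clopen {F S U Z : Set ℂ} {x : ℂ} (hx : x ∈ S)
    (hS : IsPreconnected S) (hSF : S ⊆ F) (hU : IsOpen U) (hZ : IsClosed Z) (hSU : S ⊆ U)
    (hSZ : S ⊆ Z) (hUS : F ∩ U ⊆ S) (hZS : F ∩ Z ⊆ S) : connectedComponentIn F x = S := by
  refine Subset.antisymm (fun y hy => ?_) (hS.subset_connectedComponentIn hx hSF)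
  by_contra hyS
  have hsub := connectedComponentIn_subset F x
  have hyZ : y ∉ Z := fun h => hyS (hZS ⟨hsub hy, h⟩)
  have hcover : connectedComponentIn F x ⊆ U ∪ Zᶜ := by
    intro z hz
    by_cases h : z ∈ Z
    · exact Or.inl (hSU (hZS ⟨hsub hz, h⟩))
    · exact Or.inr h
  obtain ⟨z, hz, hzU, hzZ⟩ := isPreconnected_connectedComponentIn (F := F) (x := x) U Zᶜ hU
    hZ.isOpen_compl hcover ⟨x, mem_connectedComponentIn (hSF hx), hSU hx⟩ ⟨y, hy, hyZ⟩
  exact hzZ (hSZ (hUS ⟨hsub hz, hzU⟩))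

end Pseudocircle

namespace Pseudocircle

/-! ### Families of closed curves around the origin -/

/-- At the time `k` the curve `i` meets another curve. -/
def EventAt {ι : Type*} (f : ι → ℝ → ℝ) (i : ι) (k : ℤ) : Prop := ∃ j, j ≠ i ∧ f j k = f i k

/-- A family of radial profiles that meet at integral times only. -/
structure RadialFamily {ι : Type*} (K : ℤ) (f : ι → ℝ → ℝ) : Prop where
  K_pos : 0 < K
  profile : ∀ i, IsProfile K (f i)
  integral : ∀ i j x, i ≠ j → f i x = f j x → ∃ k : ℤ, x = k
  event : ∀ i, ∃ k, EventAt f i k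

/-- Consecutive events on the curve `i`. -/
structure Consecutive {ι : Type*} (f : ι → ℝ → ℝ) (i : ι) (a b : ℤ) : Prop where
  lt : a < b
  left : EventAt f i a
  right : EventAt f i b
  between : ∀ k, a < k → k < b → ¬ EventAt f i k

def arc (K : ℝ) (g : ℝ → ℝ) (a b : ℝ) : Set ℂ := (fun x => polar K x (g x)) '' Ioo a b

theorem continuous_polar_profile {K : ℝ} {g : ℝ → ℝ} (hg : IsProfile K g) :
    Continuous fun x => polar K x (g x) :=
  (continuous_polar K).comp (continuous_id.prodMk hg.continuous)

theorem closure_arc {K : ℝ} {g : ℝ → ℝ} (hg : IsProfile K g) {a b : ℝ} (h : a < b) :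
    closure (arc K g a b) = (fun x => polar K x (g x)) '' Icc a b := by
  refine Subset.antisymm ?_ ?_
  · exact closure_minimal (image_mono Ioo_subset_Icc_self)
      (isCompact_Icc.image (continuous_polar_profile hg)).isClosed
  · rw [← closure_Ioo h.ne]
    exact image_closure_subset_closure_image (continuous_polar_profile hg)

/-! ### Vertices, edges and adjacency in terms of meeting times -/

namespace RadialFamily

variable {ι : Type*} {K : ℤ} {f : ι → ℝ → ℝ}

theorem K_pos' (hf : RadialFamily K f) : 0 < (K : ℝ) := by exact_mod_cast hf.K_pos

theorem eventAt_add (hf : RadialFamily K f) (i : ι) (k m : ℤ) :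
    EventAt f i (k + m * K) ↔ EventAt f i k := by
  unfold EventAt
  push_cast
  simp only [(hf.profile _).add_int_mul]

theorem mem_vertices (hf : RadialFamily K f) {z : ℂ} :
    z ∈ vertices (fun i => curve K (f i)) ↔ ∃ i k, EventAt f i k ∧ z = polar K k (f i k) := by
  constructor
  · rintro ⟨i, j, hij, ⟨x, rfl⟩, hj⟩
    rw [polar_mem_curve hf.K_pos' (hf.profile j)] at hj
    obtain ⟨k, rfl⟩ := hf.integral i j x hij hj
    exact ⟨i, k, ⟨j, hij.symm, hj.symm⟩, rfl⟩
  · rintro ⟨i, k, ⟨j, hij, h⟩, rfl⟩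
    refine ⟨i, j, hij.symm, ⟨k, rfl⟩, ?_⟩
    rw [polar_mem_curve hf.K_pos' (hf.profile j), h]

theorem polar_mem_vertices (hf : RadialFamily K f) {i : ι} {x : ℝ} :
    polar K x (f i x) ∈ vertices (fun i => curve K (f i)) ↔ ∃ k : ℤ, EventAt f i k ∧ x = k := by
  rw [hf.mem_vertices]
  constructor
  · rintro ⟨j, k, hk, h⟩
    obtain ⟨h1, m, rfl⟩ := (polar_eq_iff hf.K_pos').1 h
    rw [(hf.profile i).add_int_mul] at h1
    refine ⟨k + m * K, (hf.eventAt_add i k m).2 ?_, by push_cast; rfl⟩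
    by_cases hij : i = j
    · rwa [hij]
    · exact ⟨j, fun e => hij e.symm, h1.symm⟩
  · rintro ⟨k, hk, rfl⟩
    exact ⟨i, k, hk, rfl⟩

theorem exists_eventAt_le (hf : RadialFamily K f) (i : ι) (x : ℝ) :
    ∃ k : ℤ, EventAt f i k ∧ (k : ℝ) ≤ x ∧ ∀ l : ℤ, EventAt f i l → (l : ℝ) ≤ x → l ≤ k := by
  obtain ⟨k₀, hk₀⟩ := hf.event i
  obtain ⟨k, ⟨h1, h2⟩, h3⟩ := Int.exists_greatest_of_bdd
    (P := fun k : ℤ => EventAt f i k ∧ (k : ℝ) ≤ x) ⟨⌊x⌋, fun z hz => Int.le_floor.2 hz.2⟩ (by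
      obtain ⟨m, hm⟩ := exists_int_lt ((x - k₀) / K)
      refine ⟨k₀ + m * K, (hf.eventAt_add i k₀ m).2 hk₀, ?_⟩
      have := hf.K_pos'
      rw [lt_div_iff₀ this] at hm
      push_cast
      linarith)
  exact ⟨k, h1, h2, fun l h4 h5 => h3 l ⟨h4, h5⟩⟩

theorem exists_le_eventAt (hf : RadialFamily K f) (i : ι) (x : ℝ) :
    ∃ k : ℤ, EventAt f i k ∧ x ≤ k ∧ ∀ l : ℤ, EventAt f i l → x ≤ l → k ≤ l := by
  obtain ⟨k₀, hk₀⟩ := hf.event i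
  obtain ⟨k, ⟨h1, h2⟩, h3⟩ := Int.exists_least_of_bdd
    (P := fun k : ℤ => EventAt f i k ∧ x ≤ k) ⟨⌈x⌉, fun z hz => Int.ceil_le.2 hz.2⟩ (by
      obtain ⟨m, hm⟩ := exists_int_gt ((x - k₀) / K)
      refine ⟨k₀ + m * K, (hf.eventAt_add i k₀ m).2 hk₀, ?_⟩
      have := hf.K_pos'
      rw [div_lt_iff₀ this] at hm
      push_cast
      linarith)
  exact ⟨k, h1, h2, fun l h4 h5 => h3 l ⟨h4, h5⟩⟩

theorem exists_consecutive (hf : RadialFamily K f) (i : ι) {x : ℝ}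
    (hx : ∀ k : ℤ, EventAt f i k → x ≠ k) :
    ∃ a b, Consecutive f i a b ∧ (a : ℝ) < x ∧ x < b := by
  obtain ⟨a, ha, hax, ha'⟩ := hf.exists_eventAt_le i x
  obtain ⟨b, hb, hxb, hb'⟩ := hf.exists_le_eventAt i x
  have h1 : (a : ℝ) < x := lt_of_le_of_ne hax (hx a ha).symm
  have h2 : x < b := lt_of_le_of_ne hxb (hx b hb)
  refine ⟨a, b, ⟨by exact_mod_cast h1.trans h2, ha, hb, fun k h3 h4 hk => ?_⟩, h1, h2⟩
  rcases le_total (k : ℝ) x with h | h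
  · exact absurd (ha' k hk h) (not_le.2 h3)
  · exact absurd (hb' k hk h) (not_le.2 h4)

theorem Consecutive.le_add (hf : RadialFamily K f) {i : ι} {a b : ℤ} (h : Consecutive f i a b) :
    b ≤ a + K := by
  by_contra hlt
  have hK := hf.K_pos
  refine h.between (a + K) (by omega) (by omega) ?_
  have := (hf.eventAt_add i a 1).2 h.left
  rwa [one_mul] at this

theorem mem_arc (hf : RadialFamily K f) {i : ι} {a b x : ℝ} (hab : b ≤ a + K)
    (hx : a ≤ x) (hx' : x < a + K) :
    polar K x (f i x) ∈ arc K (f i) a b ↔ a < x ∧ x < b := by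
  constructor
  · rintro ⟨y, ⟨h1, h2⟩, h3⟩
    obtain ⟨-, m, h4⟩ := (polar_eq_iff hf.K_pos').1 h3
    have hK := hf.K_pos'
    have hm : m = 0 := by
      have h5 : (m : ℝ) * K < 1 * K := by linarith
      have h6 : (-1 : ℝ) * K < m * K := by linarith
      have h7 := lt_of_mul_lt_mul_right h5 hK.le
      have h8 := lt_of_mul_lt_mul_right h6 hK.le
      have h9 : m < 1 := by exact_mod_cast h7
      have h10 : -1 < m := by exact_mod_cast h8
      omega
    subst hm
    simp at h4
    subst h4
    exact ⟨h1, h2⟩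
  · rintro ⟨h1, h2⟩
    exact ⟨x, ⟨h1, h2⟩, rfl⟩

/-- Every point of a curve is attained in a given period. -/
theorem exists_mem_Ico (hf : RadialFamily K f) (i : ι) (a x : ℝ) :
    ∃ y, a ≤ y ∧ y < a + K ∧ polar K x (f i x) = polar K y (f i y) ∧ ∃ m : ℤ, y = x + m * K := by
  obtain ⟨m, ⟨h1, h2⟩, -⟩ := existsUnique_add_zsmul_mem_Ico hf.K_pos' x a
  rw [zsmul_eq_mul] at h1 h2
  refine ⟨x + m * K, h1, h2, ?_, m, rfl⟩
  rw [polar_eq_iff hf.K_pos', (hf.profile i).add_int_mul]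
  exact ⟨rfl, -m, by push_cast; ring⟩

/-- The closed arcs over `[a, b]` and `[b, a + K]` cover the curve and meet only in vertices. Once
the vertices are removed, the open arc is therefore both closed and open. -/
theorem connectedComponentIn_eq_arc (hf : RadialFamily K f) {i : ι} {a b : ℤ}
    (h : Consecutive f i a b) {x : ℝ} (h1 : a < x) (h2 : x < b) :
    connectedComponentIn (curve K (f i) \ vertices fun i => curve K (f i)) (polar K x (f i x)) =
      arc K (f i) a b := by
  have hcont := continuous_polar_profile (hf.profile i)
  have hle : (b : ℝ) ≤ a + K := by exact_mod_cast Consecutive.le_add hf h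
  have hsub : arc K (f i) a b ⊆ curve K (f i) \ vertices fun i => curve K (f i) := by
    rintro _ ⟨y, ⟨h3, h4⟩, rfl⟩
    refine ⟨⟨y, rfl⟩, fun hv => ?_⟩
    obtain ⟨k, hk, rfl⟩ := hf.polar_mem_vertices.1 hv
    exact h.between k (by exact_mod_cast h3) (by exact_mod_cast h4) hk
  refine connectedComponentIn_eq_of_clopen (U := ((fun x => polar K x (f i x)) '' Icc b (a + K))ᶜ)
    (Z := (fun x => polar K x (f i x)) '' Icc a b) ⟨x, ⟨h1, h2⟩, rfl⟩
    (isPreconnected_Ioo.image _ hcont.continuousOn) hsub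
    (isCompact_Icc.image hcont).isClosed.isOpen_compl (isCompact_Icc.image hcont).isClosed ?_
    (image_mono Ioo_subset_Icc_self) ?_ ?_
  · rintro z hz ⟨y, ⟨h3, h4⟩, rfl⟩
    rcases h4.lt_or_eq with h4 | h4
    · have hab : (a : ℝ) < b := by exact_mod_cast h.lt
      exact absurd ((hf.mem_arc hle (by linarith) h4).1 hz).2 (not_lt.2 h3)
    · refine (hsub hz).2 (hf.polar_mem_vertices.2 ⟨a + K, ?_, by push_cast; exact h4⟩)
      have := (hf.eventAt_add i a 1).2 h.left
      rwa [one_mul] at this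
  · rintro _ ⟨⟨⟨y, rfl⟩, hyv⟩, hyU⟩
    obtain ⟨y', h3, h4, h5, -⟩ := hf.exists_mem_Ico i a y
    simp only at hyv hyU ⊢
    rw [h5] at hyv hyU ⊢
    rw [hf.mem_arc hle h3 h4]
    constructor
    · refine lt_of_le_of_ne h3 fun e => hyv ?_
      exact hf.polar_mem_vertices.2 ⟨a, h.left, e.symm⟩
    · by_contra h6
      exact hyU ⟨y', ⟨not_lt.1 h6, h4.le⟩, rfl⟩
  · rintro _ ⟨⟨_, hyv⟩, ⟨y, ⟨h3, h4⟩, rfl⟩⟩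
    refine ⟨y, ⟨lt_of_le_of_ne h3 fun e => hyv ?_, lt_of_le_of_ne h4 fun e => hyv ?_⟩, rfl⟩
    · exact hf.polar_mem_vertices.2 ⟨a, h.left, e.symm⟩
    · exact hf.polar_mem_vertices.2 ⟨b, h.right, e⟩

theorem mem_edges (hf : RadialFamily K f) {e : Set ℂ} :
    e ∈ edges (fun i => curve K (f i)) ↔ ∃ i a b, Consecutive f i a b ∧ e = arc K (f i) a b := by
  constructor
  · rintro ⟨i, z, ⟨⟨x, rfl⟩, hv⟩, rfl⟩
    obtain ⟨a, b, hab, h1, h2⟩ := hf.exists_consecutive i (x := x)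
      fun k hk e => hv (hf.polar_mem_vertices.2 ⟨k, hk, e⟩)
    exact ⟨i, a, b, hab, hf.connectedComponentIn_eq_arc hab h1 h2⟩
  · rintro ⟨i, a, b, hab, rfl⟩
    obtain ⟨x, h1, h2⟩ := exists_between (show (a : ℝ) < b by exact_mod_cast hab.lt)
    refine ⟨i, polar K x (f i x), ⟨⟨x, rfl⟩, fun hv => ?_⟩,
      (hf.connectedComponentIn_eq_arc hab h1 h2).symm⟩
    obtain ⟨k, hk, rfl⟩ := hf.polar_mem_vertices.1 hv
    exact hab.between k (by exact_mod_cast h1) (by exact_mod_cast h2) hk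

theorem vertex_mem_closure_arc (hf : RadialFamily K f) {i : ι} {a b : ℤ} (h : Consecutive f i a b)
    {z : ℂ} (hz : z ∈ vertices fun i => curve K (f i)) :
    z ∈ closure (arc K (f i) a b) ↔ z = polar K a (f i a) ∨ z = polar K b (f i b) := by
  have hab : (a : ℝ) < b := by exact_mod_cast h.lt
  rw [closure_arc (hf.profile i) hab]
  constructor
  · rintro ⟨x, ⟨h1, h2⟩, rfl⟩
    obtain ⟨k, hk, rfl⟩ := hf.polar_mem_vertices.1 hz
    have h1' : a ≤ k := by exact_mod_cast h1
    have h2' : k ≤ b := by exact_mod_cast h2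
    rcases h1'.eq_or_lt with rfl | h3
    · exact Or.inl rfl
    rcases h2'.eq_or_lt with rfl | h4
    · exact Or.inr rfl
    · exact absurd hk (h.between k h3 h4)
  · rintro (rfl | rfl)
    · exact ⟨a, ⟨le_rfl, hab.le⟩, rfl⟩
    · exact ⟨b, ⟨hab.le, le_rfl⟩, rfl⟩

theorem adj_iff (hf : RadialFamily K f) (u v : vertices fun i => curve K (f i)) :
    (arrangementGraph fun i => curve K (f i)).Adj u v ↔ u ≠ v ∧ ∃ i a b, Consecutive f i a b ∧
      (((u : ℂ) = polar K a (f i a) ∧ (v : ℂ) = polar K b (f i b)) ∨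
        ((u : ℂ) = polar K b (f i b) ∧ (v : ℂ) = polar K a (f i a))) := by
  constructor
  · rintro ⟨hne, e, he, hu, hv⟩
    obtain ⟨i, a, b, hab, rfl⟩ := hf.mem_edges.1 he
    refine ⟨hne, i, a, b, hab, ?_⟩
    have hu' := (hf.vertex_mem_closure_arc hab u.2).1 hu
    have hv' := (hf.vertex_mem_closure_arc hab v.2).1 hv
    rcases hu' with hu' | hu' <;> rcases hv' with hv' | hv'
    · exact absurd (Subtype.ext (hu'.trans hv'.symm)) hne
    · exact Or.inl ⟨hu', hv'⟩
    · exact Or.inr ⟨hu', hv'⟩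
    · exact absurd (Subtype.ext (hu'.trans hv'.symm)) hne
  · rintro ⟨hne, i, a, b, hab, h⟩
    refine ⟨hne, _, hf.mem_edges.2 ⟨i, a, b, hab, rfl⟩, ?_, ?_⟩
    · exact (hf.vertex_mem_closure_arc hab u.2).2 (h.imp And.left And.left)
    · exact (hf.vertex_mem_closure_arc hab v.2).2 ((h.imp And.right And.right).symm)

/-- The intersection points of two curves are the common values in a period. -/
theorem inter_ncard (hf : RadialFamily K f) {i j : ι} (hij : i ≠ j) (s : Finset ℤ)
    (hs : ∀ k, k ∈ s ↔ 0 ≤ k ∧ k < K ∧ f i k = f j k) :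
    (curve K (f i) ∩ curve K (f j)).ncard = s.card := by
  have hK := hf.K_pos'
  have : curve K (f i) ∩ curve K (f j) = (fun k : ℤ => polar K k (f i k)) '' (s : Set ℤ) := by
    ext z
    constructor
    · rintro ⟨⟨x, rfl⟩, h⟩
      rw [polar_mem_curve hK (hf.profile j)] at h
      obtain ⟨y, h1, h2, h3, m, hm⟩ := hf.exists_mem_Ico i 0 x
      have h4 : f i y = f j y := by
        rw [hm, (hf.profile i).add_int_mul, (hf.profile j).add_int_mul, h]
      obtain ⟨k, rfl⟩ := hf.integral i j y hij h4
      rw [zero_add] at h2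
      exact ⟨k, (hs k).2 ⟨by exact_mod_cast h1, by exact_mod_cast h2, h4⟩, h3.symm⟩
    · rintro ⟨k, hk, rfl⟩
      refine ⟨⟨k, rfl⟩, ?_⟩
      rw [polar_mem_curve hK (hf.profile j)]
      exact ((hs k).1 hk).2.2
  rw [this, Set.InjOn.ncard_image, Set.ncard_coe_finset]
  intro k hk l hl h
  obtain ⟨-, m, hm⟩ := (polar_eq_iff hK).1 h
  obtain ⟨h1, h2, -⟩ := (hs k).1 hk
  obtain ⟨h3, h4, -⟩ := (hs l).1 hl
  have hm' : k = l + m * K := by exact_mod_cast hm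
  have : m = 0 := by
    have h5 : m * K < 1 * K := by linarith
    have h6 : -1 * K < m * K := by linarith
    have h7 := lt_of_mul_lt_mul_right h5 hf.K_pos.le
    have h8 := lt_of_mul_lt_mul_right h6 hf.K_pos.le
    omega
  simpa [this] using hm'

/-- A curve separates the points of another curve on both of its sides. -/
theorem exists_separates (hf : RadialFamily K f) {i j : ι} {x y : ℝ} (h1 : f j x < f i x)
    (h2 : f i y < f j y) :
    ∃ a ∈ curve K (f j), ∃ b ∈ curve K (f j), Separates (curve K (f i)) a b :=
  ⟨_, ⟨x, rfl⟩, _, ⟨y, rfl⟩, separates_of_mem hf.K_pos' (hf.profile i)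
    ((polar_mem_inside hf.K_pos' (hf.profile i)).2 h1)
    ((polar_mem_outside hf.K_pos' (hf.profile i)).2 h2)⟩

end RadialFamily

end Pseudocircle

namespace Wiring

/-! ### Piecewise linear interpolation -/

/-- Piecewise linear interpolation of the values at the integers. -/
noncomputable def interp (F : ℤ → ℝ) (x : ℝ) : ℝ :=
  F ⌊x⌋ * (1 - Int.fract x) + F (⌊x⌋ + 1) * Int.fract x

theorem interp_intCast (F : ℤ → ℝ) (k : ℤ) : interp F k = F k := by
  simp [interp]

theorem interp_eq (F : ℤ → ℝ) {k : ℤ} {x : ℝ} (h1 : k ≤ x) (h2 : x ≤ k + 1) :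
    interp F x = F k * (k + 1 - x) + F (k + 1) * (x - k) := by
  rcases h2.lt_or_eq with h2 | rfl
  · have : ⌊x⌋ = k := Int.floor_eq_iff.2 ⟨h1, h2⟩
    rw [interp, this, ← Int.self_sub_floor, this]
    ring
  · have h := interp_intCast F (k + 1)
    push_cast at h
    rw [h]
    ring

theorem exists_unit_interval (x : ℝ) : ∃ k : ℤ, (k : ℝ) ≤ x ∧ x < k + 1 :=
  ⟨⌊x⌋, Int.floor_le x, Int.lt_floor_add_one x⟩

theorem continuous_interp (F : ℤ → ℝ) : Continuous (interp F) := by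
  refine LocallyFinite.continuous (f := fun k : ℤ => Icc (k : ℝ) (k + 1)) ?_ ?_
    (fun _ => isClosed_Icc) fun k => ?_
  · intro x
    refine ⟨Ioo (x - 1) (x + 1), Ioo_mem_nhds (by linarith) (by linarith), ?_⟩
    refine (Set.finite_Icc (⌊x⌋ - 3) (⌊x⌋ + 3)).subset ?_
    rintro k ⟨y, ⟨h1, h2⟩, h3, h4⟩
    have h5 := Int.floor_le x
    have h6 := Int.lt_floor_add_one x
    have h7 : (k : ℝ) < ⌊x⌋ + 3 := by linarith
    have h8 : (⌊x⌋ : ℝ) - 3 < k := by linarith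
    exact ⟨by exact_mod_cast h8.le, by exact_mod_cast h7.le⟩
  · rw [eq_univ_iff_forall]
    intro x
    obtain ⟨k, h1, h2⟩ := exists_unit_interval x
    exact mem_iUnion.2 ⟨k, h1, h2.le⟩
  · have : ContinuousOn (fun x : ℝ => F k * (k + 1 - x) + F (k + 1) * (x - k))
        (Icc (k : ℝ) (k + 1)) := by fun_prop
    exact this.congr fun x hx => interp_eq F hx.1 hx.2

theorem interp_periodic {F : ℤ → ℝ} {K : ℤ} (h : ∀ k, F (k + K) = F k) :
    Function.Periodic (interp F) (K : ℝ) := by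
  intro x
  simp only [interp, Int.floor_add_intCast, Int.fract_add_intCast]
  rw [h, show ⌊x⌋ + K + 1 = ⌊x⌋ + 1 + K by ring, h]

theorem interp_le_of_unit {F G : ℤ → ℝ} {k : ℤ} {x : ℝ} (h1 : k ≤ x) (h2 : x ≤ k + 1)
    (h3 : F k ≤ G k) (h4 : F (k + 1) ≤ G (k + 1)) : interp F x ≤ interp G x := by
  rw [interp_eq F h1 h2, interp_eq G h1 h2]
  have := mul_le_mul_of_nonneg_right h3 (sub_nonneg.2 h2)
  have := mul_le_mul_of_nonneg_right h4 (sub_nonneg.2 h1)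
  linarith

theorem interp_lt_of_unit {F G : ℤ → ℝ} {k : ℤ} {x : ℝ} (h1 : k < x) (h2 : x < k + 1)
    (h3 : F k ≤ G k) (h4 : F (k + 1) ≤ G (k + 1)) (h5 : F k < G k ∨ F (k + 1) < G (k + 1)) :
    interp F x < interp G x := by
  rw [interp_eq F h1.le h2.le, interp_eq G h1.le h2.le]
  have h6 := mul_le_mul_of_nonneg_right h3 (sub_nonneg.2 h2.le)
  have h7 := mul_le_mul_of_nonneg_right h4 (sub_nonneg.2 h1.le)
  rcases h5 with h5 | h5
  · have := mul_lt_mul_of_pos_right h5 (sub_pos.2 h2)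
    linarith
  · have := mul_lt_mul_of_pos_right h5 (sub_pos.2 h1)
    linarith

theorem interp_le {F G : ℤ → ℝ} (h : ∀ k, F k ≤ G k) (x : ℝ) : interp F x ≤ interp G x := by
  obtain ⟨k, h1, h2⟩ := exists_unit_interval x
  exact interp_le_of_unit h1 h2.le (h _) (h _)

theorem interp_lt {F G : ℤ → ℝ} (h : ∀ k, F k < G k) (x : ℝ) : interp F x < interp G x := by
  obtain ⟨k, h1, h2⟩ := exists_unit_interval x
  rcases h1.lt_or_eq with h1 | rfl
  · exact interp_lt_of_unit h1 h2 (h _).le (h _).le (Or.inl (h _))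
  · rw [interp_intCast, interp_intCast]
    exact h k

theorem interp_nonneg {F : ℤ → ℝ} (h : ∀ k, 0 ≤ F k) (x : ℝ) : 0 ≤ interp F x := by
  have := interp_le (F := fun _ => 0) h x
  simpa [interp] using this

/-! ### Levels and wires -/

/-- The height of the position `p` at the time `k`. -/
noncomputable def levelValue (ev : ℤ → ℕ) (p : ℕ) (k : ℤ) : ℝ :=
  p + (if ev k = p + 1 then 1 / 2 else 0) - (if ev k = p ∧ p ≠ 0 then 1 / 2 else 0)

/-- The levels `p` and `p + 1` touch exactly at the letters `p + 1`, at the height `p + 1 / 2`, and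
never cross. The wires change levels at these points. -/
noncomputable def level (ev : ℤ → ℕ) (p : ℕ) : ℝ → ℝ := interp (levelValue ev p)

noncomputable def wire {N : ℕ} (ev : ℤ → ℕ) (σ : ℤ → Fin N → ℕ) (i : Fin N) : ℝ → ℝ :=
  interp fun k => levelValue ev (σ k i) k

/-- The height at the time `k` of the additional curve around the bottom cell. -/
noncomputable def hatValue (ev : ℤ → ℕ) (k : ℤ) : ℝ :=
  -- The height `5 / 4` lies between the crossings with the letter `1`, at `1 / 2`, and the level
  -- `2`, which never drops below `3 / 2`. The height `1` is that of the level `1` beside such a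
  -- crossing, and `1 / 2` separates the levels `0` and `1` elsewhere.
  if ev k = 1 then 5 / 4 else if ev (k - 1) = 1 ∨ ev (k + 1) = 1 then 1 else 1 / 2

noncomputable def hat (ev : ℤ → ℕ) : ℝ → ℝ := interp (hatValue ev)

theorem levelValue_cases (ev : ℤ → ℕ) (p : ℕ) (k : ℤ) :
    (ev k = p + 1 ∧ levelValue ev p k = p + 1 / 2) ∨
    (ev k = p ∧ p ≠ 0 ∧ levelValue ev p k = p - 1 / 2) ∨
    (ev k ≠ p + 1 ∧ (ev k ≠ p ∨ p = 0) ∧ levelValue ev p k = p) := by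
  unfold levelValue
  by_cases h1 : ev k = p + 1
  · refine Or.inl ⟨h1, ?_⟩
    rw [if_pos h1, if_neg (by omega)]
    ring
  by_cases h2 : ev k = p ∧ p ≠ 0
  · refine Or.inr (Or.inl ⟨h2.1, h2.2, ?_⟩)
    rw [if_neg h1, if_pos h2]
    ring
  · refine Or.inr (Or.inr ⟨h1, by omega, ?_⟩)
    rw [if_neg h1, if_neg h2]
    ring

theorem levelValue_lt (ev : ℤ → ℕ) {p q : ℕ} (hpq : p < q) (k : ℤ) :
    levelValue ev p k < levelValue ev q k ∨
      (q = p + 1 ∧ ev k = q ∧ levelValue ev p k = levelValue ev q k) := by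
  have hpq' : (p : ℝ) + 1 ≤ q := by exact_mod_cast hpq
  rcases levelValue_cases ev p k with ⟨h1, h2⟩ | ⟨h1, -, h2⟩ | ⟨h1, -, h2⟩ <;>
    rcases levelValue_cases ev q k with ⟨h3, h4⟩ | ⟨h3, h5, h4⟩ | ⟨h3, -, h4⟩ <;> rw [h2, h4]
  · left; linarith
  · right
    refine ⟨by omega, h3, ?_⟩
    have : q = p + 1 := by omega
    rw [this]; push_cast; ring
  · left; linarith
  · left; linarith
  · left; linarith
  · left; linarith
  · left; linarith
  · left
    have : p + 1 ≠ q := by omega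
    have : p + 2 ≤ q := by omega
    have : (p : ℝ) + 2 ≤ q := by exact_mod_cast this
    linarith
  · left; linarith

theorem levelValue_le (ev : ℤ → ℕ) {p q : ℕ} (hpq : p < q) (k : ℤ) :
    levelValue ev p k ≤ levelValue ev q k := by
  rcases levelValue_lt ev hpq k with h | h
  · exact h.le
  · exact h.2.2.le

theorem levelValue_nonneg (ev : ℤ → ℕ) (p : ℕ) (k : ℤ) : 0 ≤ levelValue ev p k := by
  have h0 : (0 : ℝ) ≤ p := Nat.cast_nonneg p
  rcases levelValue_cases ev p k with ⟨_, h⟩ | ⟨_, h1, h⟩ | ⟨_, _, h⟩ <;> rw [h]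
  · linarith
  · have : (1 : ℝ) ≤ p := by exact_mod_cast Nat.one_le_iff_ne_zero.2 h1
    linarith
  · exact h0

/-- The two positions exchanged at the time `k` have the same height at that time, so it is
irrelevant whether positions are read before or after the letter. -/
theorem levelValue_swapLetter (ev : ℤ → ℕ) (p : ℕ) (k : ℤ) :
    levelValue ev (swapLetter (ev k) p) k = levelValue ev p k := by
  rcases swapLetter_cases (ev k) p with ⟨h1, h2⟩ | ⟨h1, h2⟩ | ⟨h1, h2, h3⟩
  · rw [h2]
    rcases levelValue_lt ev (Nat.lt_succ_self p) k with h | h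
    · exfalso
      rcases levelValue_cases ev p k with ⟨h3, h4⟩ | ⟨h3, -, h4⟩ | ⟨h3, -, h4⟩ <;>
      rcases levelValue_cases ev p.succ k with ⟨h5, h6⟩ | ⟨h5, -, h6⟩ | ⟨h5, h7, h6⟩ <;>
      first
      | omega
      | (rw [h4, h6] at h; push_cast at h; linarith)
    · rw [← h1]; exact h.2.2.symm
  · rw [h2]
    rcases Nat.eq_zero_or_pos p with rfl | hp
    · rw [← h1]
    · rcases levelValue_lt ev (show p - 1 < p by omega) k with h | h
      · exfalso
        have hc : ((p - 1 : ℕ) : ℝ) = p - 1 := by push_cast [hp]; ring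
        rcases levelValue_cases ev (p - 1) k with ⟨h3, h4⟩ | ⟨h3, -, h4⟩ | ⟨h3, -, h4⟩ <;>
        rcases levelValue_cases ev p k with ⟨h5, h6⟩ | ⟨h5, -, h6⟩ | ⟨h5, h7, h6⟩ <;>
        first
        | omega
        | (rw [h4, h6, hc] at h; linarith)
      · rw [← h1]; exact h.2.2
  · rw [h3]

namespace Diagram

variable {N : ℕ} {K : ℤ} {ev : ℤ → ℕ} {σ : ℤ → Fin N → ℕ}

theorem exists_position (h : Diagram N K ev σ) (k : ℤ) {p : ℕ} (hp : p < N) : ∃ i, σ k i = p := by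
  have hinj : Function.Injective fun i => (⟨σ k i, h.σ_lt k i⟩ : Fin N) :=
    fun i j e => h.σ_inj k (congrArg Fin.val e)
  obtain ⟨i, hi⟩ := Finite.surjective_of_injective hinj ⟨p, hp⟩
  exact ⟨i, congrArg Fin.val hi⟩

theorem ev_or_succ_eq_zero (h : Diagram N K ev σ) (k : ℤ) : ev k = 0 ∨ ev (k + 1) = 0 := by
  by_contra hne
  push Not at hne
  have h1 := h.ev_mod k hne.1
  have h2 := h.ev_mod (k + 1) hne.2
  omega

/-- Two consecutive times never both carry a letter, so the levels are strictly ordered at one end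
of the unit interval at least. -/
theorem level_lt_of_unit (h : Diagram N K ev σ) {p q : ℕ} (hpq : p < q) {k : ℤ} {x : ℝ}
    (h1 : k < x) (h2 : x < k + 1) : level ev p x < level ev q x := by
  refine interp_lt_of_unit h1 h2 (levelValue_le ev hpq _) (levelValue_le ev hpq _) ?_
  rcases h.ev_or_succ_eq_zero k with h3 | h3
  · exact Or.inl ((levelValue_lt ev hpq k).resolve_right fun h4 => by omega)
  · exact Or.inr ((levelValue_lt ev hpq (k + 1)).resolve_right fun h4 => by omega)

theorem level_le (ev : ℤ → ℕ) {p q : ℕ} (hpq : p ≤ q) (x : ℝ) : level ev p x ≤ level ev q x := by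
  rcases hpq.eq_or_lt with rfl | hpq
  · exact le_rfl
  · exact interp_le (levelValue_le ev hpq) x

theorem level_lt (h : Diagram N K ev σ) {p q : ℕ} (hpq : p < q) {x : ℝ}
    (hx : ∀ k : ℤ, x = k → ev k = q → q ≠ p + 1) : level ev p x < level ev q x := by
  obtain ⟨k, h1, h2⟩ := exists_unit_interval x
  rcases h1.lt_or_eq with h1 | rfl
  · exact h.level_lt_of_unit hpq h1 h2
  · rw [level, level, interp_intCast, interp_intCast]
    exact (levelValue_lt ev hpq k).resolve_right fun h3 => hx k rfl h3.2.1 h3.1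

theorem level_eq_of_ev {p : ℕ} {k : ℤ} (h : ev k = p + 1) :
    level ev p k = level ev (p + 1) k := by
  rw [level, level, interp_intCast, interp_intCast, ← levelValue_swapLetter, h]
  congr 1
  unfold swapLetter
  rw [if_pos rfl]

theorem isProfile_level (h : Diagram N K ev σ) (p : ℕ) :
    Pseudocircle.IsProfile (K : ℝ) (level ev p) where
  continuous := continuous_interp _
  periodic := interp_periodic fun k => by unfold levelValue; rw [h.ev_per]
  nonneg := interp_nonneg (levelValue_nonneg ev p)

theorem isProfile_wire (h : Diagram N K ev σ) (i : Fin N) :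
    Pseudocircle.IsProfile (K : ℝ) (wire ev σ i) where
  continuous := continuous_interp _
  periodic := interp_periodic fun k => by unfold levelValue; rw [h.ev_per, h.σ_per]
  nonneg := interp_nonneg fun k => levelValue_nonneg ev _ k

theorem wire_eq_level (h : Diagram N K ev σ) (i : Fin N) {k : ℤ} {x : ℝ} (h1 : k ≤ x)
    (h2 : x ≤ k + 1) : wire ev σ i x = level ev (σ k i) x := by
  rw [wire, level, interp_eq _ h1 h2, interp_eq _ h1 h2]
  have := h.step (k + 1) i
  rw [add_sub_cancel_right] at this
  rw [this, levelValue_swapLetter]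

theorem exchanges_of_wire_eq (h : Diagram N K ev σ) {i j : Fin N} (hij : i ≠ j) {x : ℝ}
    (hx : wire ev σ i x = wire ev σ j x) :
    ∃ k : ℤ, x = k ∧ Exchanges (ev k) (σ k i) (σ k j) := by
  obtain ⟨k, h1, h2⟩ := exists_unit_interval x
  rw [h.wire_eq_level i h1 h2.le, h.wire_eq_level j h1 h2.le] at hx
  have hne : σ k i ≠ σ k j := fun e => hij (h.σ_inj k e)
  have key : ∀ p q, p < q → level ev p x = level ev q x → x = k ∧ q = p + 1 ∧ ev k = q := by
    intro p q hpq e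
    by_contra hcon
    refine (h.level_lt hpq fun l hl h3 h4 => hcon ?_).ne e
    have : l = k := by
      have h5 : (k : ℝ) ≤ l := by rw [← hl]; exact h1
      have h6 : (l : ℝ) < k + 1 := by rw [← hl]; exact h2
      have h7 : k ≤ l := by exact_mod_cast h5
      have h8 : l < k + 1 := by exact_mod_cast h6
      omega
    subst this
    exact ⟨hl, h4, h3⟩
  rcases lt_or_gt_of_ne hne with h3 | h3
  · obtain ⟨h4, h5, h6⟩ := key _ _ h3 hx
    exact ⟨k, h4, Or.inl (by omega)⟩
  · obtain ⟨h4, h5, h6⟩ := key _ _ h3 hx.symm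
    exact ⟨k, h4, Or.inr (by omega)⟩

theorem wire_eq_of_exchanges (h : Diagram N K ev σ) {i j : Fin N} {k : ℤ}
    (he : Exchanges (ev k) (σ k i) (σ k j)) : wire ev σ i k = wire ev σ j k := by
  rw [h.wire_eq_level i le_rfl (by linarith), h.wire_eq_level j le_rfl (by linarith)]
  rcases he with ⟨h1, h2⟩ | ⟨h1, h2⟩
  · rw [level_eq_of_ev h1.symm, show σ k i + 1 = σ k j by omega]
  · rw [level_eq_of_ev h1.symm, show σ k j + 1 = σ k i by omega]

/-- The wire `i` takes part in a crossing at the time `k`. -/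
theorem eventAt_wire (h : Diagram N K ev σ) {i : Fin N} {k : ℤ} :
    Pseudocircle.EventAt (wire ev σ) i k ↔ ev k ≠ 0 ∧ (σ k i + 1 = ev k ∨ σ k i = ev k) := by
  constructor
  · rintro ⟨j, hj, e⟩
    obtain ⟨l, hl, he⟩ := h.exchanges_of_wire_eq hj e
    have : k = l := by exact_mod_cast hl
    subst this
    unfold Exchanges at he
    omega
  · rintro ⟨h0, h1 | h1⟩
    · obtain ⟨j, hj⟩ := h.exists_position k (h.ev_lt k)
      exact ⟨j, fun e => by rw [e] at hj; omega, h.wire_eq_of_exchanges (Or.inr ⟨h1, hj⟩)⟩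
    · obtain ⟨j, hj⟩ := h.exists_position k (show ev k - 1 < N by have := h.ev_lt k; omega)
      exact ⟨j, fun e => by rw [e] at hj; omega,
        h.wire_eq_of_exchanges (Or.inl ⟨by omega, h1⟩)⟩

theorem exists_exchanges (h : Diagram N K ev σ) {i j : Fin N} (hij : i ≠ j) :
    ∃ k, 0 ≤ k ∧ k < K ∧ Exchanges (ev k) (σ k i) (σ k j) := by
  have := h.cross_two i j hij
  obtain ⟨k, hk⟩ := Finset.card_pos.1 (by omega : 0 < ((Finset.Ico 0 K).filter
    fun k => Exchanges (ev k) (σ k i) (σ k j)).card)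
  simp only [Finset.mem_filter, Finset.mem_Ico] at hk
  exact ⟨k, hk.1.1, hk.1.2, hk.2⟩

theorem exists_ne (h : Diagram N K ev σ) (i : Fin N) : ∃ j, j ≠ i := by
  have := h.six_le
  have : Nontrivial (Fin N) := Fin.nontrivial_iff_two_le.2 (by omega)
  exact _root_.exists_ne i

theorem radialFamily (h : Diagram N K ev σ) : Pseudocircle.RadialFamily K (wire ev σ) where
  K_pos := h.K_pos
  profile := h.isProfile_wire
  integral i j x hij hx := by
    obtain ⟨k, hk, -⟩ := h.exchanges_of_wire_eq hij hx
    exact ⟨k, hk⟩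
  event i := by
    obtain ⟨j, hj⟩ := h.exists_ne i
    obtain ⟨k, -, -, hk⟩ := h.exists_exchanges hj
    exact ⟨k, j, hj, h.wire_eq_of_exchanges hk⟩

/-! ### The additional curve -/

theorem hatValue_cases (ev : ℤ → ℕ) (k : ℤ) : (ev k = 1 ∧ hatValue ev k = 5 / 4) ∨
    (ev k ≠ 1 ∧ (ev (k - 1) = 1 ∨ ev (k + 1) = 1) ∧ hatValue ev k = 1) ∨
    (ev k ≠ 1 ∧ ev (k - 1) ≠ 1 ∧ ev (k + 1) ≠ 1 ∧ hatValue ev k = 1 / 2) := by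
  unfold hatValue
  split_ifs with h1 h2
  · exact Or.inl ⟨h1, rfl⟩
  · exact Or.inr (Or.inl ⟨h1, h2, rfl⟩)
  · push Not at h2
    exact Or.inr (Or.inr ⟨h1, h2.1, h2.2, rfl⟩)

theorem isProfile_hat (h : Diagram N K ev σ) : Pseudocircle.IsProfile (K : ℝ) (hat ev) where
  continuous := continuous_interp _
  periodic := interp_periodic fun k => by
    unfold hatValue
    rw [h.ev_per, show k + K - 1 = k - 1 + K by ring, show k + K + 1 = k + 1 + K by ring, h.ev_per,
      h.ev_per]
  nonneg := interp_nonneg fun k => by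
    rcases hatValue_cases ev k with ⟨_, h⟩ | ⟨_, _, h⟩ | ⟨_, _, _, h⟩ <;> rw [h] <;> norm_num

theorem level_zero_lt_hat (ev : ℤ → ℕ) (x : ℝ) : level ev 0 x < hat ev x := by
  refine interp_lt (fun k => ?_) x
  rcases hatValue_cases ev k with ⟨h1, h⟩ | ⟨h1, _, h⟩ | ⟨h1, _, _, h⟩ <;> rw [h] <;>
    rcases levelValue_cases ev 0 k with ⟨h2, h3⟩ | ⟨h2, h4, h3⟩ | ⟨h2, _, h3⟩ <;> rw [h3] <;>
    first
    | omega
    | norm_num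

theorem hat_lt_level (ev : ℤ → ℕ) {p : ℕ} (hp : 2 ≤ p) (x : ℝ) : hat ev x < level ev p x := by
  refine interp_lt (fun k => ?_) x
  have hp' : (2 : ℝ) ≤ p := by exact_mod_cast hp
  rcases hatValue_cases ev k with ⟨h1, h⟩ | ⟨h1, _, h⟩ | ⟨h1, _, _, h⟩ <;> rw [h] <;>
    rcases levelValue_cases ev p k with ⟨h2, h3⟩ | ⟨h2, h4, h3⟩ | ⟨h2, _, h3⟩ <;> rw [h3] <;>
    linarith

/-- The additional curve meets the level `1` directly before and after the letters `1` only. -/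
theorem hatValue_level_one (h : Diagram N K ev σ) (k : ℤ) :
    (ev k = 1 ∧ levelValue ev 1 k < hatValue ev k) ∨
    (ev k = 0 ∧ (ev (k - 1) = 1 ∨ ev (k + 1) = 1) ∧ levelValue ev 1 k = hatValue ev k) ∨
    (ev k ≠ 1 ∧ ev (k - 1) ≠ 1 ∧ ev (k + 1) ≠ 1 ∧ hatValue ev k < levelValue ev 1 k) := by
  rcases hatValue_cases ev k with ⟨h1, h2⟩ | ⟨h1, h4, h2⟩ | ⟨h1, h4, h5, h2⟩
  · refine Or.inl ⟨h1, ?_⟩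
    rcases levelValue_cases ev 1 k with ⟨h2, h3⟩ | ⟨h2, h4, h3⟩ | ⟨h2, _, h3⟩ <;>
      first
      | omega
      | (rw [h3, ‹hatValue ev k = _›]; norm_num)
  · have h0 : ev k = 0 := by
      by_contra h0
      have h5 := h.ev_mod k h0
      rcases h4 with h4 | h4
      · have := h.ev_mod _ (by rw [h4]; norm_num); omega
      · have := h.ev_mod _ (by rw [h4]; norm_num); omega
    refine Or.inr (Or.inl ⟨h0, h4, ?_⟩)
    rcases levelValue_cases ev 1 k with ⟨h2, h3⟩ | ⟨h2, h4, h3⟩ | ⟨h2, _, h3⟩ <;>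
      first
      | omega
      | (rw [h3, ‹hatValue ev k = _›]; norm_num)
  · refine Or.inr (Or.inr ⟨h1, h4, h5, ?_⟩)
    rcases levelValue_cases ev 1 k with ⟨h2, h3⟩ | ⟨h2, h4, h3⟩ | ⟨h2, _, h3⟩ <;>
      first
      | omega
      | (rw [h3, ‹hatValue ev k = _›]; norm_num)

/-- The additional curve is above the level `1` at the letters `1`, on it at the two adjacent times,
and below it otherwise. By the spacing of the letters, the ends of a unit interval never show
opposite strict signs nor two equalities. -/
theorem hat_ne_level_one_of_unit (h : Diagram N K ev σ) {k : ℤ} {x : ℝ} (h1 : k < x)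
    (h2 : x < k + 1) : hat ev x ≠ level ev 1 x := by
  have h3 := h.hatValue_level_one k
  have h4 := h.hatValue_level_one (k + 1)
  rw [add_sub_cancel_right] at h4
  have m := h.ev_mod k
  have m1 := h.ev_mod (k + 1)
  have m2 := h.ev_mod (k - 1)
  have m3 := h.ev_mod (k + 1 + 1)
  rcases h3 with ⟨a1, a2⟩ | ⟨a1, a3, a2⟩ | ⟨a1, a3, a4, a2⟩ <;>
    rcases h4 with ⟨b1, b2⟩ | ⟨b1, b3, b2⟩ | ⟨b1, b3, b4, b2⟩ <;>
    first
    | omega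
    | exact (interp_lt_of_unit h1 h2 a2.le b2.le (Or.inl a2)).ne'
    | exact (interp_lt_of_unit h1 h2 a2.le b2.le (Or.inr b2)).ne'
    | exact (interp_lt_of_unit h1 h2 a2.le b2.le (Or.inl a2)).ne
    | exact (interp_lt_of_unit h1 h2 a2.le b2.le (Or.inr b2)).ne
    | exact (interp_lt_of_unit h1 h2 a2.ge b2.le (Or.inr b2)).ne
    | exact (interp_lt_of_unit h1 h2 a2.le b2.ge (Or.inl a2)).ne

theorem hat_eq_wire_iff (h : Diagram N K ev σ) {i : Fin N} {x : ℝ} :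
    hat ev x = wire ev σ i x ↔
      ∃ k : ℤ, x = k ∧ σ k i = 1 ∧ (ev (k - 1) = 1 ∨ ev (k + 1) = 1) := by
  constructor
  · intro e
    obtain ⟨k, h1, h2⟩ := exists_unit_interval x
    rw [h.wire_eq_level i h1 h2.le] at e
    have h3 : σ k i = 1 := by
      by_contra h3
      rcases (by omega : σ k i = 0 ∨ 2 ≤ σ k i) with h4 | h4
      · rw [h4] at e; exact (level_zero_lt_hat ev x).ne' e
      · exact (hat_lt_level ev h4 x).ne e
    rw [h3] at e
    rcases h1.lt_or_eq with h1 | rfl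
    · exact absurd e (h.hat_ne_level_one_of_unit h1 h2)
    · refine ⟨k, rfl, h3, ?_⟩
      rw [hat, level, interp_intCast, interp_intCast] at e
      rcases h.hatValue_level_one k with ⟨a1, a2⟩ | ⟨a1, a3, a2⟩ | ⟨a1, a3, a4, a2⟩
      · exact absurd e a2.ne'
      · exact a3
      · exact absurd e a2.ne
  · rintro ⟨k, rfl, h3, h4⟩
    rw [h.wire_eq_level i le_rfl (by linarith), h3, hat, level, interp_intCast, interp_intCast]
    rcases h.hatValue_level_one k with ⟨a1, a2⟩ | ⟨a1, a3, a2⟩ | ⟨a1, a3, a4, a2⟩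
    · have m := h.ev_mod k
      have m2 := h.ev_mod (k - 1)
      have m3 := h.ev_mod (k + 1)
      omega
    · exact a2.symm
    · omega

/-- The wires together with the additional curve. -/
noncomputable def extendedWire (ev : ℤ → ℕ) (σ : ℤ → Fin N → ℕ) (o : Option (Fin N)) : ℝ → ℝ :=
  o.elim (hat ev) (wire ev σ)

theorem exists_ev_eq_one (h : Diagram N K ev σ) : ∃ k, 0 ≤ k ∧ k < K ∧ ev k = 1 := by
  obtain ⟨k, hk⟩ := Finset.card_pos.1 (by rw [h.bottom]; norm_num :
    0 < ((Finset.Ico 0 K).filter fun k => ev k = 1).card)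
  simp only [Finset.mem_filter, Finset.mem_Ico] at hk
  exact ⟨k, hk.1.1, hk.1.2, hk.2⟩

theorem eventAt_none (h : Diagram N K ev σ) {k : ℤ} :
    Pseudocircle.EventAt (extendedWire ev σ) none k ↔ ev (k - 1) = 1 ∨ ev (k + 1) = 1 := by
  constructor
  · rintro ⟨_ | j, hj, e⟩
    · exact absurd rfl hj
    · obtain ⟨l, hl, -, h2⟩ := h.hat_eq_wire_iff.1 (show hat ev k = wire ev σ j k from e.symm)
      have : k = l := by exact_mod_cast hl
      rwa [this]
  · intro hk
    obtain ⟨j, hj⟩ := h.exists_position k (show 1 < N by have := h.six_le; omega)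
    exact ⟨some j, by simp, (h.hat_eq_wire_iff.2 ⟨k, rfl, hj, hk⟩).symm⟩

theorem eventAt_some (h : Diagram N K ev σ) {i : Fin N} {k : ℤ} :
    Pseudocircle.EventAt (extendedWire ev σ) (some i) k ↔
      (ev k ≠ 0 ∧ (σ k i + 1 = ev k ∨ σ k i = ev k)) ∨
        (σ k i = 1 ∧ (ev (k - 1) = 1 ∨ ev (k + 1) = 1)) := by
  rw [← h.eventAt_wire]
  constructor
  · rintro ⟨_ | j, hj, e⟩
    · obtain ⟨l, hl, h1, h2⟩ := h.hat_eq_wire_iff.1 (show hat ev k = wire ev σ i k from e)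
      have : k = l := by exact_mod_cast hl
      rw [← this] at h1 h2
      exact Or.inr ⟨h1, h2⟩
    · exact Or.inl ⟨j, fun e => hj (by rw [e]), e⟩
  · rintro (⟨j, hj, e⟩ | ⟨h1, h2⟩)
    · exact ⟨some j, fun e => hj (Option.some_injective _ e), e⟩
    · exact ⟨none, by simp, h.hat_eq_wire_iff.2 ⟨k, rfl, h1, h2⟩⟩

theorem extendedFamily (h : Diagram N K ev σ) :
    Pseudocircle.RadialFamily K (extendedWire ev σ) where
  K_pos := h.K_pos
  profile o := by
    cases o with
    | none => exact h.isProfile_hat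
    | some i => exact h.isProfile_wire i
  integral o o' x hne e := by
    cases o with
    | none =>
      cases o' with
      | none => exact absurd rfl hne
      | some j =>
        obtain ⟨k, hk, -⟩ := h.hat_eq_wire_iff.1 (show hat ev x = wire ev σ j x from e)
        exact ⟨k, hk⟩
    | some i =>
      cases o' with
      | none =>
        obtain ⟨k, hk, -⟩ := h.hat_eq_wire_iff.1 (show hat ev x = wire ev σ i x from e.symm)
        exact ⟨k, hk⟩
      | some j => exact h.radialFamily.integral i j x (fun e => hne (by rw [e])) e
  event o := by
    cases o with
    | none =>
      obtain ⟨k, -, -, hk⟩ := h.exists_ev_eq_one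
      exact ⟨k + 1, h.eventAt_none.2 (Or.inl (by rwa [add_sub_cancel_right]))⟩
    | some i =>
      obtain ⟨k, hk⟩ := h.radialFamily.event i
      exact ⟨k, h.eventAt_some.2 (Or.inl (h.eventAt_wire.1 hk))⟩

theorem addCurve_eq (ev : ℤ → ℕ) (σ : ℤ → Fin N → ℕ) :
    Pseudocircle.addCurve (fun i => Pseudocircle.curve K (wire ev σ i))
      (Pseudocircle.curve K (hat ev)) =
      fun o => Pseudocircle.curve (K : ℝ) (extendedWire ev σ o) := by
  funext o
  cases o <;> rfl

end Diagram

end Wiring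

/-! ### The wires as a simple intersecting arrangement -/

namespace Wiring.Diagram

open Pseudocircle

variable {N : ℕ} {K : ℤ} {ev : ℤ → ℕ} {σ : ℤ → Fin N → ℕ}

theorem wire_eq_wire_iff (h : Diagram N K ev σ) {i j : Fin N} (hij : i ≠ j) {k : ℤ} :
    wire ev σ i k = wire ev σ j k ↔ Exchanges (ev k) (σ k i) (σ k j) := by
  refine ⟨fun e => ?_, h.wire_eq_of_exchanges⟩
  obtain ⟨l, hl, he⟩ := h.exchanges_of_wire_eq hij e
  have : k = l := by exact_mod_cast hl
  rwa [this]

theorem wire_lt_of_unit (h : Diagram N K ev σ) {i j : Fin N} {k : ℤ} (hlt : σ k i < σ k j) {x : ℝ}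
    (h1 : k < x) (h2 : x < k + 1) : wire ev σ i x < wire ev σ j x := by
  rw [h.wire_eq_level i h1.le h2.le, h.wire_eq_level j h1.le h2.le]
  exact h.level_lt_of_unit hlt h1 h2

/-- A crossing reverses the order of two wires, so either order occurs half a unit before or after
it. -/
theorem exists_wire_lt (h : Diagram N K ev σ) {i j : Fin N} (hij : i ≠ j) :
    ∃ x, wire ev σ i x < wire ev σ j x := by
  obtain ⟨k, -, -, hk⟩ := h.exists_exchanges hij
  have hi := h.step k i
  have hj := h.step k j
  have hi' := swapLetter_cases (ev k) (σ (k - 1) i)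
  have hj' := swapLetter_cases (ev k) (σ (k - 1) j)
  rcases hk with hk | hk
  · exact ⟨k + 1 / 2, h.wire_lt_of_unit (k := k) (by omega) (by linarith) (by linarith)⟩
  · refine ⟨((k - 1 : ℤ) : ℝ) + 1 / 2, h.wire_lt_of_unit (k := k - 1) ?_ (by linarith)
      (by linarith)⟩
    omega

theorem ncard_wire_inter (h : Diagram N K ev σ) {i j : Fin N} (hij : i ≠ j) :
    (curve K (wire ev σ i) ∩ curve K (wire ev σ j)).ncard = 2 := by
  rw [h.radialFamily.inter_ncard hij ((Finset.Ico 0 K).filter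
    fun k => Exchanges (ev k) (σ k i) (σ k j)), h.cross_two i j hij]
  intro k
  rw [Finset.mem_filter, Finset.mem_Ico, h.wire_eq_wire_iff hij, and_assoc]

theorem isArrangement (h : Diagram N K ev σ) :
    IsArrangement fun i => curve (K : ℝ) (wire ev σ i) where
  simpleClosed i := isSimpleClosedCurve_curve h.radialFamily.K_pos' (h.isProfile_wire i)
  pairwise i j hij := by
    obtain ⟨x, hx⟩ := h.exists_wire_lt hij
    obtain ⟨y, hy⟩ := h.exists_wire_lt hij.symm
    exact Or.inr ⟨h.ncard_wire_inter hij, h.radialFamily.exists_separates hy hx⟩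

theorem isIntersecting (h : Diagram N K ev σ) :
    IsIntersecting fun i => curve (K : ℝ) (wire ev σ i) := by
  intro i j hij
  have := h.ncard_wire_inter hij
  refine Set.nonempty_of_ncard_ne_zero (by rw [this]; norm_num)

theorem ev_mod_of_eq_one (h : Diagram N K ev σ) {k : ℤ} (hk : ev k = 1) : k % 4 = 2 :=
  h.ev_mod k (by rw [hk]; norm_num)

theorem ev_eq_zero (h : Diagram N K ev σ) {k : ℤ} (hk : k % 4 ≠ 2) : ev k = 0 := by
  by_contra h0
  exact hk (h.ev_mod k h0)

theorem σ_eq_of_ev_eq_zero (h : Diagram N K ev σ) {k : ℤ} (hk : ev k = 0) (i : Fin N) :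
    σ k i = σ (k - 1) i := by
  have h1 := h.step k i
  have h2 := swapLetter_cases (ev k) (σ (k - 1) i)
  omega

/-- The additional curve meets no crossing of two wires. -/
theorem not_hat_and_exchanges (h : Diagram N K ev σ) {i j : Fin N} (hij : i ≠ j) {x : ℝ}
    (h1 : hat ev x = wire ev σ i x) (h2 : wire ev σ i x = wire ev σ j x) : False := by
  obtain ⟨k, rfl, -, h3⟩ := h.hat_eq_wire_iff.1 h1
  rw [h.wire_eq_wire_iff hij] at h2
  unfold Exchanges at h2
  have h4 := h.ev_mod k (by omega)
  rcases h3 with h3 | h3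
  · have := h.ev_mod_of_eq_one h3; omega
  · have := h.ev_mod_of_eq_one h3; omega

theorem not_three_wires (h : Diagram N K ev σ) {i j l : Fin N} (hij : i ≠ j) (hil : i ≠ l)
    (hjl : j ≠ l) {x : ℝ} (h1 : wire ev σ i x = wire ev σ j x)
    (h2 : wire ev σ i x = wire ev σ l x) : False := by
  obtain ⟨k, rfl, hk⟩ := h.exchanges_of_wire_eq hij h1
  rw [h.wire_eq_wire_iff hil] at h2
  unfold Exchanges at hk h2
  exact hjl (h.σ_inj k (by omega))

theorem isSimple (h : Diagram N K ev σ) : IsSimple fun i => curve (K : ℝ) (wire ev σ i) := by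
  intro i j l hij hil hjl
  rw [Set.eq_empty_iff_forall_notMem]
  rintro _ ⟨⟨⟨x, rfl⟩, h1⟩, h2⟩
  rw [polar_mem_curve h.radialFamily.K_pos' (h.isProfile_wire _)] at h1 h2
  exact h.not_three_wires hij hil hjl h1 h2

theorem isSimple_addCurve (h : Diagram N K ev σ) :
    IsSimple (addCurve (fun i => curve (K : ℝ) (wire ev σ i)) (curve K (hat ev))) := by
  rw [addCurve_eq]
  intro o₁ o₂ o₃ h12 h13 h23
  rw [Set.eq_empty_iff_forall_notMem]
  rintro _ ⟨⟨⟨x, rfl⟩, h1⟩, h2⟩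
  rw [polar_mem_curve h.extendedFamily.K_pos' (h.extendedFamily.profile _)] at h1 h2
  rcases o₁ with _ | i <;> rcases o₂ with _ | j <;> rcases o₃ with _ | l <;>
    simp only [ne_eq, not_true_eq_false, Option.some.injEq] at h12 h13 h23
  · exact h.not_hat_and_exchanges h23 h1 (h1.symm.trans h2)
  · exact h.not_hat_and_exchanges h13 h1.symm h2
  · exact h.not_hat_and_exchanges h12 h2.symm h1
  · exact h.not_three_wires h12 h13 h23 h1 h2

/-! ### Crossings with the additional curve -/

theorem card_hat_meets (h : Diagram N K ev σ) (i : Fin N) :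
    ((Finset.Ico 0 K).filter fun k => σ k i = 1 ∧ (ev (k - 1) = 1 ∨ ev (k + 1) = 1)).card =
      ((Finset.Ico 0 K).filter fun k => ev k = 1 ∧ σ k i ≤ 1).card := by
  symm
  have hK := h.K_mod
  have hstep : ∀ k, ev k = 1 → σ k i ≤ 1 →
      ev (k + 1) = 0 ∧ σ (k + 1) i = σ k i ∧ σ (k - 1) i = 1 - σ k i := by
    intro k hk hσ
    have h1 := h.ev_mod_of_eq_one hk
    have h2 := h.ev_eq_zero (show (k + 1) % 4 ≠ 2 by omega)
    have h3 := h.σ_eq_of_ev_eq_zero h2 i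
    rw [add_sub_cancel_right] at h3
    have h4 := h.step k i
    have h5 := swapLetter_cases (ev k) (σ (k - 1) i)
    exact ⟨h2, h3, by omega⟩
  -- A wire that arrives at the bottom position met the additional curve just before the crossing; a
  -- wire that leaves it meets the curve just after.
  refine Finset.card_bij (fun k _ => if σ k i = 0 then k - 1 else k + 1) ?_ ?_ ?_
  · intro k hk
    simp only [Finset.mem_filter, Finset.mem_Ico] at hk ⊢
    obtain ⟨h1, h2, h3⟩ := hstep k hk.2.1 hk.2.2
    have h4 := h.ev_mod_of_eq_one hk.2.1
    split_ifs with h5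
    · refine ⟨by omega, by omega, Or.inr ?_⟩
      rw [sub_add_cancel, hk.2.1]
    · refine ⟨by omega, by omega, Or.inl ?_⟩
      rw [add_sub_cancel_right, hk.2.1]
  · intro a ha b hb hab
    simp only [Finset.mem_filter, Finset.mem_Ico] at ha hb
    have h1 := h.ev_mod_of_eq_one ha.2.1
    have h2 := h.ev_mod_of_eq_one hb.2.1
    split_ifs at hab <;> omega
  · intro k hk
    simp only [Finset.mem_filter, Finset.mem_Ico] at hk ⊢
    obtain ⟨⟨hk0, hkK⟩, hσ, hk | hk⟩ := hk
    · have h1 := h.ev_mod_of_eq_one hk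
      have h2 := h.σ_eq_of_ev_eq_zero (h.ev_eq_zero (show k % 4 ≠ 2 by omega)) i
      refine ⟨k - 1, ⟨by omega, hk, by omega⟩, ?_⟩
      rw [if_neg (by omega), sub_add_cancel]
    · have h1 := h.ev_mod_of_eq_one hk
      have h4 := h.step (k + 1) i
      rw [add_sub_cancel_right] at h4
      have h5 := swapLetter_cases (ev (k + 1)) (σ k i)
      refine ⟨k + 1, ⟨by omega, hk, by omega⟩, ?_⟩
      rw [if_pos (by omega), add_sub_cancel_right]

theorem hat_inter_ncard (h : Diagram N K ev σ) (i : Fin N) :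
    (curve K (hat ev) ∩ curve K (wire ev σ i)).ncard =
      ((Finset.Ico 0 K).filter fun k => ev k = 1 ∧ σ k i ≤ 1).card := by
  rw [← h.card_hat_meets]
  refine h.extendedFamily.inter_ncard (i := none) (j := some i) (by simp) _ fun k => ?_
  rw [Finset.mem_filter, Finset.mem_Ico, and_assoc]
  refine and_congr_right fun _ => and_congr_right fun _ => ?_
  change _ ↔ hat ev k = wire ev σ i k
  rw [h.hat_eq_wire_iff]
  constructor
  · intro hk
    exact ⟨k, rfl, hk⟩
  · rintro ⟨l, hl, hk⟩
    have : k = l := by exact_mod_cast hl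
    rwa [this]

theorem wire_lt_hat_of_ev (h : Diagram N K ev σ) {k : ℤ} {i : Fin N} (hk : ev k = 1)
    (hi : σ k i ≤ 1) : wire ev σ i k < hat ev k := by
  rw [h.wire_eq_level i le_rfl (by linarith)]
  rcases (by omega : σ k i = 0 ∨ σ k i = 1) with h1 | h1
  · rw [h1]; exact level_zero_lt_hat ev k
  · rw [h1, level, hat, interp_intCast, interp_intCast]
    rcases h.hatValue_level_one k with ⟨a1, a2⟩ | ⟨a1, a3, a2⟩ | ⟨a1, a3, a4, a2⟩
    · exact a2
    · omega
    · omega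

theorem exists_hat_lt_wire (h : Diagram N K ev σ) {k : ℤ} {i : Fin N} (hk : ev k = 1)
    (hi : σ k i ≤ 1) : ∃ x, hat ev x < wire ev σ i x := by
  have hmod := h.ev_mod_of_eq_one hk
  have key : ∀ l : ℤ, l % 4 = 0 → σ l i = 1 → hat ev l < wire ev σ i l := by
    intro l hl h1
    rw [h.wire_eq_level i le_rfl (by linarith), h1, level, hat, interp_intCast, interp_intCast]
    have e1 := h.ev_eq_zero (show l % 4 ≠ 2 by omega)
    have e2 := h.ev_eq_zero (show (l - 1) % 4 ≠ 2 by omega)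
    have e3 := h.ev_eq_zero (show (l + 1) % 4 ≠ 2 by omega)
    rcases h.hatValue_level_one l with ⟨a1, a2⟩ | ⟨a1, a3, a2⟩ | ⟨a1, a3, a4, a2⟩
    · omega
    · omega
    · exact a2
  -- Two units before or after the crossing, on the side where the wire runs on the level `1`, the
  -- additional curve is already below it.
  rcases (by omega : σ k i = 0 ∨ σ k i = 1) with h1 | h1
  · have h2 := h.σ_eq_of_ev_eq_zero (h.ev_eq_zero (show (k - 1) % 4 ≠ 2 by omega)) i
    have h4 := h.step k i
    have h5 := swapLetter_cases (ev k) (σ (k - 1) i)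
    refine ⟨_, key (k - 1 - 1) (by omega) (by omega)⟩
  · have h2 := h.σ_eq_of_ev_eq_zero (h.ev_eq_zero (show (k + 1) % 4 ≠ 2 by omega)) i
    have h3 := h.σ_eq_of_ev_eq_zero (h.ev_eq_zero (show (k + 1 + 1) % 4 ≠ 2 by omega)) i
    rw [add_sub_cancel_right] at h2 h3
    refine ⟨_, key (k + 1 + 1) (by omega) (by omega)⟩

theorem isArrangement_addCurve (h : Diagram N K ev σ) :
    IsArrangement (addCurve (fun i => curve (K : ℝ) (wire ev σ i)) (curve K (hat ev))) := by
  have hext := h.extendedFamily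
  have hat_wire : ∀ i, curve (K : ℝ) (hat ev) ∩ curve K (wire ev σ i) = ∅ ∨
      (curve (K : ℝ) (hat ev) ∩ curve K (wire ev σ i)).ncard = 2 ∧
        (∃ x, wire ev σ i x < hat ev x) ∧ ∃ x, hat ev x < wire ev σ i x := by
    intro i
    have h1 := h.hat_inter_ncard i
    rcases Set.eq_empty_or_nonempty (curve (K : ℝ) (hat ev) ∩ curve K (wire ev σ i)) with h0 | h0
    · exact Or.inl h0
    · right
      obtain ⟨_, ⟨x, rfl⟩, hx⟩ := h0
      rw [polar_mem_curve hext.K_pos' (h.isProfile_wire i)] at hx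
      obtain ⟨k, rfl, h2, h3⟩ := h.hat_eq_wire_iff.1 hx
      have h4 : ∃ l, ev l = 1 ∧ σ l i ≤ 1 := by
        rcases h3 with h3 | h3
        · refine ⟨k - 1, h3, ?_⟩
          have := h.ev_mod_of_eq_one h3
          rw [← h.σ_eq_of_ev_eq_zero (h.ev_eq_zero (show k % 4 ≠ 2 by omega)) i]
          omega
        · refine ⟨k + 1, h3, ?_⟩
          have h4 := h.step (k + 1) i
          rw [add_sub_cancel_right] at h4
          have h5 := swapLetter_cases (ev (k + 1)) (σ k i)
          omega
      obtain ⟨l, h5, h6⟩ := h4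
      refine ⟨?_, ⟨l, h.wire_lt_hat_of_ev h5 h6⟩, h.exists_hat_lt_wire h5 h6⟩
      rw [h1]
      -- A wire is moved by a letter `1` either never or twice in a period; the crossing at the time
      -- `l`, reduced modulo `K`, excludes the first case.
      refine (h.visits i).resolve_left fun h7 => ?_
      rw [Finset.card_eq_zero, Finset.filter_eq_empty_iff] at h7
      have h8 := Int.emod_nonneg l h.K_pos.ne'
      have h9 := Int.emod_lt_of_pos l h.K_pos
      have hev : ∀ m : ℤ, ev (l + m * K) = ev l := fun m =>
        Function.Periodic.int_mul (f := ev) (c := K) h.ev_per m l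
      have hσ : ∀ m : ℤ, σ (l + m * K) i = σ l i := fun m =>
        Function.Periodic.int_mul (f := fun k => σ k i) (c := K) (fun k => h.σ_per k i) m l
      have e : l % K = l + -(l / K) * K := by
        have := Int.emod_add_mul_ediv l K
        linarith
      refine h7 (Finset.mem_Ico.2 ⟨h8, h9⟩) ⟨?_, ?_⟩
      · rw [e, hev, h5]
      · rw [e, hσ]; exact h6
  rw [addCurve_eq]
  refine ⟨fun o => isSimpleClosedCurve_curve hext.K_pos' (hext.profile o), fun o o' hne => ?_⟩
  rcases o with _ | i <;> rcases o' with _ | j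
  · exact absurd rfl hne
  · rcases hat_wire j with h1 | ⟨h1, ⟨x, hx⟩, ⟨y, hy⟩⟩
    · exact Or.inl h1
    · exact Or.inr ⟨h1, hext.exists_separates (i := none) (j := some j) hx hy⟩
  · rcases hat_wire i with h1 | ⟨h1, ⟨x, hx⟩, ⟨y, hy⟩⟩
    · left
      rw [Set.inter_comm]
      exact h1
    · right
      rw [Set.inter_comm]
      exact ⟨h1, hext.exists_separates (i := some i) (j := none) hy hx⟩
  · exact h.isArrangement.pairwise i j fun e => hne (by rw [e])

end Wiring.Diagram

namespace Wiring

open Pseudocircle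

/-! ### Successive times -/

structure Successive (P : ℤ → Prop) (a b : ℤ) : Prop where
  lt : a < b
  left : P a
  right : P b
  between : ∀ k, a < k → k < b → ¬ P k

section Successive

variable {P : ℤ → Prop} {K : ℤ}

theorem periodic_add_mul (hper : ∀ k, P (k + K) ↔ P k) (k m : ℤ) : P (k + m * K) ↔ P k :=
  iff_of_eq <| Function.Periodic.int_mul (f := P) (c := K) (fun k => propext (hper k)) m k

theorem exists_successive (hK : 0 < K) (hper : ∀ k, P (k + K) ↔ P k) (hne : ∃ k, P k) {x : ℝ}
    (hx : ∀ k : ℤ, x = k → ¬ P k) : ∃ a b : ℤ, Successive P a b ∧ (a : ℝ) < x ∧ x < b := by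
  obtain ⟨k₀, hk₀⟩ := hne
  have hK' : (0 : ℝ) < K := by exact_mod_cast hK
  obtain ⟨a, ⟨h1, h2⟩, h3⟩ := Int.exists_greatest_of_bdd
    (P := fun k : ℤ => P k ∧ (k : ℝ) ≤ x) ⟨⌊x⌋, fun z hz => Int.le_floor.2 hz.2⟩ (by
      obtain ⟨m, hm⟩ := exists_int_lt ((x - k₀) / K)
      refine ⟨k₀ + m * K, (periodic_add_mul hper k₀ m).2 hk₀, ?_⟩
      rw [lt_div_iff₀ hK'] at hm
      push_cast
      linarith)
  obtain ⟨b, ⟨h4, h5⟩, h6⟩ := Int.exists_least_of_bdd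
    (P := fun k : ℤ => P k ∧ x ≤ k) ⟨⌈x⌉, fun z hz => Int.ceil_le.2 hz.2⟩ (by
      obtain ⟨m, hm⟩ := exists_int_gt ((x - k₀) / K)
      refine ⟨k₀ + m * K, (periodic_add_mul hper k₀ m).2 hk₀, ?_⟩
      rw [div_lt_iff₀ hK'] at hm
      push_cast
      linarith)
  have h7 : (a : ℝ) < x := lt_of_le_of_ne h2 fun e => hx a e.symm h1
  have h8 : x < b := lt_of_le_of_ne h5 fun e => hx b e h4
  refine ⟨a, b, ⟨by exact_mod_cast h7.trans h8, h1, h4, fun k hak hkb hk => ?_⟩, h7, h8⟩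
  rcases le_total (k : ℝ) x with h | h
  · exact absurd (h3 k ⟨hk, h⟩) (not_le.2 hak)
  · exact absurd (h6 k ⟨hk, h⟩) (not_le.2 hkb)

theorem exists_successive_of_left (hK : 0 < K) (hper : ∀ k, P (k + K) ↔ P k) {a : ℤ} (ha : P a) :
    ∃ b, Successive P a b := by
  obtain ⟨a', b, h, h1, h2⟩ := exists_successive hK hper ⟨a, ha⟩ (x := a + 1 / 2) (by
    intro k hk
    have : (2 * a + 1 : ℝ) = 2 * k := by linarith
    have : 2 * a + 1 = 2 * k := by exact_mod_cast this
    omega)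
  have h3 : ((2 * a' : ℤ) : ℝ) < ((2 * a + 1 : ℤ) : ℝ) := by push_cast; linarith
  have h4 : ((2 * a + 1 : ℤ) : ℝ) < ((2 * b : ℤ) : ℝ) := by push_cast; linarith
  have h5 : 2 * a' < 2 * a + 1 := by exact_mod_cast h3
  have h6 : 2 * a + 1 < 2 * b := by exact_mod_cast h4
  have : a' = a := by
    by_contra hne
    exact h.between a (by omega) (by omega) ha
  exact ⟨b, this ▸ h⟩

theorem Successive.add (hper : ∀ k, P (k + K) ↔ P k) {a b : ℤ} (h : Successive P a b) (m : ℤ) :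
    Successive P (a + m * K) (b + m * K) where
  lt := by have := h.lt; omega
  left := (periodic_add_mul hper a m).2 h.left
  right := (periodic_add_mul hper b m).2 h.right
  between k h1 h2 hk := by
    refine h.between (k + (-m) * K) ?_ ?_ ((periodic_add_mul hper k (-m)).2 hk) <;>
    · rw [neg_mul]; omega

theorem Successive.le_add (hK : 0 < K) (hper : ∀ k, P (k + K) ↔ P k) {a b : ℤ}
    (h : Successive P a b) : b ≤ a + K := by
  by_contra hlt
  exact h.between (a + K) (by omega) (by omega) ((hper a).2 h.left)

/-- Successive times with overlapping intervals agree. -/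
theorem Successive.unique {a b a' b' : ℤ} (h : Successive P a b) (h' : Successive P a' b')
    (h1 : a < b') (h2 : a' < b) : a = a' ∧ b = b' := by
  constructor
  · rcases lt_trichotomy a a' with h3 | h3 | h3
    · exact absurd h'.left (h.between a' h3 h2)
    · exact h3
    · exact absurd h.left (h'.between a h3 h1)
  · rcases lt_trichotomy b b' with h3 | h3 | h3
    · exact absurd h.right (h'.between b h2 h3)
    · exact h3
    · exact absurd h'.right (h.between b' h1 h3)

end Successive

/-! ### Strips between two profiles -/

/-- The point at the height `t` of the strip between `f` and `g`. -/
noncomputable def strip (K : ℝ) (f g : ℝ → ℝ) (q : ℝ × ℝ) : ℂ :=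
  polar K q.1 (f q.1 + q.2 * (g q.1 - f q.1))

/-- The open region between the profiles `f` and `g` and the times `a` and `b`. -/
def region (K : ℝ) (f g : ℝ → ℝ) (a b : ℝ) : Set ℂ := strip K f g '' (Ioo a b ×ˢ Ioo 0 1)

section Strip

variable {K : ℝ} {f g : ℝ → ℝ} {a b : ℝ}

theorem continuous_strip (hf : IsProfile K f) (hg : IsProfile K g) : Continuous (strip K f g) := by
  have h1 := hf.continuous
  have h2 := hg.continuous
  exact (continuous_polar K).comp (continuous_fst.prodMk (by fun_prop))

theorem mem_region (hfg : ∀ x, a < x → x < b → f x < g x) {z : ℂ} :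
    z ∈ region K f g a b ↔ ∃ x r, a < x ∧ x < b ∧ f x < r ∧ r < g x ∧ z = polar K x r := by
  constructor
  · rintro ⟨⟨x, t⟩, ⟨⟨h1, h2⟩, h3, h4⟩, rfl⟩
    have := hfg x h1 h2
    simp only at h1 h2 h3 h4
    refine ⟨x, _, h1, h2, ?_, ?_, rfl⟩ <;> dsimp only <;> nlinarith
  · rintro ⟨x, r, h1, h2, h3, h4, rfl⟩
    have := hfg x h1 h2
    refine ⟨(x, (r - f x) / (g x - f x)), ⟨⟨h1, h2⟩, div_pos (by linarith) (by linarith), ?_⟩, ?_⟩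
    · simp only
      rw [div_lt_one (by linarith)]
      linarith
    · simp only [strip]
      rw [div_mul_cancel₀ _ (by linarith), add_sub_cancel]

theorem mem_closure_region (hf : IsProfile K f) (hg : IsProfile K g) (hab : a < b)
    (hfg : ∀ x, f x ≤ g x) {z : ℂ} : z ∈ closure (region K f g a b) ↔
      ∃ x r, a ≤ x ∧ x ≤ b ∧ f x ≤ r ∧ r ≤ g x ∧ z = polar K x r := by
  have hc := continuous_strip hf hg
  have : closure (region K f g a b) = strip K f g '' (Icc a b ×ˢ Icc 0 1) := by
    refine Subset.antisymm ?_ ?_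
    · exact closure_minimal (image_mono (prod_mono Ioo_subset_Icc_self Ioo_subset_Icc_self))
        ((isCompact_Icc.prod isCompact_Icc).image hc).isClosed
    · rw [← closure_Ioo hab.ne, ← closure_Ioo (zero_ne_one (α := ℝ)), ← closure_prod_eq]
      exact image_closure_subset_closure_image hc
  rw [this]
  constructor
  · rintro ⟨⟨x, t⟩, ⟨⟨h1, h2⟩, h3, h4⟩, rfl⟩
    have := hfg x
    simp only at h1 h2 h3 h4
    refine ⟨x, _, h1, h2, ?_, ?_, rfl⟩ <;> dsimp only <;> nlinarith
  · rintro ⟨x, r, h1, h2, h3, h4, rfl⟩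
    rcases (hfg x).eq_or_lt with h5 | h5
    · refine ⟨(x, 0), ⟨⟨h1, h2⟩, by simp⟩, ?_⟩
      simp only [strip, zero_mul, add_zero]
      rw [show f x = r by linarith]
    · refine ⟨(x, (r - f x) / (g x - f x)),
        ⟨⟨h1, h2⟩, div_nonneg (by linarith) (by linarith), ?_⟩, ?_⟩
      · simp only
        rw [div_le_one (by linarith)]
        linarith
      · simp only [strip]
        rw [div_mul_cancel₀ _ (by linarith), add_sub_cancel]

theorem isPreconnected_region (hf : IsProfile K f) (hg : IsProfile K g) :
    IsPreconnected (region K f g a b) :=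
  (isPreconnected_Ioo.prod isPreconnected_Ioo).image _ (continuous_strip hf hg).continuousOn

theorem isOpen_region (hK : 0 < K) (hf : IsProfile K f) (hg : IsProfile K g)
    (hfg : ∀ x, a < x → x < b → f x < g x) : IsOpen (region K f g a b) := by
  have h1 := hf.continuous
  have h2 := hg.continuous
  have : region K f g a b = (fun p : ℝ × ℝ => polar K p.1 p.2) ''
      ({p | p.1 ∈ Ioo a b} ∩ ({p | f p.1 < p.2} ∩ {p | p.2 < g p.1})) := by
    ext z
    rw [mem_region hfg]
    constructor
    · rintro ⟨x, r, h1, h2, h3, h4, rfl⟩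
      exact ⟨(x, r), ⟨⟨h1, h2⟩, h3, h4⟩, rfl⟩
    · rintro ⟨⟨x, r⟩, ⟨⟨h1, h2⟩, h3, h4⟩, rfl⟩
      exact ⟨x, r, h1, h2, h3, h4, rfl⟩
  rw [this]
  refine isOpen_polar_image hK ((isOpen_Ioo.preimage continuous_fst).inter
    ((isOpen_lt (by fun_prop) continuous_snd).inter (isOpen_lt continuous_snd (by fun_prop))))

theorem region_add (hK : 0 < K) (hf : IsProfile K f) (hg : IsProfile K g) (m : ℤ) :
    region K f g (a + m * K) (b + m * K) = region K f g a b := by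
  have key : ∀ q : ℝ × ℝ, ∀ m : ℤ, strip K f g (q.1 + m * K, q.2) = strip K f g q := by
    intro q m
    simp only [strip, hf.add_int_mul, hg.add_int_mul]
    exact (polar_eq_iff hK).2 ⟨rfl, m, rfl⟩
  ext z
  constructor
  · rintro ⟨q, ⟨⟨h1, h2⟩, h3⟩, rfl⟩
    refine ⟨(q.1 + (-m : ℤ) * K, q.2), ⟨⟨?_, ?_⟩, h3⟩, key q (-m)⟩ <;> push_cast <;> linarith
  · rintro ⟨q, ⟨⟨h1, h2⟩, h3⟩, rfl⟩
    refine ⟨(q.1 + m * K, q.2), ⟨⟨?_, ?_⟩, h3⟩, key q m⟩ <;> simp only <;> linarith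

theorem tendsto_polar_atBot (K x : ℝ) :
    Filter.Tendsto (fun r => polar K x r) Filter.atBot (nhds 0) := by
  rw [tendsto_zero_iff_norm_tendsto_zero]
  refine Real.tendsto_exp_atBot.congr fun r => ?_
  simp [polar, Complex.norm_exp]

theorem polar_mem_closure_inside (hK : 0 < K) (hf : IsProfile K f) {x r : ℝ} :
    polar K x r ∈ closure (inside K f) ↔ r ≤ f x := by
  constructor
  · intro h
    by_contra hlt
    have h1 : outside K f ∩ inside K f ≠ ∅ := Set.Nonempty.ne_empty <|
      mem_closure_iff.1 h _ (isOpen_outside hK hf) ((polar_mem_outside hK hf).2 (not_le.1 hlt))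
    exact h1 (disjoint_inside_outside hK hf).symm.inter_eq
  · intro h
    have h1 : Continuous fun s => polar K x s :=
      (continuous_polar K).comp (continuous_const.prodMk continuous_id)
    have h2 : r ∈ closure (Iio (f x)) := by rwa [closure_Iio, mem_Iic]
    refine closure_mono ?_ (image_closure_subset_closure_image h1 ⟨r, h2, rfl⟩)
    rintro _ ⟨s, hs, rfl⟩
    exact (polar_mem_inside hK hf).2 hs

theorem polar_mem_closure_outside (hK : 0 < K) (hf : IsProfile K f) {x r : ℝ} :
    polar K x r ∈ closure (outside K f) ↔ f x ≤ r := by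
  constructor
  · intro h
    by_contra hlt
    have h1 : inside K f ∩ outside K f ≠ ∅ := Set.Nonempty.ne_empty <|
      mem_closure_iff.1 h _ (isOpen_inside hK hf) ((polar_mem_inside hK hf).2 (not_le.1 hlt))
    exact h1 (disjoint_inside_outside hK hf).inter_eq
  · intro h
    have h1 : Continuous fun s => polar K x s :=
      (continuous_polar K).comp (continuous_const.prodMk continuous_id)
    have h2 : r ∈ closure (Ioi (f x)) := by rwa [closure_Ioi, mem_Ici]
    refine closure_mono ?_ (image_closure_subset_closure_image h1 ⟨r, h2, rfl⟩)
    rintro _ ⟨s, hs, rfl⟩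
    exact (polar_mem_outside hK hf).2 hs

theorem isPreconnected_outside (hf : IsProfile K f) : IsPreconnected (outside K f) := by
  have h1 := hf.continuous
  have : outside K f = (fun p : ℝ × ℝ => polar K p.1 (f p.1 + p.2)) '' (univ ×ˢ Ioi 0) := by
    ext z
    constructor
    · rintro ⟨x, r, h, rfl⟩
      exact ⟨(x, r - f x), ⟨trivial, sub_pos.2 h⟩, by simp⟩
    · rintro ⟨⟨x, t⟩, ⟨-, h⟩, rfl⟩
      exact ⟨x, f x + t, by simpa using h, rfl⟩
  rw [this]
  exact (isPreconnected_univ.prod isPreconnected_Ioi).image _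
    ((continuous_polar K).comp (continuous_fst.prodMk (by fun_prop))).continuousOn

/-- Without the origin, the inside is a continuous image of a half-plane, and the origin lies in its
closure. -/
theorem isPreconnected_inside (hf : IsProfile K f) : IsPreconnected (inside K f) := by
  have h1 := hf.continuous
  have hA : IsPreconnected ((fun p : ℝ × ℝ => polar K p.1 (f p.1 + p.2)) '' (univ ×ˢ Iio 0)) :=
    (isPreconnected_univ.prod isPreconnected_Iio).image _
      ((continuous_polar K).comp (continuous_fst.prodMk (by fun_prop))).continuousOn
  refine hA.subset_closure ?_ ?_
  · rintro _ ⟨⟨x, t⟩, ⟨-, h⟩, rfl⟩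
    exact Or.inr ⟨x, f x + t, by simpa using h, rfl⟩
  · rintro z (rfl | ⟨x, r, h, rfl⟩)
    · refine mem_closure_of_tendsto (tendsto_polar_atBot K 0) ?_
      filter_upwards [Filter.eventually_lt_atBot (f 0)] with r hr
      exact ⟨(0, r - f 0), ⟨trivial, sub_neg.2 hr⟩, by simp⟩
    · exact subset_closure ⟨(x, r - f x), ⟨trivial, sub_neg.2 h⟩, by simp⟩

end Strip

end Wiring

namespace Wiring.Diagram

open Pseudocircle

variable {N : ℕ} {K : ℤ} {ev : ℤ → ℕ} {σ : ℤ → Fin N → ℕ}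

/-! ### Cells of a diagram -/

theorem K_pos' (h : Diagram N K ev σ) : 0 < (K : ℝ) := h.radialFamily.K_pos'

/-- At any time the wires occupy all positions, so their union is the union of the levels. The cells
depend only on the levels. -/
theorem polar_mem_iUnion (h : Diagram N K ev σ) {x r : ℝ} :
    polar K x r ∈ ⋃ i, curve (K : ℝ) (wire ev σ i) ↔ ∃ p < N, r = level ev p x := by
  obtain ⟨k, h1, h2⟩ := exists_unit_interval x
  simp only [mem_iUnion, polar_mem_curve h.K_pos' (h.isProfile_wire _)]
  constructor
  · rintro ⟨i, hi⟩
    exact ⟨_, h.σ_lt k i, by rw [hi, h.wire_eq_level i h1 h2.le]⟩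
  · rintro ⟨p, hp, hr⟩
    obtain ⟨i, hi⟩ := h.exists_position k hp
    exact ⟨i, by rw [hr, h.wire_eq_level i h1 h2.le, hi]⟩

theorem zero_notMem_iUnion : (0 : ℂ) ∉ ⋃ i, curve (K : ℝ) (wire ev σ i) := by
  simp only [mem_iUnion, not_exists]
  rintro i ⟨x, hx⟩
  exact polar_ne_zero _ _ _ hx

theorem connectedComponentIn_inside (h : Diagram N K ev σ) {z : ℂ}
    (hz : z ∈ inside K (level ev 0)) :
    connectedComponentIn (⋃ i, curve (K : ℝ) (wire ev σ i))ᶜ z = inside K (level ev 0) := by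
  have hK := h.K_pos'
  have hp := h.isProfile_level 0
  refine connectedComponentIn_eq_of_clopen hz (isPreconnected_inside hp) ?_ (isOpen_inside hK hp)
    (isClosed_closure (s := inside K (level ev 0))) subset_rfl subset_closure inter_subset_right ?_
  · rintro _ (rfl | ⟨x, r, hr, rfl⟩)
    · exact zero_notMem_iUnion
    · rw [mem_compl_iff, h.polar_mem_iUnion]
      rintro ⟨p, -, rfl⟩
      exact absurd (level_le ev (Nat.zero_le p) x) (not_le.2 hr)
  · rintro z ⟨hF, hc⟩
    by_cases h0 : z = 0
    · exact Or.inl h0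
    obtain ⟨x, r, rfl⟩ := exists_polar_eq hK h0
    rw [polar_mem_closure_inside hK hp] at hc
    rw [polar_mem_inside hK hp]
    refine lt_of_le_of_ne hc fun e => hF (h.polar_mem_iUnion.2 ⟨0, ?_, e⟩)
    have := h.six_le
    omega

theorem connectedComponentIn_outside (h : Diagram N K ev σ) {z : ℂ}
    (hz : z ∈ outside K (level ev (N - 1))) :
    connectedComponentIn (⋃ i, curve (K : ℝ) (wire ev σ i))ᶜ z = outside K (level ev (N - 1)) := by
  have hK := h.K_pos'
  have hp := h.isProfile_level (N - 1)
  refine connectedComponentIn_eq_of_clopen hz (isPreconnected_outside hp) ?_ (isOpen_outside hK hp)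
    (isClosed_closure (s := outside K (level ev (N - 1)))) subset_rfl subset_closure
    inter_subset_right ?_
  · rintro _ ⟨x, r, hr, rfl⟩
    rw [mem_compl_iff, h.polar_mem_iUnion]
    rintro ⟨p, hp, rfl⟩
    exact absurd (level_le ev (show p ≤ N - 1 by omega) x) (not_le.2 hr)
  · rintro z ⟨hF, hc⟩
    have h0 : z ≠ 0 := by
      rintro rfl
      obtain ⟨w, hw, x, r, hr, rfl⟩ := mem_closure_iff.1 hc _
        (isOpen_inside hK hp) (Or.inl rfl)
      exact absurd ((polar_mem_inside hK hp).1 hw) (not_lt.2 hr.le)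
    obtain ⟨x, r, rfl⟩ := exists_polar_eq hK h0
    rw [polar_mem_closure_outside hK hp] at hc
    rw [polar_mem_outside hK hp]
    refine lt_of_le_of_ne hc fun e => hF (h.polar_mem_iUnion.2 ⟨N - 1, ?_, e.symm⟩)
    have := h.six_le
    omega

theorem level_lt_succ (h : Diagram N K ev σ) {p : ℕ} {x : ℝ} (hx : ∀ k : ℤ, x = k → ev k ≠ p + 1) :
    level ev p x < level ev (p + 1) x :=
  h.level_lt (Nat.lt_succ_self p) fun k hk h1 => absurd h1 (hx k hk)

theorem Successive.level_lt_succ (h : Diagram N K ev σ) {p : ℕ} {u v : ℤ}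
    (huv : Successive (fun k => ev k = p + 1) u v) (x : ℝ) (h1 : u < x) (h2 : x < v) :
    level ev p x < level ev (p + 1) x := by
  refine h.level_lt_succ ?_
  rintro k rfl
  exact huv.between k (by exact_mod_cast h1) (by exact_mod_cast h2)

/-- The region is open and avoids the curves. Its boundary lies on the two levels, which pinch
together at the times `u` and `v`, so the region is also closed in the complement. -/
theorem connectedComponentIn_region (h : Diagram N K ev σ) {p : ℕ} (hpN : p + 1 < N) {u v : ℤ}
    (huv : Successive (fun k => ev k = p + 1) u v) {z : ℂ}
    (hz : z ∈ region K (level ev p) (level ev (p + 1)) u v) :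
    connectedComponentIn (⋃ i, curve (K : ℝ) (wire ev σ i))ᶜ z =
      region K (level ev p) (level ev (p + 1)) u v := by
  have hK := h.K_pos'
  have hp := h.isProfile_level p
  have hp' := h.isProfile_level (p + 1)
  have hlt := Successive.level_lt_succ h huv
  refine connectedComponentIn_eq_of_clopen hz (isPreconnected_region hp hp') ?_
    (isOpen_region hK hp hp' hlt) isClosed_closure subset_rfl subset_closure inter_subset_right ?_
  · intro z hz
    obtain ⟨x, r, h1, h2, h3, h4, rfl⟩ := (mem_region hlt).1 hz
    rw [mem_compl_iff, h.polar_mem_iUnion]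
    rintro ⟨q, -, rfl⟩
    rcases Nat.lt_or_ge p q with h5 | h5
    · exact absurd (level_le ev h5 x) (not_le.2 h4)
    · exact absurd (level_le ev h5 x) (not_le.2 h3)
  · rintro z ⟨hF, hc⟩
    obtain ⟨x, r, h1, h2, h3, h4, rfl⟩ := (mem_closure_region hp hp'
      (by exact_mod_cast huv.lt) (level_le ev (Nat.le_succ p))).1 hc
    have h5 : level ev p x < r := lt_of_le_of_ne h3 fun e =>
      hF (h.polar_mem_iUnion.2 ⟨p, by omega, e.symm⟩)
    have h6 : r < level ev (p + 1) x := lt_of_le_of_ne h4 fun e =>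
      hF (h.polar_mem_iUnion.2 ⟨p + 1, hpN, e⟩)
    refine (mem_region hlt).2 ⟨x, r, lt_of_le_of_ne h1 ?_, lt_of_le_of_ne h2 ?_, h5, h6, rfl⟩
    · rintro rfl
      rw [level_eq_of_ev huv.left] at h5
      exact absurd h6 (not_lt.2 h5.le)
    · rintro rfl
      rw [level_eq_of_ev huv.right] at h5
      exact absurd h6 (not_lt.2 h5.le)

/-- No wire passes a gap whose letter does not occur. As any two wires meet, this shows that every
letter is used. -/
theorem lt_iff_of_forall_ne (h : Diagram N K ev σ) {p : ℕ} (hp : ∀ k, ev k ≠ p) (i : Fin N)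
    (k : ℤ) : σ k i < p ↔ σ 0 i < p := by
  have key : ∀ k, σ (k + 1) i < p ↔ σ k i < p := by
    intro k
    have h1 := h.step (k + 1) i
    rw [add_sub_cancel_right] at h1
    have h2 := swapLetter_cases (ev (k + 1)) (σ k i)
    have h3 := hp (k + 1)
    omega
  induction k using Int.induction_on with
  | zero => rfl
  | succ k ih => exact (key _).trans ih
  | pred k ih =>
    have h1 := key (-k - 1)
    rw [sub_add_cancel] at h1
    exact h1.symm.trans ih

/-- Every letter occurs. -/
theorem exists_ev_eq (h : Diagram N K ev σ) {p : ℕ} (hp : p + 1 < N) : ∃ k, ev k = p + 1 := by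
  by_contra! hne
  obtain ⟨i, hi⟩ := h.exists_position 0 (show p < N by omega)
  obtain ⟨j, hj⟩ := h.exists_position 0 hp
  have hij : i ≠ j := by
    rintro rfl
    omega
  obtain ⟨k, -, -, hk⟩ := h.exists_exchanges hij
  have h1 := h.lt_iff_of_forall_ne hne i k
  have h2 := h.lt_iff_of_forall_ne hne j k
  have h3 := hne k
  unfold Exchanges at hk
  omega

theorem ev_eq_periodic (h : Diagram N K ev σ) (p : ℕ) (k : ℤ) : ev (k + K) = p ↔ ev k = p := by
  rw [h.ev_per]

theorem mem_cells (h : Diagram N K ev σ) {F : Set ℂ} :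
    F ∈ cells (fun i => curve (K : ℝ) (wire ev σ i)) ↔
      F = inside K (level ev 0) ∨ F = outside K (level ev (N - 1)) ∨
        ∃ p u v, p + 1 < N ∧ Successive (fun k => ev k = p + 1) u v ∧
          F = region K (level ev p) (level ev (p + 1)) u v := by
  have hK := h.K_pos'
  have hN := h.six_le
  constructor
  · rintro ⟨z, hz, rfl⟩
    by_cases h0 : z = 0
    · exact Or.inl (h.connectedComponentIn_inside (Or.inl h0))
    obtain ⟨x, r, rfl⟩ := exists_polar_eq hK h0
    rw [mem_compl_iff, h.polar_mem_iUnion] at hz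
    push Not at hz
    by_cases h1 : level ev (N - 1) x < r
    · right; left
      exact h.connectedComponentIn_outside ((polar_mem_outside hK (h.isProfile_level _)).2 h1)
    have h2 : ∃ p, p < N ∧ r < level ev p x :=
      ⟨N - 1, by omega, lt_of_le_of_ne (not_lt.1 h1) (hz _ (by omega))⟩
    classical
    -- The lowest level above the point determines the gap that contains it.
    obtain ⟨h3, h4⟩ := Nat.find_spec h2
    have h5 := fun q => Nat.find_min (m := q) h2
    rcases Nat.eq_zero_or_eq_succ_pred (Nat.find h2) with h6 | h6
    · rw [h6] at h4
      left
      exact h.connectedComponentIn_inside ((polar_mem_inside hK (h.isProfile_level _)).2 h4)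
    · set p := (Nat.find h2).pred
      rw [h6] at h4 h3
      have h7 : level ev p x < r := by
        refine lt_of_le_of_ne (not_lt.1 fun h7 => h5 p (by omega) ⟨by omega, h7⟩) ?_
        exact (hz p (by omega)).symm
      obtain ⟨u, v, huv, h8, h9⟩ := exists_successive h.K_pos (h.ev_eq_periodic (p + 1))
        (h.exists_ev_eq h3) (x := x) (by
          rintro k rfl e
          rw [level_eq_of_ev e] at h7
          exact absurd h4 (not_lt.2 h7.le))
      right; right
      refine ⟨p, u, v, h3, huv, h.connectedComponentIn_region h3 huv ?_⟩
      exact (mem_region (Successive.level_lt_succ h huv)).2 ⟨x, r, h8, h9, h7, h4, rfl⟩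
  · rintro (rfl | rfl | ⟨p, u, v, hp, huv, rfl⟩)
    · have h0 : (0 : ℂ) ∈ inside (K : ℝ) (level ev 0) := Or.inl rfl
      exact ⟨0, zero_notMem_iUnion, (h.connectedComponentIn_inside h0).symm⟩
    · have h0 : polar K 0 (level ev (N - 1) 0 + 1) ∈ outside (K : ℝ) (level ev (N - 1)) :=
        (polar_mem_outside hK (h.isProfile_level _)).2 (by linarith)
      have h1 := h.connectedComponentIn_outside h0
      refine ⟨_, ?_, h1.symm⟩
      by_contra hcon
      rw [connectedComponentIn_eq_empty hcon] at h1
      rw [← h1] at h0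
      exact h0
    · have h2 : (u : ℝ) < v := by exact_mod_cast huv.lt
      obtain ⟨x, h3, h4⟩ := exists_between h2
      obtain ⟨r, h5, h6⟩ := exists_between (Successive.level_lt_succ h huv x h3 h4)
      have h0 : polar K x r ∈ region (K : ℝ) (level ev p) (level ev (p + 1)) u v :=
        (mem_region (Successive.level_lt_succ h huv)).2 ⟨x, r, h3, h4, h5, h6, rfl⟩
      have h1 := h.connectedComponentIn_region hp huv h0
      refine ⟨_, ?_, h1.symm⟩
      by_contra hcon
      rw [connectedComponentIn_eq_empty hcon] at h1
      rw [← h1] at h0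
      exact h0

/-! ### Edges as arcs of levels -/

/-- A crossing at the time `k` involves the position `p`. -/
abbrev Near (ev : ℤ → ℕ) (p : ℕ) (k : ℤ) : Prop := ev k ≠ 0 ∧ (ev k = p ∨ ev k = p + 1)

theorem near_periodic (h : Diagram N K ev σ) (p : ℕ) (k : ℤ) :
    Near ev p (k + K) ↔ Near ev p k := by
  unfold Near
  rw [h.ev_per]

/-- The position of a wire is constant between successive crossings. -/
theorem σ_eq_of_forall_not_near (h : Diagram N K ev σ) (i : Fin N) {a b : ℤ}
    (hab : ∀ k, a < k → k < b → ¬ (ev k ≠ 0 ∧ (σ k i + 1 = ev k ∨ σ k i = ev k))) (k : ℤ)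
    (h1 : a ≤ k) (h2 : k < b) : σ k i = σ a i := by
  induction k, h1 using Int.leInduction with
  | base => rfl
  | succ k hk ih =>
    have h3 := h.step (k + 1) i
    rw [add_sub_cancel_right] at h3
    have h4 := swapLetter_cases (ev (k + 1)) (σ k i)
    have h5 := hab (k + 1) (by omega) h2
    have h6 := ih (by omega)
    omega

theorem σ_eq_of_not_near (h : Diagram N K ev σ) {i : Fin N} {p : ℕ} {a b : ℤ} (hi : σ a i = p)
    (hab : ∀ k, a < k → k < b → ¬ Near ev p k) (k : ℤ) (h1 : a ≤ k) (h2 : k < b) : σ k i = p := by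
  induction k, h1 using Int.leInduction with
  | base => exact hi
  | succ k hk ih =>
    have h3 := h.step (k + 1) i
    rw [add_sub_cancel_right] at h3
    have h4 := swapLetter_cases (ev (k + 1)) (σ k i)
    have h5 := hab (k + 1) (by omega) h2
    have h6 := ih (by omega)
    unfold Near at h5
    omega

theorem near_iff_pred (h : Diagram N K ev σ) (i : Fin N) (k : ℤ) :
    (ev k ≠ 0 ∧ (σ k i + 1 = ev k ∨ σ k i = ev k)) ↔ Near ev (σ (k - 1) i) k := by
  have h3 := h.step k i
  have h4 := swapLetter_cases (ev k) (σ (k - 1) i)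
  unfold Near
  omega

theorem near_iff {p : ℕ} {k : ℤ} : (ev k ≠ 0 ∧ (p + 1 = ev k ∨ p = ev k)) ↔ Near ev p k := by
  unfold Near
  omega

theorem arc_wire_eq (h : Diagram N K ev σ) (i : Fin N) {a b : ℤ} {p : ℕ}
    (hp : ∀ k, a ≤ k → k < b → σ k i = p) :
    arc (K : ℝ) (wire ev σ i) a b = arc K (level ev p) a b := by
  refine image_congr fun x hx => ?_
  obtain ⟨k, h1, h2⟩ := exists_unit_interval x
  have h3 : (a : ℝ) < ((k + 1 : ℤ) : ℝ) := by push_cast; linarith [hx.1]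
  have h4 : (k : ℝ) < b := by linarith [hx.2]
  have h5 : a < k + 1 := by exact_mod_cast h3
  rw [h.wire_eq_level i h1 h2.le, hp k (by omega) (by exact_mod_cast h4)]

/-- Between successive crossings a wire keeps its position. So edges can be described by levels
alone, as arcs between successive letters `p` or `p + 1`, without reference to the wires. -/
theorem mem_edges (h : Diagram N K ev σ) {e : Set ℂ} :
    e ∈ edges (fun i => curve (K : ℝ) (wire ev σ i)) ↔
      ∃ p a b, p < N ∧ Successive (Near ev p) a b ∧ e = arc K (level ev p) a b := by
  rw [h.radialFamily.mem_edges]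
  constructor
  · rintro ⟨i, a, b, hab, rfl⟩
    have hσ := h.σ_eq_of_forall_not_near i fun k h1 h2 =>
      mt h.eventAt_wire.2 (hab.between k h1 h2)
    refine ⟨σ a i, a, b, h.σ_lt a i, ⟨hab.lt, ?_, ?_, ?_⟩, h.arc_wire_eq i hσ⟩
    · exact near_iff.1 (h.eventAt_wire.1 hab.left)
    · have := (h.near_iff_pred i b).1 (h.eventAt_wire.1 hab.right)
      rwa [hσ (b - 1) (by have := hab.lt; omega) (by omega)] at this
    · intro k h1 h2 h3
      rw [← hσ (k - 1) (by omega) (by omega), ← h.near_iff_pred i k, ← h.eventAt_wire] at h3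
      exact hab.between k h1 h2 h3
  · rintro ⟨p, a, b, hp, hab, rfl⟩
    obtain ⟨i, rfl⟩ := h.exists_position a hp
    have key := h.σ_eq_of_not_near rfl hab.between
    have key' : ∀ k, a < k → k ≤ b → (EventAt (wire ev σ) i k ↔ Near ev (σ a i) k) := by
      intro k h1 h2
      rw [h.eventAt_wire, h.near_iff_pred, key (k - 1) (by omega) (by omega)]
    refine ⟨i, a, b, ⟨hab.lt, ?_, (key' b hab.lt le_rfl).2 hab.right, fun k h1 h2 h3 =>
      hab.between k h1 h2 ((key' k h1 h2.le).1 h3)⟩, (h.arc_wire_eq i key).symm⟩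
    rw [h.eventAt_wire, near_iff]
    exact hab.left

end Wiring.Diagram

namespace Wiring.Diagram

open Pseudocircle

variable {N : ℕ} {K : ℤ} {ev : ℤ → ℕ} {σ : ℤ → Fin N → ℕ}

/-! ### Boundary edges -/

/-- All levels are strictly ordered at the half-integral time after `a`; the point at this time
serves as a test point of an arc that starts at `a`. -/
theorem level_lt_of_half (h : Diagram N K ev σ) {p q : ℕ} (hpq : p < q) (a : ℤ) :
    level ev p (a + 1 / 2) < level ev q (a + 1 / 2) :=
  h.level_lt_of_unit (k := a) hpq (by linarith) (by linarith)

theorem level_add (h : Diagram N K ev σ) (p : ℕ) (x : ℝ) (m : ℤ) :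
    level ev p (x + m * K) = level ev p x := (h.isProfile_level p).add_int_mul x m

theorem eq_of_level_half_eq (h : Diagram N K ev σ) {p q : ℕ} {a : ℤ}
    (e : level ev p (a + 1 / 2) = level ev q (a + 1 / 2)) : p = q := by
  rcases lt_trichotomy p q with h1 | h1 | h1
  · exact absurd e (h.level_lt_of_half h1 a).ne
  · exact h1
  · exact absurd e (h.level_lt_of_half h1 a).ne'

theorem half_mem_arc (ev : ℤ → ℕ) (p : ℕ) {a b : ℤ} (hab : a < b) :
    polar K (a + 1 / 2) (level ev p (a + 1 / 2)) ∈ arc (K : ℝ) (level ev p) a b := by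
  have h1 : ((a + 1 : ℤ) : ℝ) ≤ b := by exact_mod_cast hab
  push_cast at h1
  exact ⟨a + 1 / 2, ⟨by linarith, by linarith⟩, rfl⟩

theorem arc_add (h : Diagram N K ev σ) (p : ℕ) (a b : ℝ) (m : ℤ) :
    arc (K : ℝ) (level ev p) (a + m * K) (b + m * K) = arc K (level ev p) a b := by
  have key : ∀ x : ℝ, ∀ m : ℤ, polar K (x + m * K) (level ev p (x + m * K)) =
      polar K x (level ev p x) := fun x m =>
    (polar_eq_iff h.K_pos').2 ⟨h.level_add p x m, m, rfl⟩
  ext z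
  constructor
  · rintro ⟨x, ⟨h1, h2⟩, rfl⟩
    refine ⟨x + (-m : ℤ) * K, ⟨?_, ?_⟩, key x (-m)⟩ <;> push_cast <;> linarith
  · rintro ⟨x, ⟨h1, h2⟩, rfl⟩
    exact ⟨x + m * K, ⟨by linarith, by linarith⟩, key x m⟩

theorem lt_of_half_lt {a b : ℤ} (h : (a : ℝ) + 1 / 2 < b) : a < b := by
  have : ((2 * a + 1 : ℤ) : ℝ) < ((2 * b : ℤ) : ℝ) := by push_cast; linarith
  have : 2 * a + 1 < 2 * b := by exact_mod_cast this
  omega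

theorem le_of_lt_half {a b : ℤ} (h : (a : ℝ) < b + 1 / 2) : a ≤ b := by
  have : ((2 * a : ℤ) : ℝ) < ((2 * b + 1 : ℤ) : ℝ) := by push_cast; linarith
  have : 2 * a < 2 * b + 1 := by exact_mod_cast this
  omega

theorem arc_eq_arc (h : Diagram N K ev σ) {p p' : ℕ} {a b a' b' : ℤ}
    (hab : Successive (Near ev p) a b) (hab' : Successive (Near ev p') a' b')
    (e : arc (K : ℝ) (level ev p) a b = arc K (level ev p') a' b') :
    p = p' ∧ ∃ m : ℤ, a = a' + m * K := by
  have h1 := half_mem_arc (K := K) ev p hab.lt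
  rw [e] at h1
  obtain ⟨x, ⟨h2, h3⟩, h4⟩ := h1
  obtain ⟨h5, m, h6⟩ := (polar_eq_iff h.K_pos').1 h4
  subst h6
  rw [h.level_add] at h5
  obtain rfl := h.eq_of_level_half_eq h5
  refine ⟨rfl, -m, ?_⟩
  have h7 := hab.add (h.near_periodic p') m
  have h8 : a + m * K < b' := lt_of_half_lt (by push_cast; linarith)
  have h9 : a' ≤ a + m * K := le_of_lt_half (by push_cast; linarith)
  have h10 := hab.lt
  have := (h7.unique hab' h8 (by omega)).1
  rw [neg_mul]
  omega

/-- The arcs of the levels with the given starting points are distinct. -/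
theorem encard_arcs (h : Diagram N K ev σ) (T : Finset (ℕ × ℤ)) (u : ℤ)
    (hT : ∀ q ∈ T, Near ev q.1 q.2 ∧ u ≤ q.2 ∧ q.2 < u + K) :
    {e | ∃ q ∈ T, ∃ b, Successive (Near ev q.1) q.2 b ∧
      e = arc (K : ℝ) (level ev q.1) q.2 b}.encard = T.card := by
  have h1 : ∀ q : ℕ × ℤ, ∃ b, Near ev q.1 q.2 → Successive (Near ev q.1) q.2 b := by
    intro q
    by_cases hq : Near ev q.1 q.2
    · obtain ⟨b, hb⟩ := exists_successive_of_left h.K_pos (h.near_periodic q.1) hq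
      exact ⟨b, fun _ => hb⟩
    · exact ⟨0, fun h => absurd h hq⟩
  choose b hb using h1
  have h2 : {e | ∃ q ∈ T, ∃ b, Successive (Near ev q.1) q.2 b ∧
      e = arc (K : ℝ) (level ev q.1) q.2 b} =
      (fun q : ℕ × ℤ => arc (K : ℝ) (level ev q.1) q.2 (b q)) '' (T : Set (ℕ × ℤ)) := by
    ext e
    constructor
    · rintro ⟨q, hq, b', hb', rfl⟩
      have hs := hb q (hT q hq).1
      have := (hs.unique hb' hb'.lt hs.lt).2
      exact ⟨q, hq, by simp only [this]⟩
    · rintro ⟨q, hq, rfl⟩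
      exact ⟨q, hq, b q, hb q (hT q hq).1, rfl⟩
  rw [h2, Set.InjOn.encard_image, Set.encard_coe_eq_coe_finsetCard]
  rintro ⟨p, a⟩ hq ⟨p', a'⟩ hq' e
  obtain ⟨h3, h4, h5⟩ := hT _ hq
  obtain ⟨h3', h4', h5'⟩ := hT _ hq'
  obtain ⟨h6, m, h7⟩ := h.arc_eq_arc (hb _ h3) (hb _ h3') e
  have hK := h.K_pos
  simp only at h4 h5 h4' h5' h6 h7
  have hm : m = 0 := by
    have h8 : m * K < 1 * K := by linarith
    have h9 : -1 * K < m * K := by linarith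
    have := lt_of_mul_lt_mul_right h8 hK.le
    have := lt_of_mul_lt_mul_right h9 hK.le
    omega
  subst hm
  rw [h6, h7]
  simp

theorem arc_subset_closure_inside (h : Diagram N K ev σ) {p : ℕ} {a b : ℤ} (hab : a < b) :
    arc (K : ℝ) (level ev p) a b ⊆ closure (inside K (level ev 0)) ↔ p = 0 := by
  have hp := h.isProfile_level 0
  constructor
  · intro hs
    have h1 := hs (half_mem_arc ev p hab)
    rw [polar_mem_closure_inside h.K_pos' hp] at h1
    by_contra h0
    exact absurd h1 (not_le.2 (h.level_lt_of_half (Nat.pos_of_ne_zero h0) a))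
  · rintro rfl _ ⟨x, -, rfl⟩
    exact (polar_mem_closure_inside h.K_pos' hp).2 le_rfl

theorem arc_subset_closure_outside (h : Diagram N K ev σ) {p : ℕ} (hpN : p < N) {a b : ℤ}
    (hab : a < b) :
    arc (K : ℝ) (level ev p) a b ⊆ closure (outside K (level ev (N - 1))) ↔ p = N - 1 := by
  have hp := h.isProfile_level (N - 1)
  constructor
  · intro hs
    have h1 := hs (half_mem_arc ev p hab)
    rw [polar_mem_closure_outside h.K_pos' hp] at h1
    by_contra h0
    exact absurd h1 (not_le.2 (h.level_lt_of_half (show p < N - 1 by omega) a))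
  · rintro rfl _ ⟨x, -, rfl⟩
    exact (polar_mem_closure_outside h.K_pos' hp).2 le_rfl

/-- The test point determines the level and the translate by periods. The arc then cannot extend
beyond `v`, because the letter there is a crossing on both levels of the gap. -/
theorem arc_subset_closure_region (h : Diagram N K ev σ) {p q : ℕ} {a b u v : ℤ}
    (hab : Successive (Near ev q) a b) (huv : Successive (fun k => ev k = p + 1) u v) :
    arc (K : ℝ) (level ev q) a b ⊆ closure (region K (level ev p) (level ev (p + 1)) u v) ↔
      (q = p ∨ q = p + 1) ∧ ∃ m : ℤ, u ≤ a + m * K ∧ b + m * K ≤ v := by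
  have hp := h.isProfile_level p
  have hp' := h.isProfile_level (p + 1)
  have hmem := fun {z : ℂ} => mem_closure_region (K := K) (z := z) hp hp'
    (a := u) (b := v) (by exact_mod_cast huv.lt) (level_le ev (Nat.le_succ p))
  constructor
  · intro hs
    obtain ⟨x, r, h1, h2, h3, h4, h5⟩ := hmem.1 (hs (half_mem_arc ev q hab.lt))
    obtain ⟨h6, m, h7⟩ := (polar_eq_iff h.K_pos').1 h5
    subst h6
    have h8 : x = ((a + -m * K : ℤ) : ℝ) + 1 / 2 := by push_cast; linarith
    have h9 : ((a : ℝ) + 1 / 2) = x + m * K := h7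
    rw [h9, h.level_add, h8] at h3 h4
    have h10 : q = p ∨ q = p + 1 := by
      by_contra hne
      rcases (by omega : q < p ∨ p + 1 < q) with h0 | h0
      · exact absurd h3 (not_le.2 (h.level_lt_of_half h0 _))
      · exact absurd h4 (not_le.2 (h.level_lt_of_half h0 _))
    refine ⟨h10, -m, le_of_lt_half ?_, ?_⟩
    · rw [← h8]
      refine lt_of_le_of_ne h1 fun e => ?_
      have h11 : ((2 * u : ℤ) : ℝ) = ((2 * (a + -m * K) + 1 : ℤ) : ℝ) := by push_cast; linarith
      have : 2 * u = 2 * (a + -m * K) + 1 := by exact_mod_cast h11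
      omega
    · by_contra h11
      have h12 : a + -m * K < v := lt_of_half_lt (by
        rw [← h8]
        refine lt_of_le_of_ne h2 fun e => ?_
        have h11 : ((2 * v : ℤ) : ℝ) = ((2 * (a + -m * K) + 1 : ℤ) : ℝ) := by push_cast; linarith
        have : 2 * v = 2 * (a + -m * K) + 1 := by exact_mod_cast h11
        omega)
      refine (hab.add (h.near_periodic q) (-m)).between v h12 (by omega) ?_
      have := huv.right
      unfold Near
      omega
  · rintro ⟨h1, m, h2, h3⟩ z hz
    rw [← h.arc_add q a b m] at hz
    obtain ⟨x, ⟨h4, h5⟩, rfl⟩ := hz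
    have h6 : (u : ℝ) ≤ a + m * K := by exact_mod_cast h2
    have h7 : (b : ℝ) + m * K ≤ v := by exact_mod_cast h3
    refine hmem.2 ⟨x, _, by linarith, by linarith, ?_, ?_, rfl⟩ <;>
      exact level_le ev (by omega) x

theorem encard_level_arcs (h : Diagram N K ev σ) (p : ℕ) :
    {e | ∃ a b, Successive (Near ev p) a b ∧ e = arc (K : ℝ) (level ev p) a b}.encard =
      ((Finset.Ico 0 K).filter fun k => Near ev p k).card := by
  have h1 := h.encard_arcs ({p} ×ˢ (Finset.Ico 0 K).filter fun k => Near ev p k) 0 (by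
    rintro ⟨q, a⟩ hq
    simp only [Finset.mem_product, Finset.mem_singleton, Finset.mem_filter, Finset.mem_Ico] at hq
    obtain ⟨rfl, ha, hn⟩ := hq
    exact ⟨hn, by simpa using ha⟩)
  rw [Finset.card_product, Finset.card_singleton, one_mul] at h1
  rw [← h1]
  congr 1
  ext e
  constructor
  · rintro ⟨a, b, hab, rfl⟩
    have h2 := hab.add (h.near_periodic p) (-(a / K))
    have h3 : a + -(a / K) * K = a % K := by
      have := Int.emod_add_mul_ediv a K
      linarith
    refine ⟨(p, a + -(a / K) * K), ?_, b + -(a / K) * K, h2, ?_⟩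
    · simp only [Finset.mem_product, Finset.mem_singleton, Finset.mem_filter, Finset.mem_Ico,
        true_and]
      refine ⟨?_, h2.left⟩
      rw [h3]
      exact ⟨Int.emod_nonneg a h.K_pos.ne', Int.emod_lt_of_pos a h.K_pos⟩
    · have h4 := h.arc_add p a b (-(a / K))
      push_cast at h4 ⊢
      exact h4.symm
  · rintro ⟨⟨q, a⟩, hq, b, hab, rfl⟩
    simp only [Finset.mem_product, Finset.mem_singleton] at hq
    obtain ⟨rfl, -⟩ := hq
    exact ⟨a, b, hab, rfl⟩

theorem encard_boundaryEdges_inside (h : Diagram N K ev σ) :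
    (boundaryEdges (fun i => curve (K : ℝ) (wire ev σ i)) (inside K (level ev 0))).encard = 5 := by
  have h1 := h.encard_level_arcs 0
  rw [Finset.filter_congr (q := fun k => ev k = 1) fun k _ => by unfold Near; omega, h.bottom] at h1
  refine Eq.trans ?_ h1
  congr 1
  ext e
  constructor
  · rintro ⟨he, hs⟩
    obtain ⟨p, a, b, hp, hab, rfl⟩ := h.mem_edges.1 he
    rw [h.arc_subset_closure_inside hab.lt] at hs
    subst hs
    exact ⟨a, b, hab, rfl⟩
  · rintro ⟨a, b, hab, rfl⟩
    have := h.six_le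
    exact ⟨h.mem_edges.2 ⟨0, a, b, by omega, hab, rfl⟩,
      (h.arc_subset_closure_inside hab.lt).2 rfl⟩

theorem four_le_encard_boundaryEdges_outside (h : Diagram N K ev σ) :
    4 ≤ (boundaryEdges (fun i => curve (K : ℝ) (wire ev σ i))
      (outside K (level ev (N - 1)))).encard := by
  have hN := h.six_le
  have h1 := h.encard_level_arcs (N - 1)
  rw [Finset.filter_congr (q := fun k => ev k = N - 1) fun k _ => by
    have := h.ev_lt k
    unfold Near
    omega] at h1
  have h2 : (4 : ℕ∞) ≤ ((Finset.Ico 0 K).filter fun k => ev k = N - 1).card := by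
    exact_mod_cast h.top
  rw [← h1] at h2
  refine h2.trans (Set.encard_le_encard ?_)
  rintro e ⟨a, b, hab, rfl⟩
  exact ⟨h.mem_edges.2 ⟨N - 1, a, b, by omega, hab, rfl⟩,
    (h.arc_subset_closure_outside (by omega) hab.lt).2 rfl⟩

/-- Edges are counted by their starting times. On both levels one edge starts at `u`; each letter
`p` in between starts a further edge on the lower level and each letter `p + 2` one on the upper
level. -/
theorem encard_boundaryEdges_region (h : Diagram N K ev σ) {p : ℕ} {u v : ℤ} (hpN : p + 1 < N)
    (huv : Successive (fun k => ev k = p + 1) u v) :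
    (boundaryEdges (fun i => curve (K : ℝ) (wire ev σ i))
      (region K (level ev p) (level ev (p + 1)) u v)).encard =
      (((Finset.Ioo u v).filter
        fun k => ev k = p + 1 + 1 ∨ (ev k + 1 = p + 1 ∧ ev k ≠ 0)).card + 2 : ℕ) := by
  have huK := huv.le_add h.K_pos (h.ev_eq_periodic (p + 1))
  set T : Finset (ℕ × ℤ) := {p} ×ˢ (Finset.Ico u v).filter (fun k => Near ev p k) ∪
    {p + 1} ×ˢ (Finset.Ico u v).filter (fun k => Near ev (p + 1) k) with hTdef
  have hT : ∀ q : ℕ × ℤ, q ∈ T ↔ (q.1 = p ∨ q.1 = p + 1) ∧ (u ≤ q.2 ∧ q.2 < v) ∧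
      Near ev q.1 q.2 := by
    rintro ⟨q, a⟩
    simp only [hTdef, Finset.mem_union, Finset.mem_product, Finset.mem_singleton,
      Finset.mem_filter, Finset.mem_Ico]
    constructor
    · rintro (⟨rfl, h1, h2⟩ | ⟨rfl, h1, h2⟩)
      · exact ⟨Or.inl rfl, h1, h2⟩
      · exact ⟨Or.inr rfl, h1, h2⟩
    · rintro ⟨rfl | rfl, h1, h2⟩
      · exact Or.inl ⟨rfl, h1, h2⟩
      · exact Or.inr ⟨rfl, h1, h2⟩
  have h1 := h.encard_arcs T u (by
    intro q hq
    obtain ⟨-, h2, h3⟩ := (hT q).1 hq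
    exact ⟨h3, h2.1, by omega⟩)
  have hcard : T.card = ((Finset.Ioo u v).filter
        fun k => ev k = p + 1 + 1 ∨ (ev k + 1 = p + 1 ∧ ev k ≠ 0)).card + 2 := by
    rw [hTdef, Finset.card_union_of_disjoint, Finset.card_product, Finset.card_product,
      Finset.card_singleton, Finset.card_singleton, one_mul, one_mul]
    · have hl := huv.left
      have hlt := huv.lt
      have e1 : (Finset.Ico u v).filter (fun k => Near ev p k) =
          insert u ((Finset.Ioo u v).filter fun k => ev k + 1 = p + 1 ∧ ev k ≠ 0) := by
        ext k
        simp only [Finset.mem_insert, Finset.mem_filter, Finset.mem_Ico, Finset.mem_Ioo]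
        constructor
        · rintro ⟨⟨h2, h3⟩, h4⟩
          rcases h2.eq_or_lt with rfl | h2
          · exact Or.inl rfl
          · have := huv.between k h2 h3
            unfold Near at h4
            exact Or.inr ⟨⟨h2, h3⟩, by omega, by omega⟩
        · rintro (rfl | ⟨⟨h2, h3⟩, h4⟩)
          · exact ⟨⟨le_rfl, hlt⟩, by omega, by omega⟩
          · exact ⟨⟨h2.le, h3⟩, by omega, by omega⟩
      have e2 : (Finset.Ico u v).filter (fun k => Near ev (p + 1) k) =
          insert u ((Finset.Ioo u v).filter fun k => ev k = p + 1 + 1) := by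
        ext k
        simp only [Finset.mem_insert, Finset.mem_filter, Finset.mem_Ico, Finset.mem_Ioo]
        constructor
        · rintro ⟨⟨h2, h3⟩, h4⟩
          rcases h2.eq_or_lt with rfl | h2
          · exact Or.inl rfl
          · have := huv.between k h2 h3
            unfold Near at h4
            exact Or.inr ⟨⟨h2, h3⟩, by omega⟩
        · rintro (rfl | ⟨⟨h2, h3⟩, h4⟩)
          · exact ⟨⟨le_rfl, hlt⟩, by omega, by omega⟩
          · exact ⟨⟨h2.le, h3⟩, by omega, by omega⟩
      rw [e1, e2, Finset.card_insert_of_notMem (by simp), Finset.card_insert_of_notMem (by simp),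
        Finset.filter_or, Finset.card_union_of_disjoint]
      · omega
      · rw [Finset.disjoint_filter]
        intro k _ h2 h3
        omega
    · rw [Finset.disjoint_left]
      rintro ⟨q, a⟩ h2 h3
      simp only [Finset.mem_product, Finset.mem_singleton] at h2 h3
      omega
  rw [hcard] at h1
  rw [← h1]
  congr 1
  ext e
  constructor
  · rintro ⟨he, hs⟩
    obtain ⟨q, a, b, hq, hab, rfl⟩ := h.mem_edges.1 he
    obtain ⟨h2, m, h3, h4⟩ := (h.arc_subset_closure_region hab huv).1 hs
    have h5 := hab.add (h.near_periodic q) m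
    refine ⟨(q, a + m * K), (hT _).2 ⟨h2, ⟨h3, by have := h5.lt; simp only; omega⟩, h5.left⟩,
      b + m * K, h5, ?_⟩
    have h6 := h.arc_add q a b m
    push_cast at h6 ⊢
    exact h6.symm
  · rintro ⟨⟨q, a⟩, hq, b, hab, rfl⟩
    obtain ⟨h2, ⟨h3, h4⟩, -⟩ := (hT _).1 hq
    simp only at h2 h3 h4 hab
    refine ⟨h.mem_edges.2 ⟨q, a, b, by omega, hab, rfl⟩, (h.arc_subset_closure_region hab huv).2
      ⟨h2, 0, by omega, ?_⟩⟩
    by_contra h5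
    refine hab.between v h4 (by omega) ?_
    have := huv.right
    unfold Near
    omega

theorem isGonalCell_three_region (h : Diagram N K ev σ) {p : ℕ} {u v : ℤ} (hpN : p + 1 < N)
    (huv : Successive (fun k => ev k = p + 1) u v) :
    IsGonalCell (fun i => curve (K : ℝ) (wire ev σ i)) 3
      (region K (level ev p) (level ev (p + 1)) u v) ↔ p % 2 = 0 := by
  have h1 := h.cell (p + 1) u v (by omega) huv.lt huv.left huv.right huv.between
  unfold IsGonalCell
  rw [h.encard_boundaryEdges_region hpN huv, Nat.cast_inj]
  constructor
  · rintro ⟨-, h2⟩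
    have := h1.1 (by omega)
    omega
  · intro h2
    have := h1.2 (by omega)
    exact ⟨h.mem_cells.2 (Or.inr (Or.inr ⟨p, u, v, hpN, huv, rfl⟩)), by omega⟩

theorem isGonalCell_five_inside (h : Diagram N K ev σ) :
    IsGonalCell (fun i => curve (K : ℝ) (wire ev σ i)) 5 (inside K (level ev 0)) :=
  ⟨h.mem_cells.2 (Or.inl rfl), h.encard_boundaryEdges_inside⟩

/-- An edge on the level `q` borders the gaps `q` and `q + 1`, exactly one of which is odd; since
`N` is even, this one lies between two levels. The bottom cell has five edges and the top cell at
least four, so neither is a triangle. -/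
theorem isTriangleSaturated (h : Diagram N K ev σ) :
    IsTriangleSaturated fun i => curve (K : ℝ) (wire ev σ i) := by
  intro e he
  obtain ⟨q, a, b, hq, hab, rfl⟩ := h.mem_edges.1 he
  have hN := h.even
  -- the even one of the two levels `q - 1` and `q`
  obtain ⟨p, hp, hpq, hpN⟩ : ∃ p, p % 2 = 0 ∧ (q = p ∨ q = p + 1) ∧ p + 1 < N := by
    rcases Nat.mod_two_eq_zero_or_one q with h1 | h1
    · exact ⟨q, h1, Or.inl rfl, by omega⟩
    · exact ⟨q - 1, by omega, by omega, by omega⟩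
  obtain ⟨u, v, huv, h1, h2⟩ := exists_successive h.K_pos (h.ev_eq_periodic (p + 1))
    (h.exists_ev_eq hpN) (x := a + 1 / 2) (by
      intro k hk
      have : (2 * a + 1 : ℝ) = 2 * k := by linarith
      have : 2 * a + 1 = 2 * k := by exact_mod_cast this
      omega)
  have h3 : u ≤ a := le_of_lt_half h1
  have h4 : a < v := lt_of_half_lt h2
  refine ⟨_, ⟨(h.isGonalCell_three_region hpN huv).2 hp, he,
    (h.arc_subset_closure_region hab huv).2 ⟨hpq, 0, by omega, ?_⟩⟩, ?_⟩
  · by_contra h5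
    refine hab.between v h4 (by omega) ?_
    have := huv.right
    unfold Near
    omega
  · rintro F ⟨hF, -, hs⟩
    rcases h.mem_cells.1 hF.1 with rfl | rfl | ⟨p', u', v', hpN', huv', rfl⟩
    · have h5 := hF.2
      rw [h.encard_boundaryEdges_inside] at h5
      exact absurd h5 (by norm_num)
    · have h5 := h.four_le_encard_boundaryEdges_outside
      rw [hF.2] at h5
      exact absurd h5 (by norm_num)
    · rw [h.isGonalCell_three_region hpN' huv'] at hF
      obtain ⟨h5, m, h6, h7⟩ := (h.arc_subset_closure_region hab huv').1 hs
      obtain rfl : p' = p := by omega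
      have h8 := huv.add (h.ev_eq_periodic (p' + 1)) m
      have h9 := hab.lt
      obtain ⟨rfl, rfl⟩ := huv'.unique h8 (by omega) (by omega)
      push_cast
      exact region_add h.K_pos' (h.isProfile_level _) (h.isProfile_level _) m

end Wiring.Diagram

namespace Wiring.Diagram

open Pseudocircle

variable {N : ℕ} {K : ℤ} {ev : ℤ → ℕ} {σ : ℤ → Fin N → ℕ}

/-! ### The corona extension -/

theorem wire_eq_level_ev (h : Diagram N K ev σ) {i : Fin N} {k : ℤ}
    (hi : σ k i + 1 = ev k ∨ σ k i = ev k) : wire ev σ i k = level ev (ev k) k := by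
  rw [h.wire_eq_level i le_rfl (by linarith)]
  rcases hi with hi | hi
  · rw [level_eq_of_ev hi.symm, hi]
  · rw [hi]

theorem wire_eq_level_zero (h : Diagram N K ev σ) {i : Fin N} {k : ℤ} (hk : ev k = 1)
    (hi : σ k i ≤ 1) : wire ev σ i k = level ev 0 k := by
  rw [h.wire_eq_level_ev (by omega), level_eq_of_ev (p := 0) hk, hk]

/-- A wire that meets the additional curve takes part in the neighbouring crossing. -/
theorem σ_le_one_of_meets (h : Diagram N K ev σ) {i : Fin N} {k : ℤ} (hi : σ k i = 1) :
    (ev (k - 1) = 1 → σ (k - 1) i = 1 ∧ σ (k - 1 - 1) i = 0) ∧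
      (ev (k + 1) = 1 → σ (k + 1) i = 0) := by
  constructor
  · intro hk
    have h1 := h.ev_mod_of_eq_one hk
    have h2 := h.σ_eq_of_ev_eq_zero (h.ev_eq_zero (show k % 4 ≠ 2 by omega)) i
    have h3 := h.step (k - 1) i
    have h4 := swapLetter_cases (ev (k - 1)) (σ (k - 1 - 1) i)
    omega
  · intro hk
    have h3 := h.step (k + 1) i
    have h4 := swapLetter_cases (ev (k + 1)) (σ (k + 1 - 1) i)
    rw [add_sub_cancel_right] at h3 h4
    omega

theorem hat_meets_iff (h : Diagram N K ev σ) (i : Fin N) :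
    (curve (K : ℝ) (hat ev) ∩ curve K (wire ev σ i)).Nonempty ↔
      ∃ e ∈ boundaryEdges (fun i => curve (K : ℝ) (wire ev σ i)) (inside K (level ev 0)),
        e ⊆ curve K (wire ev σ i) := by
  have hK := h.K_pos'
  constructor
  · rintro ⟨_, ⟨x, rfl⟩, hx⟩
    rw [polar_mem_curve hK (h.isProfile_wire i)] at hx
    obtain ⟨k, rfl, h1, h2⟩ := h.hat_eq_wire_iff.1 hx
    -- The neighbouring crossing connects the wire with the bottom position, where it contains an
    -- edge of the pentagon.
    obtain ⟨t, ht⟩ : ∃ t, σ t i = 0 := by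
      have h3 := h.σ_le_one_of_meets h1
      rcases h2 with h2 | h2
      · exact ⟨_, (h3.1 h2).2⟩
      · exact ⟨_, h3.2 h2⟩
    obtain ⟨a, b, hab, h3, h4⟩ := h.radialFamily.exists_consecutive i (x := t + 1 / 2) (by
      intro k _ hk
      have : (2 * t + 1 : ℝ) = 2 * k := by linarith
      have : 2 * t + 1 = 2 * k := by exact_mod_cast this
      omega)
    have h5 := h.σ_eq_of_forall_not_near i fun k h1 h2 =>
      mt h.eventAt_wire.2 (hab.between k h1 h2)
    have h6 := h5 t (le_of_lt_half h3) (lt_of_half_lt h4)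
    refine ⟨arc K (wire ev σ i) a b, ⟨h.radialFamily.mem_edges.2 ⟨i, a, b, hab, rfl⟩, ?_⟩, ?_⟩
    · rw [h.arc_wire_eq i h5, ← h6, ht]
      exact (h.arc_subset_closure_inside hab.lt).2 rfl
    · rintro _ ⟨y, -, rfl⟩
      exact ⟨y, rfl⟩
  · rintro ⟨e, ⟨he, hs⟩, hi⟩
    obtain ⟨p, a, b, hp, hab, rfl⟩ := h.mem_edges.1 he
    obtain rfl := (h.arc_subset_closure_inside hab.lt).1 hs
    have h1 := hi (half_mem_arc ev 0 hab.lt)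
    rw [polar_mem_curve hK (h.isProfile_wire i), h.wire_eq_level i (k := a) (by linarith)
      (by linarith)] at h1
    have h2 := h.eq_of_level_half_eq h1
    have h3 := hab.left
    unfold Near at h3
    have h4 := h.step a i
    have h5 := swapLetter_cases (ev a) (σ (a - 1) i)
    -- The edge of the pentagon starts with a letter `1` at the time `a`, by which the wire comes
    -- down from the position `1`; it met the additional curve one unit earlier.
    refine ⟨polar K (a - 1 : ℤ) (hat ev (a - 1 : ℤ)), ⟨_, rfl⟩, ?_⟩
    rw [polar_mem_curve hK (h.isProfile_wire i), h.hat_eq_wire_iff]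
    refine ⟨a - 1, rfl, by omega, Or.inr ?_⟩
    rw [sub_add_cancel]
    omega

theorem hat_meets_at (h : Diagram N K ev σ) (i : Fin N) {z : ℂ}
    (hz : z ∈ curve (K : ℝ) (hat ev) ∩ curve K (wire ev σ i)) :
    ∃ e ∈ edges (fun i => curve (K : ℝ) (wire ev σ i)), z ∈ e ∧
      ∃ v ∈ vertices (fun i => curve (K : ℝ) (wire ev σ i)),
        v ∈ closure (inside (K : ℝ) (level ev 0)) ∧ v ∈ closure e := by
  have hK := h.K_pos'
  obtain ⟨⟨x, rfl⟩, hx⟩ := hz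
  rw [polar_mem_curve hK (h.isProfile_wire i)] at hx
  obtain ⟨k, rfl, h1, h2⟩ := h.hat_eq_wire_iff.1 hx
  have h0 : ev k = 0 := by
    refine h.ev_eq_zero ?_
    rcases h2 with h2 | h2
    · have := h.ev_mod_of_eq_one h2; omega
    · have := h.ev_mod_of_eq_one h2; omega
  obtain ⟨a, b, hab, h3, h4⟩ := h.radialFamily.exists_consecutive i (x := k) (by
    intro l hl e
    have : k = l := by exact_mod_cast e
    subst this
    exact (h.eventAt_wire.1 hl).1 h0)
  have h3' : a < k := by exact_mod_cast h3
  have h4' : k < b := by exact_mod_cast h4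
  have h5 := h.σ_le_one_of_meets h1
  have hv : ∀ l, EventAt (wire ev σ) i l → (l = a ∨ l = b) → ev l = 1 → σ l i ≤ 1 →
      ∃ v ∈ vertices (fun i => curve (K : ℝ) (wire ev σ i)),
        v ∈ closure (inside (K : ℝ) (level ev 0)) ∧ v ∈ closure (arc K (wire ev σ i) a b) := by
    intro l hl hlab h6 h7
    have h8 : polar K l (wire ev σ i l) ∈ vertices (fun i => curve (K : ℝ) (wire ev σ i)) :=
      h.radialFamily.polar_mem_vertices.2 ⟨l, hl, rfl⟩
    refine ⟨_, h8, ?_, (h.radialFamily.vertex_mem_closure_arc hab h8).2 ?_⟩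
    · rw [polar_mem_closure_inside hK (h.isProfile_level 0), h.wire_eq_level_zero h6 h7]
    · rcases hlab with rfl | rfl
      · exact Or.inl rfl
      · exact Or.inr rfl
  refine ⟨arc K (wire ev σ i) a b, h.radialFamily.mem_edges.2 ⟨i, a, b, hab, rfl⟩,
    ⟨k, ⟨h3, h4⟩, congrArg (polar K k) hx.symm⟩, ?_⟩
  rcases h2 with h2 | h2
  · have h6 : EventAt (wire ev σ) i (k - 1) :=
      h.eventAt_wire.2 ⟨by omega, by have := h5.1 h2; omega⟩
    refine hv (k - 1) h6 (Or.inl ?_) h2 (by have := h5.1 h2; omega)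
    by_contra hne
    exact hab.between (k - 1) (by omega) (by omega) h6
  · have h6 : EventAt (wire ev σ) i (k + 1) :=
      h.eventAt_wire.2 ⟨by omega, by have := h5.2 h2; omega⟩
    refine hv (k + 1) h6 (Or.inr ?_) h2 (by have := h5.2 h2; omega)
    by_contra hne
    exact hab.between (k + 1) (by omega) (by omega) h6

theorem isCoronaExtension (h : Diagram N K ev σ) :
    IsCoronaExtension (fun i => curve (K : ℝ) (wire ev σ i)) (inside K (level ev 0))
      (curve K (hat ev)) where
  pentagon := h.isGonalCell_five_inside
  arrangement := h.isArrangement_addCurve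
  disjoint_cell := by
    rw [Set.disjoint_left]
    rintro _ ⟨x, rfl⟩ hx
    rw [polar_mem_closure_inside h.K_pos' (h.isProfile_level 0)] at hx
    exact absurd hx (not_le.2 (level_zero_lt_hat ev x))
  encloses z hz v hv hvP := by
    refine separates_of_mem h.K_pos' h.isProfile_hat ?_ ?_
    · rcases hz with rfl | ⟨x, r, hr, rfl⟩
      · exact Or.inl rfl
      · exact Or.inr ⟨x, r, hr.trans (level_zero_lt_hat ev x), rfl⟩
    · obtain ⟨i, k, hk, rfl⟩ := h.radialFamily.mem_vertices.1 hv
      have h2 := h.eventAt_wire.1 hk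
      rw [polar_mem_outside h.K_pos' h.isProfile_hat, h.wire_eq_level_ev h2.2]
      -- Crossings with the letter `1` are on the boundary of the bottom cell; all others are at or
      -- above the level `2`.
      refine hat_lt_level ev ?_ k
      by_contra hlt
      refine hvP ((polar_mem_closure_inside h.K_pos' (h.isProfile_level 0)).2 ?_)
      rw [h.wire_eq_level_zero (by omega) (by omega)]
  meets_iff := h.hat_meets_iff
  meets_at i _ hp := h.hat_meets_at i hp

end Wiring.Diagram

namespace Pseudocircle.RadialFamily

variable {ι : Type*} {K : ℤ} {f : ι → ℝ → ℝ}

/-! ### Colorings of the arrangement graph -/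

theorem eq_add_of_polar_eq (hf : RadialFamily K f) {i j : ι} {k l : ℤ}
    (e : polar K k (f i k) = polar K l (f j l)) : ∃ m : ℤ, k = l + m * K := by
  obtain ⟨-, m, hm⟩ := (polar_eq_iff hf.K_pos').1 e
  exact ⟨m, by exact_mod_cast hm⟩

theorem exists_eventAt_of_mem_vertices (hf : RadialFamily K f)
    (v : vertices fun i => curve (K : ℝ) (f i)) :
    ∃ k : ℤ, ∃ i, EventAt f i k ∧ (v : ℂ) = polar K k (f i k) := by
  obtain ⟨i, k, h1, h2⟩ := hf.mem_vertices.1 v.2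
  exact ⟨k, i, h1, h2⟩

/-- A coloring of the times that separates consecutive events yields a coloring of the arrangement
graph. -/
theorem nonempty_coloring (hf : RadialFamily K f) {α : Type*} (c : ℤ → α)
    (hper : ∀ k, c (k + K) = c k) (hc : ∀ i a b, Consecutive f i a b → b < a + K → c a ≠ c b) :
    Nonempty ((arrangementGraph fun i => curve (K : ℝ) (f i)).Coloring α) := by
  choose t ht using hf.exists_eventAt_of_mem_vertices
  have key : ∀ (v : vertices fun i => curve (K : ℝ) (f i)) i (a : ℤ),
      (v : ℂ) = polar K a (f i a) → c (t v) = c a := by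
    intro v i a e
    obtain ⟨j, -, hj⟩ := ht v
    obtain ⟨m, hm⟩ := hf.eq_add_of_polar_eq (hj.symm.trans e)
    rw [hm]
    exact Function.Periodic.int_mul (f := c) (c := K) hper m a
  refine ⟨SimpleGraph.Coloring.mk (fun v => c (t v)) ?_⟩
  intro u v huv
  obtain ⟨hne, i, a, b, hab, h1⟩ := (hf.adj_iff u v).1 huv
  -- An edge that runs through a whole period is a loop and imposes no condition on colorings.
  have h2 : b < a + K := by
    refine lt_of_le_of_ne (Consecutive.le_add hf hab) ?_
    rintro rfl
    refine hne (Subtype.ext ?_)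
    have h3 : polar K a (f i a) = polar K (a + K : ℤ) (f i (a + K : ℤ)) := by
      have h4 := (hf.profile i).add_int_mul a 1
      rw [polar_eq_iff hf.K_pos']
      push_cast at h4 ⊢
      rw [one_mul] at h4
      exact ⟨h4.symm, -1, by push_cast; ring⟩
    rcases h1 with ⟨h1, h1'⟩ | ⟨h1, h1'⟩
    · rw [h1, h1', h3]
    · rw [h1, h1', h3]
  rcases h1 with ⟨h1, h1'⟩ | ⟨h1, h1'⟩
  · rw [key u i a h1, key v i b h1']
    exact hc i a b hab h2
  · rw [key u i b h1, key v i a h1']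
    exact (hc i a b hab h2).symm

/-- A coloring of the arrangement graph yields a coloring of the times. -/
theorem exists_coloring (hf : RadialFamily K f)
    (hsim : ∀ i j k, EventAt f i k → EventAt f j k → f i k = f j k) {α : Type*} [Inhabited α]
    (C : (arrangementGraph fun i => curve (K : ℝ) (f i)).Coloring α) :
    ∃ c : ℤ → α, (∀ k, c (k + K) = c k) ∧
      ∀ i a b, Consecutive f i a b → b < a + K → c a ≠ c b := by
  classical
  -- `Q k v` means that `v` is the vertex at the time `k`; by `hsim` there is at most one. Times
  -- without a vertex receive an arbitrary color.
  set Q : ℤ → (vertices fun i => curve (K : ℝ) (f i)) → Prop :=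
    fun k v => ∃ i, EventAt f i k ∧ (v : ℂ) = polar K k (f i k) with hQ
  have hper : ∀ k, Q (k + K) = Q k := by
    intro k
    funext v
    refine propext (exists_congr fun i => ?_)
    have h1 := hf.eventAt_add i k 1
    have h2 := (hf.profile i).add_int_mul k 1
    have h3 : polar K (k + K : ℤ) (f i (k + K : ℤ)) = polar K k (f i k) := by
      rw [polar_eq_iff hf.K_pos']
      push_cast at h2 ⊢
      rw [one_mul] at h2
      exact ⟨h2, 1, by push_cast; ring⟩
    rw [one_mul] at h1
    rw [h1, h3]
  have huniq : ∀ k v v', Q k v → Q k v' → v = v' := by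
    rintro k v v' ⟨i, hi, h1⟩ ⟨j, hj, h2⟩
    refine Subtype.ext ?_
    rw [h1, h2, hsim i j k hi hj]
  have hex : ∀ i k, EventAt f i k → ∃ v, Q k v ∧ (v : ℂ) = polar K k (f i k) := by
    intro i k hk
    exact ⟨⟨_, hf.polar_mem_vertices.2 ⟨k, hk, rfl⟩⟩, ⟨i, hk, rfl⟩, rfl⟩
  set c : ℤ → α := fun k => if h : ∃ v, Q k v then C h.choose else default with hc
  have hcv : ∀ k v, Q k v → c k = C v := by
    intro k v hv
    have h : ∃ v, Q k v := ⟨v, hv⟩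
    rw [hc]
    simp only [dif_pos h]
    rw [huniq k _ _ h.choose_spec hv]
  refine ⟨c, fun k => by simp only [hc, hper], fun i a b hab hlt => ?_⟩
  obtain ⟨u, hu, hu'⟩ := hex i a hab.left
  obtain ⟨v, hv, hv'⟩ := hex i b hab.right
  rw [hcv a u hu, hcv b v hv]
  refine C.valid ((hf.adj_iff u v).2 ⟨?_, i, a, b, hab, Or.inl ⟨hu', hv'⟩⟩)
  intro e
  rw [e, hv'] at hu'
  obtain ⟨m, hm⟩ := hf.eq_add_of_polar_eq hu'
  have h1 := hab.lt
  have hK := hf.K_pos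
  have h2 : m * K < 1 * K := by omega
  have h3 : 0 * K < m * K := by omega
  have := lt_of_mul_lt_mul_right h2 hK.le
  have := lt_of_mul_lt_mul_right h3 hK.le
  omega

end Pseudocircle.RadialFamily

namespace Wiring

/-! ### Telescoping along successive times -/

section Telescoping

variable {P : ℤ → Prop} {K : ℤ}

theorem Successive.chain (hK : 0 < K) (hper : ∀ k, P (k + K) ↔ P k) {R : ℤ → ℤ → Prop}
    (hrefl : ∀ u, R u u) (hstep : ∀ u v w, Successive P u v → v ≤ w → R v w → R u w) {u v : ℤ}
    (hu : P u) (hv : P v) (huv : u ≤ v) : R u v := by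
  obtain ⟨n, hn⟩ := Int.eq_ofNat_of_zero_le (sub_nonneg.2 huv)
  induction n using Nat.strong_induction_on generalizing u with
  | _ n ih =>
    rcases huv.eq_or_lt with rfl | huv
    · exact hrefl _
    obtain ⟨w, hw⟩ := exists_successive_of_left hK hper hu
    have h1 : w ≤ v := by
      by_contra hlt
      exact hw.between v huv (by omega) hv
    have h2 := hw.lt
    exact hstep u w v hw h1 (ih (v - w).toNat (by omega) hw.right h1 (by omega))

theorem sum_Ioc_add_sum_Ioc {M : Type*} [AddCommMonoid M] (F : ℤ → M) {u v w : ℤ} (huv : u ≤ v)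
    (hvw : v ≤ w) :
    ∑ k ∈ Finset.Ioc u v, F k + ∑ k ∈ Finset.Ioc v w, F k = ∑ k ∈ Finset.Ioc u w, F k := by
  rw [← Finset.Ioc_union_Ioc_eq_Ioc huv hvw, Finset.sum_union]
  exact Finset.Ioc_disjoint_Ioc_of_le le_rfl

theorem sum_Ioc_period {M : Type*} [AddCommMonoid M] {F : ℤ → M} (hK : 0 < K)
    (hF : ∀ k, F (k + K) = F k) (u : ℤ) :
    ∑ k ∈ Finset.Ioc u (u + K), F k = ∑ k ∈ Finset.Ico 0 K, F k := by
  have hmod : ∀ k, F (k % K) = F k := by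
    intro k
    have h1 := Int.emod_add_mul_ediv k K
    have h2 := Function.Periodic.int_mul (f := F) (c := K) hF (k / K) (k % K)
    rw [mul_comm] at h1
    rw [Int.cast_id, h1] at h2
    exact h2.symm
  have h1 : Finset.Ioc u (u + K) = Finset.Ico (u + 1) (u + 1 + K) := by
    ext k
    simp only [Finset.mem_Ioc, Finset.mem_Ico]
    omega
  rw [h1, ← Int.image_Ico_emod (u + 1) K hK.le, Finset.sum_image]
  · exact Finset.sum_congr rfl fun k _ => (hmod k).symm
  · intro a ha b hb hab
    simp only [Finset.coe_Ico, mem_Ico] at ha hb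
    have h2 := Int.emod_add_mul_ediv a K
    have h3 := Int.emod_add_mul_ediv b K
    simp only at hab
    have h4 : a - b = (a / K - b / K) * K := by
      rw [sub_mul]
      linarith [mul_comm K (a / K), mul_comm K (b / K)]
    have h5 : (a / K - b / K) * K < 1 * K := by omega
    have h6 : (-1) * K < (a / K - b / K) * K := by omega
    have h7 := lt_of_mul_lt_mul_right h5 hK.le
    have h8 := lt_of_mul_lt_mul_right h6 hK.le
    have h9 : a / K - b / K = 0 := by omega
    rw [h9] at h4
    omega

/-- The increments of the periodic function `x` along one full turn add up to zero. -/
theorem sum_eq_zero_of_successive {M : Type*} [AddCommGroup M] {x F : ℤ → M} (hK : 0 < K)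
    (hper : ∀ k, P (k + K) ↔ P k) (hne : ∃ k, P k) (hx : ∀ k, x (k + K) = x k)
    (hF : ∀ k, F (k + K) = F k)
    (hstep : ∀ u v, Successive P u v → x v = x u + ∑ k ∈ Finset.Ioc u v, F k) :
    ∑ k ∈ Finset.Ico 0 K, F k = 0 := by
  obtain ⟨u, hu⟩ := hne
  have h1 := Successive.chain hK hper (R := fun u v => x v = x u + ∑ k ∈ Finset.Ioc u v, F k)
    (fun u => by simp) (fun u v w huv hvw e => by
      rw [← sum_Ioc_add_sum_Ioc F huv.lt.le hvw, ← add_assoc, ← hstep u v huv, e])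
    hu ((hper u).2 hu) (by omega)
  rw [sum_Ioc_period hK hF, hx] at h1
  simpa using h1

theorem sum_nonpos_of_successive {x F : ℤ → ℤ} (hK : 0 < K)
    (hper : ∀ k, P (k + K) ↔ P k) (hne : ∃ k, P k) (hx : ∀ k, x (k + K) = x k)
    (hF : ∀ k, F (k + K) = F k)
    (hstep : ∀ u v, Successive P u v → x u + ∑ k ∈ Finset.Ioc u v, F k ≤ x v) :
    ∑ k ∈ Finset.Ico 0 K, F k ≤ 0 := by
  obtain ⟨u, hu⟩ := hne
  have h1 := Successive.chain hK hper (R := fun u v => x u + ∑ k ∈ Finset.Ioc u v, F k ≤ x v)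
    (fun u => by simp) (fun u v w huv hvw e => by
      have := hstep u v huv
      rw [← sum_Ioc_add_sum_Ioc F huv.lt.le hvw]
      linarith)
    hu ((hper u).2 hu) (by omega)
  rw [sum_Ioc_period hK hF, hx] at h1
  linarith

end Telescoping

namespace Diagram

open Pseudocircle

variable {N : ℕ} {K : ℤ} {ev : ℤ → ℕ} {σ : ℤ → Fin N → ℕ}

/-! ### Consecutive vertices of the extended arrangement -/

/-- Every wire has at least two vertices in a period, since it crosses another wire twice; hence no
edge on it is a loop. -/
theorem Consecutive.lt_add (h : Diagram N K ev σ) {i : Fin N} {a b : ℤ}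
    (hab : Consecutive (extendedWire ev σ) (some i) a b) : b < a + K := by
  have hf := h.extendedFamily
  have hK := h.K_pos
  refine lt_of_le_of_ne (RadialFamily.Consecutive.le_add hf hab) ?_
  rintro rfl
  have hall : ∀ k, EventAt (extendedWire ev σ) (some i) k → (k - a) % K = 0 := by
    intro k hk
    by_contra hne
    have h1 := Int.emod_nonneg (k - a) hK.ne'
    have h2 := Int.emod_lt_of_pos (k - a) hK
    refine hab.between (a + (k - a) % K) (by omega) (by omega) ?_
    rw [← hf.eventAt_add (some i) _ ((k - a) / K)]
    have h3 : a + (k - a) % K + (k - a) / K * K = k := by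
      have := Int.emod_add_mul_ediv (k - a) K
      rw [mul_comm K] at this
      linarith
    rwa [h3]
  obtain ⟨j, hj⟩ := h.exists_ne i
  obtain ⟨k, l, hk, hl, hkl⟩ := Finset.one_lt_card_iff.1
    (show 1 < ((Finset.Ico 0 K).filter fun k => Exchanges (ev k) (σ k j) (σ k i)).card by
      rw [h.cross_two j i hj]; norm_num)
  simp only [Finset.mem_filter, Finset.mem_Ico] at hk hl
  have hev : ∀ k, Exchanges (ev k) (σ k j) (σ k i) → (k - a) % K = 0 := fun k hk =>
    hall k (h.eventAt_some.2 (Or.inl (by unfold Exchanges at hk; omega)))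
  have h1 := hev k hk.2
  have h2 := hev l hl.2
  have h3 : k % K = l % K := by
    have : (k - l) % K = 0 := by
      rw [show k - l = (k - a) - (l - a) by ring, Int.sub_emod, h1, h2]
      simp
    exact Int.emod_eq_emod_iff_emod_sub_eq_zero.2 this
  rw [Int.emod_eq_of_lt hk.1.1 hk.1.2, Int.emod_eq_of_lt hl.1.1 hl.1.2] at h3
  exact hkl h3

theorem K_ge (h : Diagram N K ev σ) : 4 ≤ K := by
  have := h.K_pos
  have := h.K_mod
  omega

/-- The additional curve meets only the level `1`, so edges on all other levels survive in the
extension. -/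
theorem exists_consecutive_of_near (h : Diagram N K ev σ) {p : ℕ} (hp : p < N) (hp1 : p ≠ 1)
    {a b : ℤ} (hab : Successive (Near ev p) a b) :
    ∃ i, Consecutive (extendedWire ev σ) (some i) a b := by
  obtain ⟨i, hi⟩ := h.exists_position a hp
  have hσ := h.σ_eq_of_not_near hi hab.between
  refine ⟨i, hab.lt, h.eventAt_some.2 (Or.inl ?_), h.eventAt_some.2 (Or.inl ?_), ?_⟩
  · rw [near_iff, hi]
    exact hab.left
  · rw [h.near_iff_pred, hσ (b - 1) (by have := hab.lt; omega) (by omega)]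
    exact hab.right
  · intro k h1 h2 hk
    have h3 := hσ k h1.le h2
    rcases h.eventAt_some.1 hk with h4 | h4
    · rw [near_iff, h3] at h4
      exact hab.between k h1 h2 h4
    · omega

/-- This and the following five lemmas provide the sides of the triangles created by the corona: `v
- 1`, `v`, `v + 1` at each vertex of the pentagon, and `u + 1`, `q`, `v - 1` in the truncated
triangle between successive letters `1`, with `q` the letter `2` in between. -/
theorem exists_consecutive_left (h : Diagram N K ev σ) {v : ℤ} (hv : ev v = 1) :
    ∃ i, Consecutive (extendedWire ev σ) (some i) (v - 1) v := by
  obtain ⟨i, hi⟩ := h.exists_position (v - 1) (show 1 < N by have := h.six_le; omega)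
  have h1 := h.step v i
  have h2 := swapLetter_cases (ev v) (σ (v - 1) i)
  refine ⟨i, by omega, h.eventAt_some.2 (Or.inr ⟨hi, Or.inr ?_⟩), h.eventAt_some.2 (Or.inl ?_),
    fun k _ _ => by omega⟩
  · rwa [sub_add_cancel]
  · omega

theorem exists_consecutive_right (h : Diagram N K ev σ) {v : ℤ} (hv : ev v = 1) :
    ∃ i, Consecutive (extendedWire ev σ) (some i) v (v + 1) := by
  obtain ⟨i, hi⟩ := h.exists_position (v + 1) (show 1 < N by have := h.six_le; omega)
  have h0 := h.ev_mod_of_eq_one hv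
  have h1 := h.σ_eq_of_ev_eq_zero (h.ev_eq_zero (show (v + 1) % 4 ≠ 2 by omega)) i
  rw [add_sub_cancel_right] at h1
  refine ⟨i, by omega, h.eventAt_some.2 (Or.inl ?_), h.eventAt_some.2 (Or.inr ⟨hi, Or.inl ?_⟩),
    fun k _ _ => by omega⟩
  · omega
  · rwa [add_sub_cancel_right]

theorem consecutive_around (h : Diagram N K ev σ) {v : ℤ} (hv : ev v = 1) :
    Consecutive (extendedWire ev σ) none (v - 1) (v + 1) := by
  have h0 := h.ev_mod_of_eq_one hv
  refine ⟨by omega, h.eventAt_none.2 (Or.inr ?_), h.eventAt_none.2 (Or.inl ?_), fun k h1 h2 hk => ?_⟩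
  · rwa [sub_add_cancel]
  · rwa [add_sub_cancel_right]
  · obtain rfl : k = v := by omega
    rcases h.eventAt_none.1 hk with h3 | h3
    · have := h.ev_mod_of_eq_one h3; omega
    · have := h.ev_mod_of_eq_one h3; omega

theorem consecutive_between (h : Diagram N K ev σ) {u v : ℤ}
    (huv : Successive (fun k => ev k = 1) u v) :
    Consecutive (extendedWire ev σ) none (u + 1) (v - 1) := by
  have h0 := h.ev_mod_of_eq_one huv.left
  have h1 := h.ev_mod_of_eq_one huv.right
  have h2 := huv.lt
  refine ⟨by omega, h.eventAt_none.2 (Or.inl ?_), h.eventAt_none.2 (Or.inr ?_), fun k h1 h2 hk => ?_⟩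
  · rw [add_sub_cancel_right]
    exact huv.left
  · rw [sub_add_cancel]
    exact huv.right
  · rcases h.eventAt_none.1 hk with h3 | h3
    · exact huv.between _ (by omega) (by omega) h3
    · exact huv.between _ (by omega) (by omega) h3

theorem exists_consecutive_right_two (h : Diagram N K ev σ) {u q : ℤ} (huq : u < q) (hu : ev u = 1)
    (hq : ev q = 2) (hbetween : ∀ k, u < k → k < q → ev k ≠ 1 ∧ ev k ≠ 2) :
    ∃ i, Consecutive (extendedWire ev σ) (some i) (u + 1) q := by
  obtain ⟨i, hi⟩ := h.exists_position (u + 1) (show 1 < N by have := h.six_le; omega)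
  have h0 := h.ev_mod_of_eq_one hu
  have h1 := h.ev_mod q (by omega)
  have hσ := h.σ_eq_of_not_near (b := q) hi fun k h1 h2 h3 => by
    have := hbetween k (by omega) h2
    unfold Near at h3
    omega
  refine ⟨i, by omega, h.eventAt_some.2 (Or.inr ⟨hi, Or.inl ?_⟩), h.eventAt_some.2 (Or.inl ?_),
    fun k h1 h2 hk => ?_⟩
  · rwa [add_sub_cancel_right]
  · have h3 := h.step q i
    have h4 := swapLetter_cases (ev q) (σ (q - 1) i)
    have := hσ (q - 1) (by omega) (by omega)
    omega
  · have h3 := hσ k h1.le h2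
    have h4 := hbetween k (by omega) h2
    rcases h.eventAt_some.1 hk with h5 | ⟨h5, h6 | h6⟩
    · omega
    · exact (hbetween (k - 1) (by omega) (by omega)).1 h6
    · rcases eq_or_ne (k + 1) q with h7 | h7
      · rw [h7] at h6
        omega
      · exact (hbetween (k + 1) (by omega) (by omega)).1 h6

theorem exists_consecutive_left_two (h : Diagram N K ev σ) {q v : ℤ} (hqv : q < v) (hv : ev v = 1)
    (hq : ev q = 2) (hbetween : ∀ k, q < k → k < v → ev k ≠ 1 ∧ ev k ≠ 2) :
    ∃ i, Consecutive (extendedWire ev σ) (some i) q (v - 1) := by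
  obtain ⟨i, hi⟩ := h.exists_position q (show 1 < N by have := h.six_le; omega)
  have h0 := h.ev_mod_of_eq_one hv
  have h1 := h.ev_mod q (by omega)
  have hσ := h.σ_eq_of_not_near (b := v) hi fun k h1 h2 h3 => by
    have := hbetween k h1 h2
    unfold Near at h3
    omega
  refine ⟨i, by omega, h.eventAt_some.2 (Or.inl ?_),
    h.eventAt_some.2 (Or.inr ⟨hσ _ (by omega) (by omega), Or.inr ?_⟩), fun k h1 h2 hk => ?_⟩
  · omega
  · rwa [sub_add_cancel]
  · have h3 := hσ k h1.le (by omega)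
    have h4 := hbetween k h1 (by omega)
    rcases h.eventAt_some.1 hk with h5 | ⟨h5, h6 | h6⟩
    · omega
    · rcases eq_or_ne (k - 1) q with h7 | h7
      · rw [h7] at h6
        omega
      · exact (hbetween (k - 1) (by omega) (by omega)).1 h6
    · exact (hbetween (k + 1) (by omega) (by omega)).1 h6

/-- Between successive odd letters there is exactly one neighbouring letter. -/
theorem exists_unique_between (h : Diagram N K ev σ) {r : ℕ} (hr : r % 2 = 0) {u v : ℤ}
    (huv : Successive (fun k => ev k = r + 1) u v) :
    ∃ e, ((Finset.Ioo u v).filter fun k => ev k = r + 1 + 1 ∨ (ev k + 1 = r + 1 ∧ ev k ≠ 0)) = {e} :=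
  Finset.card_eq_one.1
    ((h.cell (r + 1) u v (by omega) huv.lt huv.left huv.right huv.between).2 (by omega))

end Diagram

end Wiring

namespace Wiring.Diagram

open Pseudocircle

variable {N : ℕ} {K : ℤ} {ev : ℤ → ℕ} {σ : ℤ → Fin N → ℕ}

/-! ### Three colors do not suffice -/

section NotThree

variable {c : ℤ → Fin 3}

/-- The indicator of the color `χ` modulo two. -/
abbrev indicator (c : ℤ → Fin 3) (χ : Fin 3) (k : ℤ) : ZMod 2 := if c k = χ then 1 else 0

/-- Three distinct colors exhaust `Fin 3`, so exactly one of them is `χ`. -/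
theorem indicator_add {a b d : Fin 3} (hab : a ≠ b) (had : a ≠ d) (hbd : b ≠ d) (χ : Fin 3) :
    ((if a = χ then 1 else 0) + (if b = χ then 1 else 0) + (if d = χ then 1 else 0) : ZMod 2) = 1 := by
  revert a b d χ
  decide

/-- A coloring of the times by three colors that separates consecutive vertices. -/
structure IsThreeColoring (K : ℤ) (ev : ℤ → ℕ) (σ : ℤ → Fin N → ℕ) (c : ℤ → Fin 3) : Prop where
  periodic : ∀ k, c (k + K) = c k
  ne : ∀ o a b, Consecutive (extendedWire ev σ) o a b → b < a + K → c a ≠ c b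

theorem ne_of_near (h : Diagram N K ev σ) (hc : IsThreeColoring K ev σ c) {p : ℕ} (hp : p < N)
    (hp1 : p ≠ 1) {a b : ℤ} (hab : Successive (Near ev p) a b) : c a ≠ c b := by
  obtain ⟨i, hi⟩ := h.exists_consecutive_of_near hp hp1 hab
  exact hc.ne _ _ _ hi (Consecutive.lt_add h hi)

theorem triangle_at_odd_letter (h : Diagram N K ev σ) (hc : IsThreeColoring K ev σ c) {r : ℕ}
    (hr : r % 2 = 0) (hr2 : 2 ≤ r) (hrN : r + 1 < N) {u v e : ℤ}
    (huv : Successive (fun k => ev k = r + 1) u v)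
    (he : (Finset.Ioo u v).filter (fun k => ev k = r + 1 + 1 ∨ (ev k + 1 = r + 1 ∧ ev k ≠ 0)) = {e}) :
    c u ≠ c v ∧ c u ≠ c e ∧ c v ≠ c e := by
  have hmem : ∀ k, (u < k ∧ k < v) ∧ (ev k = r + 1 + 1 ∨ (ev k + 1 = r + 1 ∧ ev k ≠ 0)) ↔ k = e := by
    intro k
    rw [← Finset.mem_singleton (a := e), ← he, Finset.mem_filter, Finset.mem_Ioo]
  obtain ⟨⟨h1, h2⟩, h3⟩ := (hmem e).2 rfl
  have hu := huv.left
  have hv := huv.right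
  -- The level `q` is the side of the cell that is subdivided at `e`; on the other level `q'` an
  -- edge joins `u` and `v` directly.
  have key : ∀ q q', (q = r ∨ q = r + 1) → (q' = r ∨ q' = r + 1) → q ≠ q' → Near ev q e →
      c u ≠ c v ∧ c u ≠ c e ∧ c v ≠ c e := by
    intro q q' hq hq' hne hqe
    refine ⟨h.ne_of_near hc (p := q') (by omega) (by omega) ⟨huv.lt, ?_, ?_, ?_⟩,
      h.ne_of_near hc (p := q) (by omega) (by omega) ⟨h1, ?_, hqe, ?_⟩,
      (h.ne_of_near hc (p := q) (by omega) (by omega) ⟨h2, hqe, ?_, ?_⟩).symm⟩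
    any_goals (unfold Near; omega)
    · intro k h4 h5 h6
      have h7 := huv.between k h4 h5
      have h8 : k = e := (hmem k).1 ⟨⟨h4, h5⟩, by unfold Near at h6; omega⟩
      subst h8
      unfold Near at h6 hqe
      omega
    · intro k h4 h5 h6
      have h7 := huv.between k h4 (by omega)
      have h8 : k = e := (hmem k).1 ⟨⟨h4, by omega⟩, by unfold Near at h6; omega⟩
      omega
    · intro k h4 h5 h6
      have h7 := huv.between k (by omega) h5
      have h8 : k = e := (hmem k).1 ⟨⟨by omega, h5⟩, by unfold Near at h6; omega⟩
      omega
  rcases h3 with h3 | h3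
  · exact key (r + 1) r (Or.inr rfl) (Or.inl rfl) (by omega) ⟨by omega, by omega⟩
  · exact key r (r + 1) (Or.inl rfl) (Or.inr rfl) (by omega) ⟨by omega, by omega⟩

theorem sum_Ioc_eq_of_filter {u v e : ℤ} {Q : ℤ → Prop} [DecidablePred Q] {F : ℤ → ZMod 2}
    (huv : u < v) (he : (Finset.Ioo u v).filter Q = {e}) (hF : ∀ k, u < k → k < v → ¬ Q k → F k = 0) :
    ∑ k ∈ Finset.Ioc u v, F k = F v + F e := by
  have h1 : Finset.Ioc u v = insert v (Finset.Ioo u v) := by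
    ext k
    simp only [Finset.mem_insert, Finset.mem_Ioc, Finset.mem_Ioo]
    omega
  rw [h1, Finset.sum_insert (by simp)]
  congr 1
  rw [← Finset.sum_filter_of_ne (p := Q), he, Finset.sum_singleton]
  intro k hk hne
  by_contra hQ
  rw [Finset.mem_Ioo] at hk
  exact hne (hF k hk.1 hk.2 hQ)

/-- The sum of `indicator + 1` over the crossings with the letter `q`. -/
noncomputable abbrev letterSum (K : ℤ) (ev : ℤ → ℕ) (c : ℤ → Fin 3) (χ : Fin 3) (q : ℕ) : ZMod 2 :=
  ∑ k ∈ Finset.Ico 0 K, if ev k = q then indicator c χ k + 1 else 0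

/-- Each triangle `u`, `v`, `e` of the gap `r + 1` gives `x v = x u + (x e + 1)` modulo two.
Telescoping around the gap leaves the sum over all third vertices `e`, which are the crossings with
the letters `r` and `r + 2`. -/
theorem letterSum_add (h : Diagram N K ev σ) (hc : IsThreeColoring K ev σ c) (χ : Fin 3) {r : ℕ}
    (hr : r % 2 = 0) (hr2 : 2 ≤ r) (hrN : r + 1 < N) :
    letterSum K ev c χ r + letterSum K ev c χ (r + 2) = 0 := by
  rw [letterSum, letterSum, ← Finset.sum_add_distrib]
  refine sum_eq_zero_of_successive (P := fun k => ev k = r + 1) (x := indicator c χ) h.K_pos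
    (h.ev_eq_periodic (r + 1)) (h.exists_ev_eq hrN) (fun k => by simp only [indicator, hc.periodic])
    (fun k => by simp only [indicator, hc.periodic, h.ev_per]) fun u v huv => ?_
  obtain ⟨e, he⟩ := h.exists_unique_between hr huv
  obtain ⟨h1, h2, h3⟩ := h.triangle_at_odd_letter hc hr hr2 hrN huv he
  have hv := huv.right
  have hmem : e ∈ (Finset.Ioo u v).filter
      (fun k => ev k = r + 1 + 1 ∨ (ev k + 1 = r + 1 ∧ ev k ≠ 0)) := by
    rw [he]
    exact Finset.mem_singleton_self e
  rw [Finset.mem_filter] at hmem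
  rw [sum_Ioc_eq_of_filter huv.lt he, if_neg (by omega), if_neg (by omega)]
  · have h4 := indicator_add h1 h2 h3 χ
    have h5 : ∀ a b d : ZMod 2, a + b + d = 1 → b = a + (0 + 0 + (d + 1)) := by decide
    rcases hmem.2 with h6 | h6
    · rw [if_neg (by omega), if_pos (by omega), zero_add (_ + 1)]
      exact h5 _ _ _ h4
    · rw [if_pos (by omega), if_neg (by omega), add_zero (_ + 1)]
      exact h5 _ _ _ h4
  · intro k _ _ hk
    rw [if_neg (by omega), if_neg (by omega), add_zero]

/-- The sum for the letter `N` is empty, and `letterSum_add` carries this down through the even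
letters. -/
theorem letterSum_two (h : Diagram N K ev σ) (hc : IsThreeColoring K ev σ c) (χ : Fin 3) :
    letterSum K ev c χ 2 = 0 := by
  have hN := h.six_le
  have heven := h.even
  have key : ∀ j, 2 * j + 2 ≤ N → letterSum K ev c χ (N - 2 * j) = 0 := by
    intro j
    induction j with
    | zero =>
      intro _
      refine Finset.sum_eq_zero fun k _ => if_neg ?_
      have := h.ev_lt k
      omega
    | succ j ih =>
      intro hj
      have h1 := h.letterSum_add hc χ (r := N - 2 * (j + 1)) (by omega) (by omega) (by omega)
      rw [show N - 2 * (j + 1) + 2 = N - 2 * j by omega, ih (by omega), add_zero] at h1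
      exact h1
  have h1 := key (N / 2 - 1) (by omega)
  rwa [show N - 2 * (N / 2 - 1) = 2 by omega] at h1

theorem exists_ev_eq_one' (h : Diagram N K ev σ) : ∃ k, ev k = 1 := by
  obtain ⟨k, -, -, hk⟩ := h.exists_ev_eq_one
  exact ⟨k, hk⟩

/-- The triangles `u + 1`, `e`, `v - 1` and `v - 1`, `v`, `v + 1` share the vertex `v - 1`. Adding
their relations modulo two eliminates it and expresses `x (v + 1)` by `x (u + 1)`, `x e` and `x v`;
telescoping along the vertices to the right of the letters `1` gives the claim. -/
theorem letterSum_one (h : Diagram N K ev σ) (hc : IsThreeColoring K ev σ c) (χ : Fin 3) :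
    letterSum K ev c χ 1 = 0 := by
  suffices h1 : letterSum K ev c χ 1 + letterSum K ev c χ 2 = 0 by
    rwa [h.letterSum_two hc, add_zero] at h1
  rw [letterSum, letterSum, ← Finset.sum_add_distrib]
  refine sum_eq_zero_of_successive (P := fun k => ev k = 1) (x := fun k => indicator c χ (k + 1))
    h.K_pos (h.ev_eq_periodic 1) h.exists_ev_eq_one'
    (fun k => by simp only [indicator, show k + K + 1 = k + 1 + K by ring, hc.periodic])
    (fun k => by simp only [indicator, hc.periodic, h.ev_per]) fun u v huv => ?_
  obtain ⟨e, he⟩ := h.exists_unique_between (r := 0) rfl huv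
  have hmem : ∀ k, (u < k ∧ k < v) ∧ (ev k = 0 + 1 + 1 ∨ (ev k + 1 = 0 + 1 ∧ ev k ≠ 0)) ↔
      k = e := by
    intro k
    rw [← Finset.mem_singleton (a := e), ← he, Finset.mem_filter, Finset.mem_Ioo]
  obtain ⟨⟨h1, h2⟩, h3⟩ := (hmem e).2 rfl
  have he2 : ev e = 2 := by omega
  have hu := huv.left
  have hv := huv.right
  have hnone : ∀ k, u < k → k < v → k ≠ e → ev k ≠ 1 ∧ ev k ≠ 2 := fun k h4 h5 h6 =>
    ⟨huv.between k h4 h5, fun h7 => h6 ((hmem k).1 ⟨⟨h4, h5⟩, by omega⟩)⟩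
  obtain ⟨i₁, c1⟩ := h.exists_consecutive_right_two h1 hu he2
    fun k h4 h5 => hnone k h4 (by omega) (by omega)
  obtain ⟨i₂, c2⟩ := h.exists_consecutive_left_two h2 hv he2
    fun k h4 h5 => hnone k (by omega) h5 (by omega)
  obtain ⟨i₃, c3⟩ := h.exists_consecutive_left hv
  obtain ⟨i₄, c4⟩ := h.exists_consecutive_right hv
  have hK := h.K_ge
  have huK := huv.le_add h.K_pos (h.ev_eq_periodic 1)
  have t1 := indicator_add (hc.ne _ _ _ c1 (Consecutive.lt_add h c1))
    (hc.ne _ _ _ (h.consecutive_between huv) (by omega))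
    (hc.ne _ _ _ c2 (Consecutive.lt_add h c2)) χ
  have t2 := indicator_add (hc.ne _ _ _ c3 (Consecutive.lt_add h c3))
    (hc.ne _ _ _ (h.consecutive_around hv) (by omega))
    (hc.ne _ _ _ c4 (Consecutive.lt_add h c4)) χ
  rw [sum_Ioc_eq_of_filter huv.lt he, if_pos hv, if_neg (by omega), if_neg (by omega), if_pos he2]
  · have h5 : ∀ a b d f g : ZMod 2, a + b + d = 1 → d + f + g = 1 → g = a + (f + 1 + 0 +
      (0 + (b + 1))) := by decide
    exact h5 _ _ _ _ _ t1 t2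
  · intro k h4 h5 hk
    have := huv.between k h4 h5
    rw [if_neg (by omega), if_neg (by omega), add_zero]

/-- The number of crossings of the color `χ` on the boundary of the bottom cell. -/
noncomputable abbrev bottomCount (K : ℤ) (ev : ℤ → ℕ) (c : ℤ → Fin 3) (χ : Fin 3) : ℕ :=
  (((Finset.Ico 0 K).filter fun k => ev k = 1).filter fun k => c k = χ).card

theorem bottomCount_odd (h : Diagram N K ev σ) (hc : IsThreeColoring K ev σ c) (χ : Fin 3) :
    bottomCount K ev c χ % 2 = 1 := by
  have h1 := h.letterSum_one hc χ
  rw [letterSum, ← Finset.sum_filter, Finset.sum_add_distrib, Finset.sum_boole, Finset.sum_const,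
    h.bottom] at h1
  have h2 : ((bottomCount K ev c χ + 5 : ℕ) : ZMod 2) = 0 := by
    push_cast
    simpa using h1
  rw [ZMod.natCast_eq_zero_iff] at h2
  omega

theorem bottomCount_le_two (h : Diagram N K ev σ) (hc : IsThreeColoring K ev σ c) (χ : Fin 3) :
    bottomCount K ev c χ ≤ 2 := by
  have h1 := sum_nonpos_of_successive (P := fun k => ev k = 1)
    (x := fun k => if c k = χ then 1 else 0)
    -- With this summand a single step says that successive vertices of the pentagon are not both of
    -- the color `χ`; the total is twice the count minus five.
    (F := fun k => if ev k = 1 then 2 * (if c k = χ then 1 else 0) - 1 else 0) h.K_pos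
    (h.ev_eq_periodic 1) h.exists_ev_eq_one' (fun k => by simp only [hc.periodic])
    (fun k => by simp only [hc.periodic, h.ev_per]) fun u v huv => by
      have hne : c u ≠ c v := by
        refine h.ne_of_near hc (p := 0) (by have := h.six_le; omega) (by omega) ⟨huv.lt, ?_, ?_, ?_⟩
        · have := huv.left
          exact ⟨by omega, by omega⟩
        · have := huv.right
          exact ⟨by omega, by omega⟩
        · intro k h1 h2 h3
          have := huv.between k h1 h2
          unfold Near at h3
          omega
      have hsum : ∑ k ∈ Finset.Ioc u v, (if ev k = 1 then 2 * (if c k = χ then 1 else 0) - 1 else 0 : ℤ)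
          = 2 * (if c v = χ then 1 else 0) - 1 := by
        rw [Finset.sum_eq_single v]
        · rw [if_pos huv.right]
        · intro k hk hkv
          rw [Finset.mem_Ioc] at hk
          exact if_neg (huv.between k hk.1 (by omega))
        · intro hv
          exact absurd (Finset.mem_Ioc.2 ⟨huv.lt, le_rfl⟩) hv
      rw [hsum]
      by_cases h1 : c u = χ <;> by_cases h2 : c v = χ
      · exact absurd (h1.trans h2.symm) hne
      all_goals simp [h1, h2]
  rw [← Finset.sum_filter, Finset.sum_sub_distrib, ← Finset.mul_sum, Finset.sum_boole,
    Finset.sum_const, h.bottom] at h1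
  simp only [nsmul_eq_mul, mul_one] at h1
  have h2 : 2 * (bottomCount K ev c χ : ℤ) - (5 : ℕ) ≤ 0 := h1
  omega

/-- Each color occurs an odd number of times and at most twice, hence once, but the pentagon has
five vertices. -/
theorem not_isThreeColoring (h : Diagram N K ev σ) : ¬ IsThreeColoring K ev σ c := by
  intro hc
  have h1 := Finset.card_eq_sum_card_fiberwise (f := c) (t := Finset.univ)
    (s := (Finset.Ico 0 K).filter fun k => ev k = 1) fun _ _ => Finset.mem_coe.2 (Finset.mem_univ _)
  rw [h.bottom, Fin.sum_univ_three] at h1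
  have h2 := fun χ => h.bottomCount_odd hc χ
  have h3 := fun χ => h.bottomCount_le_two hc χ
  have := h2 0
  have := h2 1
  have := h2 2
  have := h3 0
  have := h3 1
  have := h3 2
  unfold bottomCount at *
  omega

end NotThree

end Wiring.Diagram

namespace Wiring

open Pseudocircle

/-! ### A coloring with four colors -/

section LetterColor

/-- The number of earlier occurrences of the letter at the time `k` in the period. -/
noncomputable def rank (ev : ℤ → ℕ) (k : ℤ) : ℕ := ((Finset.Ico 0 k).filter fun l => ev l = ev k).card

def HasLater (K : ℤ) (ev : ℤ → ℕ) (k : ℤ) : Prop := ∃ l, k < l ∧ l < K ∧ ev l = ev k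

open Classical in
/-- The colors of the crossings: the occurrences of an odd letter have the colors `1`, `2`, `1`,
`2` and so on, and the last one has the color `3`. -/
noncomputable def letterColor (K : ℤ) (ev : ℤ → ℕ) (k : ℤ) : ℕ :=
  if ev (k % K) % 2 = 0 then 0 else if HasLater K ev (k % K) then 1 + rank ev (k % K) % 2 else 3

/-- The colors of all vertices of the extended arrangement. -/
noncomputable def vertexColor (K : ℤ) (ev : ℤ → ℕ) (k : ℤ) : ℕ :=
  if ev k ≠ 0 then letterColor K ev k
  -- A vertex of the pentagon and its two neighbours on the corona receive all of the colors `1`,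
  -- `2`, `3`. The left neighbour has the color `3` whenever possible, the right one never.
  else if ev (k + 1) = 1 then (if letterColor K ev (k + 1) = 3 then 2 else 3)
  else if ev (k - 1) = 1 then
    (if letterColor K ev (k - 1) = 3 then 1 else 3 - letterColor K ev (k - 1))
  else 0

variable {K : ℤ} {ev : ℤ → ℕ}

theorem letterColor_cases (K : ℤ) (ev : ℤ → ℕ) (k : ℤ) :
    (ev (k % K) % 2 = 0 ∧ letterColor K ev k = 0) ∨
    (ev (k % K) % 2 = 1 ∧ HasLater K ev (k % K) ∧
      letterColor K ev k = 1 + rank ev (k % K) % 2) ∨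
    (ev (k % K) % 2 = 1 ∧ ¬ HasLater K ev (k % K) ∧ letterColor K ev k = 3) := by
  unfold letterColor
  split_ifs with h1 h2
  · exact Or.inl ⟨h1, rfl⟩
  · exact Or.inr (Or.inl ⟨by omega, h2, rfl⟩)
  · exact Or.inr (Or.inr ⟨by omega, h2, rfl⟩)

theorem letterColor_add (K : ℤ) (ev : ℤ → ℕ) (k : ℤ) :
    letterColor K ev (k + K) = letterColor K ev k := by
  unfold letterColor
  rw [Int.add_emod_right]

theorem rank_add_one_of_not_hasLater {k : ℤ} (h0 : 0 ≤ k) (hK : k < K) (hk : ¬ HasLater K ev k) :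
    rank ev k + 1 = ((Finset.Ico 0 K).filter fun l => ev l = ev k).card := by
  have : (Finset.Ico 0 K).filter (fun l => ev l = ev k) =
      insert k ((Finset.Ico 0 k).filter fun l => ev l = ev k) := by
    ext l
    simp only [Finset.mem_filter, Finset.mem_Ico, Finset.mem_insert]
    constructor
    · rintro ⟨⟨h1, h2⟩, h3⟩
      rcases lt_trichotomy l k with h4 | h4 | h4
      · exact Or.inr ⟨⟨h1, h4⟩, h3⟩
      · exact Or.inl h4
      · exact absurd ⟨l, h4, h2, h3⟩ hk
    · rintro (rfl | ⟨⟨h1, h2⟩, h3⟩)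
      · exact ⟨⟨h0, hK⟩, rfl⟩
      · exact ⟨⟨h1, h2.trans hK⟩, h3⟩
  rw [this, Finset.card_insert_of_notMem (by simp), rank]

theorem rank_of_successive {p : ℕ} {u v : ℤ} (huv : Successive (fun k => ev k = p) u v)
    (h0 : 0 ≤ u) : rank ev v = rank ev u + 1 := by
  have hu : ev u = p := huv.left
  have hv : ev v = p := huv.right
  have : (Finset.Ico 0 v).filter (fun l => ev l = ev v) =
      insert u ((Finset.Ico 0 u).filter fun l => ev l = ev u) := by
    ext l
    simp only [Finset.mem_filter, Finset.mem_Ico, Finset.mem_insert, hu, hv]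
    constructor
    · rintro ⟨⟨h1, h2⟩, h3⟩
      rcases lt_trichotomy l u with h4 | h4 | h4
      · exact Or.inr ⟨⟨h1, h4⟩, h3⟩
      · exact Or.inl h4
      · exact absurd h3 (huv.between l h4 h2)
    · rintro (rfl | ⟨⟨h1, h2⟩, h3⟩)
      · exact ⟨⟨h0, huv.lt⟩, hu⟩
      · exact ⟨⟨h1, h2.trans huv.lt⟩, h3⟩
  rw [rank, this, Finset.card_insert_of_notMem (by simp), rank]

/-- Successive occurrences of an odd letter have different colors; the color before the last one is
determined by the number of occurrences. -/
theorem letterColor_successive (hper : ∀ k, ev (k + K) = ev k) (hK : 0 < K) {p : ℕ}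
    (hp : p % 2 = 1) {u v : ℤ} (huv : Successive (fun k => ev k = p) u v) :
    (v < u + K → letterColor K ev u ≠ letterColor K ev v) ∧
      (((Finset.Ico 0 K).filter fun l => ev l = p).card = 5 → letterColor K ev v = 3 →
        letterColor K ev u = 2) := by
  have hpp : ∀ k, ev (k + K) = p ↔ ev k = p := fun k => by rw [hper]
  wlog h0 : 0 ≤ u ∧ u < K generalizing u v
  · have h1 := huv.add hpp (-(u / K))
    have h2 : ∀ k, letterColor K ev (k + -(u / K) * K) = letterColor K ev k := fun k =>
      Function.Periodic.int_mul (f := letterColor K ev) (c := K) (letterColor_add K ev) _ k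
    have h3 : u + -(u / K) * K = u % K := by
      have := Int.emod_add_mul_ediv u K
      linarith
    have h4 := this h1 (by
      rw [h3]
      exact ⟨Int.emod_nonneg u hK.ne', Int.emod_lt_of_pos u hK⟩)
    rw [h2, h2] at h4
    exact ⟨fun h5 => h4.1 (by omega), h4.2⟩
  have hle := huv.le_add hK hpp
  have hlt := huv.lt
  have hu : ev u = p := huv.left
  have hv : ev v = p := huv.right
  have eu : u % K = u := Int.emod_eq_of_lt h0.1 h0.2
  have cu := letterColor_cases K ev u
  have cv := letterColor_cases K ev v
  rw [eu, hu] at cu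
  rcases lt_or_ge v K with h1 | h1
  · have e2 : v % K = v := Int.emod_eq_of_lt (by omega) h1
    have h2 : HasLater K ev u := ⟨v, hlt, h1, by rw [hu, hv]⟩
    have h3 := rank_of_successive huv h0.1
    rw [e2, hv] at cv
    rcases cu with ⟨a1, a2⟩ | ⟨a1, a2, a3⟩ | ⟨a1, a2, a3⟩
    · omega
    · rcases cv with ⟨b1, b2⟩ | ⟨b1, b2, b3⟩ | ⟨b1, b2, b3⟩
      · omega
      · exact ⟨fun _ => by omega, fun _ h => by omega⟩
      -- With five occurrences the last one has rank `4`; the one before has the odd rank `3` and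
      -- hence the color `2`.
      · have h4 := rank_add_one_of_not_hasLater (by omega) h1 b2
        rw [hv] at h4
        exact ⟨fun _ => by omega, fun _ h => by omega⟩
    · exact absurd h2 a2
  -- Here the pair straddles the end of the period: `u` is the last occurrence and `v - K` the
  -- first.
  · have e2 : v % K = v - K := by
      rw [← Int.sub_emod_right, Int.emod_eq_of_lt (by omega) (by omega)]
    have hv' : ev (v - K) = p := by rw [← hper, sub_add_cancel, hv]
    have h2 : ¬ HasLater K ev u := by
      rintro ⟨l, h3, h4, h5⟩
      exact huv.between l h3 (by omega) (by rw [h5, hu])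
    have h3 : rank ev (v - K) = 0 := by
      rw [rank, Finset.card_eq_zero, Finset.filter_eq_empty_iff]
      intro l hl h4
      rw [Finset.mem_Ico] at hl
      refine huv.between (l + K) (by omega) (by omega) ?_
      rw [hper, h4, hv']
    rw [e2, hv'] at cv
    rcases cu with ⟨a1, a2⟩ | ⟨a1, a2, a3⟩ | ⟨a1, a2, a3⟩
    · omega
    · exact absurd a2 h2
    · rcases cv with ⟨b1, b2⟩ | ⟨b1, b2, b3⟩ | ⟨b1, b2, b3⟩
      · omega
      · exact ⟨fun _ => by omega, fun _ h => by omega⟩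
      · have h4 := rank_add_one_of_not_hasLater (by omega) (by omega) b2
        rw [hv'] at h4
        -- The first occurrence is also the last one, so the letter occurs only once; both
        -- hypotheses exclude this.
        refine ⟨fun h5 => absurd ⟨u, by omega, h0.2, by rw [hu, hv']⟩ b2, fun h5 _ => by omega⟩

end LetterColor

/-! ### Properness of the coloring with four colors -/

namespace Diagram

variable {N : ℕ} {K : ℤ} {ev : ℤ → ℕ} {σ : ℤ → Fin N → ℕ}

theorem ev_emod (h : Diagram N K ev σ) (k : ℤ) : ev (k % K) = ev k := by
  have h1 := Function.Periodic.int_mul (f := ev) (c := K) h.ev_per (k / K) (k % K)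
  have h2 := Int.emod_add_mul_ediv k K
  rw [mul_comm] at h2
  rw [Int.cast_id, h2] at h1
  exact h1.symm

theorem letterColor_of_even (h : Diagram N K ev σ) {k : ℤ} (hk : ev k % 2 = 0) :
    letterColor K ev k = 0 := by
  have := letterColor_cases K ev k
  rw [h.ev_emod] at this
  omega

theorem letterColor_of_odd (h : Diagram N K ev σ) {k : ℤ} (hk : ev k % 2 = 1) :
    0 < letterColor K ev k ∧ letterColor K ev k < 4 := by
  have := letterColor_cases K ev k
  rw [h.ev_emod] at this
  omega

theorem vertexColor_add (h : Diagram N K ev σ) (k : ℤ) :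
    vertexColor K ev (k + K) = vertexColor K ev k := by
  unfold vertexColor
  rw [show k + K + 1 = k + 1 + K by ring, show k + K - 1 = k - 1 + K by ring]
  simp only [h.ev_per, letterColor_add]

theorem vertexColor_lt (h : Diagram N K ev σ) (k : ℤ) : vertexColor K ev k < 4 := by
  have h1 : letterColor K ev k < 4 := by
    rcases Nat.mod_two_eq_zero_or_one (ev k) with h1 | h1
    · rw [h.letterColor_of_even h1]; norm_num
    · exact (h.letterColor_of_odd h1).2
  unfold vertexColor
  split_ifs <;> omega

theorem vertexColor_of_ne (K : ℤ) {k : ℤ} (hk : ev k ≠ 0) :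
    vertexColor K ev k = letterColor K ev k := if_pos hk

theorem vertexColor_left (h : Diagram N K ev σ) {k : ℤ} (hk : ev (k + 1) = 1) :
    vertexColor K ev k = if letterColor K ev (k + 1) = 3 then 2 else 3 := by
  have h1 := h.ev_mod_of_eq_one hk
  rw [vertexColor, if_neg (by rw [h.ev_eq_zero (by omega)]; simp), if_pos hk]

theorem vertexColor_right (h : Diagram N K ev σ) {k : ℤ} (hk : ev (k - 1) = 1) :
    vertexColor K ev k =
      if letterColor K ev (k - 1) = 3 then 1 else 3 - letterColor K ev (k - 1) := by
  have h1 := h.ev_mod_of_eq_one hk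
  have h2 := h.ev_eq_zero (show (k + 1) % 4 ≠ 2 by omega)
  rw [vertexColor, if_neg (by rw [h.ev_eq_zero (by omega)]; simp), if_neg (by omega), if_pos hk]

/-- A right neighbour has the color `1` or `2`, a left one `2` or `3`. The left one is `2` only at
the last letter `1`; the letter before it has the color `2`, since there are five, so its right
neighbour is `1`. -/
theorem vertexColor_right_ne_left (h : Diagram N K ev σ) {a b : ℤ}
    (hab : Successive (fun k => ev k = 1) (a - 1) (b + 1)) :
    vertexColor K ev a ≠ vertexColor K ev b := by
  have h1 := (letterColor_successive h.ev_per h.K_pos rfl hab).2 h.bottom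
  have hl := hab.left
  have hr := hab.right
  have h2 := h.letterColor_of_odd (k := a - 1) (by rw [hl])
  have h3 := h.letterColor_of_odd (k := b + 1) (by rw [hr])
  rw [h.vertexColor_right hl, h.vertexColor_left hr]
  split_ifs <;> omega

/-- No edge joins two crossings with an even letter. -/
theorem not_both_even (h : Diagram N K ev σ) {p : ℕ} (hp : p < N) {a b : ℤ}
    (hab : Successive (Near ev p) a b) (ha : ev a % 2 = 0) (hb : ev b % 2 = 0) : False := by
  have hN := h.even
  have ha' := hab.left
  have hb' := hab.right
  unfold Near at ha' hb'
  -- The odd gap `s + 1` borders the level `p`. Two adjacent even letters on this level would both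
  -- lie between the same successive letters `s + 1`, where only one neighbouring letter is allowed.
  obtain ⟨s, hs, hsp, hsN⟩ : ∃ s, s % 2 = 0 ∧ (s + 1 = p ∨ s = p) ∧ s + 1 < N := by
    rcases Nat.mod_two_eq_zero_or_one p with h1 | h1
    · exact ⟨p, h1, Or.inr rfl, by omega⟩
    · exact ⟨p - 1, by omega, by omega, by omega⟩
  obtain ⟨u, v, huv, h1, h2⟩ := exists_successive h.K_pos (h.ev_eq_periodic (s + 1))
    (h.exists_ev_eq hsN) (x := a + 1 / 2) (by
      intro k hk
      have : (2 * a + 1 : ℝ) = 2 * k := by linarith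
      have : 2 * a + 1 = 2 * k := by exact_mod_cast this
      omega)
  have h3 : u ≤ a := le_of_lt_half h1
  have h4 : a < v := lt_of_half_lt h2
  have hu := huv.left
  have hv := huv.right
  have h5 : u ≠ a := by
    rintro rfl
    omega
  have h6 : v ≠ b := by
    rintro rfl
    omega
  have h7 : b < v := by
    by_contra h7
    refine hab.between v h4 (by omega) ?_
    unfold Near
    omega
  have h8 := hab.lt
  obtain ⟨e, he⟩ := h.exists_unique_between hs huv
  have hmem : ∀ k, (u < k ∧ k < v) ∧ (ev k = s + 1 + 1 ∨ (ev k + 1 = s + 1 ∧ ev k ≠ 0)) →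
      k = e := by
    intro k hk
    rw [← Finset.mem_singleton (a := e), ← he, Finset.mem_filter, Finset.mem_Ioo]
    exact hk
  have h9 := hmem a ⟨by omega, by omega⟩
  have h10 := hmem b ⟨by omega, by omega⟩
  omega

theorem vertexColor_ne_of_none (h : Diagram N K ev σ) {a b : ℤ}
    (hab : Consecutive (extendedWire ev σ) none a b) : vertexColor K ev a ≠ vertexColor K ev b := by
  have hlt := hab.lt
  have hnot : ∀ k, a < k → k < b → ev (k - 1) ≠ 1 ∧ ev (k + 1) ≠ 1 := fun k h1 h2 =>
    not_or.1 (mt h.eventAt_none.2 (hab.between k h1 h2))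
  rcases h.eventAt_none.1 hab.left with ha | ha
  · have h1 := h.ev_mod_of_eq_one ha
    have hb : ev (b + 1) = 1 := by
      rcases h.eventAt_none.1 hab.right with hb | hb
      · have h2 := h.ev_mod_of_eq_one hb
        have h3 := (hnot (b - 1 - 1) (by omega) (by omega)).2
        rw [sub_add_cancel] at h3
        exact absurd hb h3
      · exact hb
    have h2 := h.ev_mod_of_eq_one hb
    refine h.vertexColor_right_ne_left ⟨by omega, ha, hb, fun k h3 h4 h5 => ?_⟩
    have h6 := h.ev_mod_of_eq_one h5
    have h7 := (hnot (k - 1) (by omega) (by omega)).2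
    rw [sub_add_cancel] at h7
    exact h7 h5
  · have h1 := h.ev_mod_of_eq_one ha
    have h2 : b = a + 1 + 1 := by
      have h3 : b ≤ a + 1 + 1 := by
        by_contra h3
        refine (hnot (a + 1 + 1) (by omega) (by omega)).1 ?_
        rwa [add_sub_cancel_right]
      by_contra h4
      obtain rfl : b = a + 1 := by omega
      rcases h.eventAt_none.1 hab.right with hb | hb
      · have := h.ev_mod_of_eq_one hb
        omega
      · have := h.ev_mod_of_eq_one hb
        omega
    have hb : ev (b - 1) = 1 := by rwa [h2, add_sub_cancel_right]
    have h3 := h.letterColor_of_odd (k := a + 1) (by rw [ha])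
    rw [h.vertexColor_left ha, h.vertexColor_right hb, show b - 1 = a + 1 by omega]
    split_ifs <;> omega

theorem vertexColor_ne_of_some (h : Diagram N K ev σ) {i : Fin N} {a b : ℤ}
    (hab : Consecutive (extendedWire ev σ) (some i) a b) (hK : b < a + K) :
    vertexColor K ev a ≠ vertexColor K ev b := by
  have hlt := hab.lt
  have hnot : ∀ k, a < k → k < b → ¬ (ev k ≠ 0 ∧ (σ k i + 1 = ev k ∨ σ k i = ev k)) ∧
      ¬ (σ k i = 1 ∧ (ev (k - 1) = 1 ∨ ev (k + 1) = 1)) := fun k h1 h2 =>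
    not_or.1 (mt h.eventAt_some.2 (hab.between k h1 h2))
  have hσ := h.σ_eq_of_forall_not_near i fun k h1 h2 => (hnot k h1 h2).1
  have hstep := h.step b i
  rw [hσ (b - 1) (by omega) (by omega)] at hstep
  have hswap := swapLetter_cases (ev b) (σ a i)
  rcases h.eventAt_some.1 hab.left with ⟨ha0, ha⟩ | ⟨ha1, ha⟩
  · rcases h.eventAt_some.1 hab.right with ⟨hb0, hb⟩ | ⟨hb1, hb⟩
    · -- two crossings of wires
      rw [vertexColor_of_ne K ha0, vertexColor_of_ne K hb0]
      have hs : Successive (Near ev (σ a i)) a b := by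
        refine ⟨hlt, near_iff.1 ⟨ha0, ha⟩, ⟨hb0, by omega⟩, fun k h1 h2 h3 => ?_⟩
        rw [← near_iff, ← hσ k h1.le h2] at h3
        exact (hnot k h1 h2).1 h3
      rcases Nat.mod_two_eq_zero_or_one (ev a) with h1 | h1 <;>
        rcases Nat.mod_two_eq_zero_or_one (ev b) with h2 | h2
      · exact (h.not_both_even (h.σ_lt a i) hs h1 h2).elim
      · have := h.letterColor_of_even h1
        have := h.letterColor_of_odd h2
        omega
      · have := h.letterColor_of_odd h1
        have := h.letterColor_of_even h2
        omega
      · refine (letterColor_successive h.ev_per h.K_pos h1 ⟨hlt, rfl, by omega,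
          fun k h3 h4 h5 => ?_⟩).1 hK
        refine hs.between k h3 h4 (near_iff.1 ⟨?_, ?_⟩) <;> omega
    · -- a crossing of wires, then the additional curve
      have hb2 : b % 4 ≠ 2 := by
        rcases hb with hb | hb
        · have := h.ev_mod_of_eq_one hb; omega
        · have := h.ev_mod_of_eq_one hb; omega
      have hb0 := h.ev_eq_zero hb2
      rw [vertexColor_of_ne K ha0]
      rcases Nat.mod_two_eq_zero_or_one (ev a) with h1 | h1
      · rw [h.letterColor_of_even h1]
        rcases hb with hb | hb
        · have h3 := h.letterColor_of_odd (k := b - 1) (by rw [hb])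
          rw [h.vertexColor_right hb]
          split_ifs <;> omega
        · rw [h.vertexColor_left hb]
          split_ifs <;> omega
      · have ha2 : ev a = 1 := by omega
        have h2 := h.ev_mod_of_eq_one ha2
        have h3 : b = a + 1 := by
          by_contra h3
          refine (hnot (a + 1) (by omega) (by omega)).2 ⟨?_, Or.inl ?_⟩
          · rw [hσ (a + 1) (by omega) (by omega)]
            omega
          · rwa [add_sub_cancel_right]
        have h4 := h.letterColor_of_odd h1
        have h5 : ev (b - 1) = 1 := by rwa [h3, add_sub_cancel_right]
        rw [h.vertexColor_right h5, h3, add_sub_cancel_right]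
        split_ifs <;> omega
  · rcases ha with ha | ha
    · have h1 := h.ev_mod_of_eq_one ha
      have ho := h.letterColor_of_odd (k := a - 1) (by rw [ha])
      rcases h.eventAt_some.1 hab.right with ⟨hb0, hb⟩ | ⟨hb1, hb⟩
      · have h2 := h.ev_mod b hb0
        have h3 : ev b ≠ 1 := by
          intro h3
          refine (hnot (b - 1) (by omega) (by omega)).2 ⟨?_, Or.inr ?_⟩
          · rw [hσ (b - 1) (by omega) (by omega), ha1]
          · rwa [sub_add_cancel]
        have h4 : ev b = 2 := by omega
        rw [vertexColor_of_ne K hb0, h.letterColor_of_even (by rw [h4]), h.vertexColor_right ha]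
        split_ifs <;> omega
      · rcases hb with hb | hb
        · exfalso
          have h2 := h.ev_mod_of_eq_one hb
          refine (hnot (b - 1) (by omega) (by omega)).1 ⟨by omega, ?_⟩
          rw [hσ (b - 1) (by omega) (by omega), hb, ha1]
          omega
        · have h2 := h.ev_mod_of_eq_one hb
          refine h.vertexColor_right_ne_left ⟨by omega, ha, hb, fun k h3 h4 h5 => ?_⟩
          have h6 := h.ev_mod_of_eq_one h5
          have h7 := hσ k (by omega) (by omega)
          exact (hnot k (by omega) (by omega)).1 ⟨by omega, by omega⟩
    · have h1 := h.ev_mod_of_eq_one ha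
      have h2 : b = a + 1 := by
        by_contra h2
        refine (hnot (a + 1) (by omega) (by omega)).1 ⟨by omega, ?_⟩
        rw [hσ (a + 1) (by omega) (by omega)]
        omega
      subst h2
      have h3 := h.letterColor_of_odd (k := a + 1) (by rw [ha])
      rw [h.vertexColor_left ha, vertexColor_of_ne K (by omega)]
      split_ifs <;> omega

/-! ### The chromatic number -/

/-- The word performs one crossing at a time, and the additional curve has its vertices at odd
times, where it meets only the wire at the position `1`. So each time carries at most one vertex,
and colorings of vertices can be replaced by colorings of times. -/
theorem eq_of_eventAt (h : Diagram N K ev σ) (o o' : Option (Fin N)) (k : ℤ)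
    (ho : EventAt (extendedWire ev σ) o k) (ho' : EventAt (extendedWire ev σ) o' k) :
    extendedWire ev σ o k = extendedWire ev σ o' k := by
  have hodd : ∀ k, ev (k - 1) = 1 ∨ ev (k + 1) = 1 → ev k = 0 := by
    rintro k (hk | hk)
    · have := h.ev_mod_of_eq_one hk
      exact h.ev_eq_zero (by omega)
    · have := h.ev_mod_of_eq_one hk
      exact h.ev_eq_zero (by omega)
  have key : ∀ o, EventAt (extendedWire ev σ) o k →
      (ev k ≠ 0 ∧ extendedWire ev σ o k = level ev (ev k) k) ∨
      (ev k = 0 ∧ extendedWire ev σ o k = hat ev k) := by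
    rintro (_ | i) ho
    · exact Or.inr ⟨hodd k (h.eventAt_none.1 ho), rfl⟩
    · rcases h.eventAt_some.1 ho with h1 | h1
      · exact Or.inl ⟨h1.1, h.wire_eq_level_ev h1.2⟩
      · exact Or.inr ⟨hodd k h1.2, (h.hat_eq_wire_iff.2 ⟨k, rfl, h1⟩).symm⟩
  rcases key o ho with h1 | h1 <;> rcases key o' ho' with h2 | h2
  · rw [h1.2, h2.2]
  · exact absurd h2.1 h1.1
  · exact absurd h1.1 h2.1
  · rw [h1.2, h2.2]

theorem chromaticNumber_eq_four (h : Diagram N K ev σ) :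
    (arrangementGraph (addCurve (fun i => curve (K : ℝ) (wire ev σ i))
      (curve K (hat ev)))).chromaticNumber = 4 := by
  rw [addCurve_eq]
  have hf := h.extendedFamily
  refine SimpleGraph.chromaticNumber_eq_iff_colorable_not_colorable.2 ⟨?_, ?_⟩
  · refine hf.nonempty_coloring (fun k => (⟨vertexColor K ev k, h.vertexColor_lt k⟩ : Fin 4))
      (fun k => Fin.ext (h.vertexColor_add k)) ?_
    intro o a b hab hK e
    have e' : vertexColor K ev a = vertexColor K ev b := congrArg Fin.val e
    cases o with
    | none => exact h.vertexColor_ne_of_none hab e'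
    | some i => exact h.vertexColor_ne_of_some hab hK e'
  · rintro ⟨C⟩
    obtain ⟨c, h1, h2⟩ := hf.exists_coloring h.eq_of_eventAt C
    exact h.not_isThreeColoring ⟨h1, h2⟩

end Diagram

end Wiring

/-- There are arbitrarily large intersecting triangle-saturated arrangements with a pentagonal
cell and a corona extension that is simple and `4`-chromatic. -/
theorem mainTheorem5 :
    ∀ N : ℕ, ∃ n ≥ N, ∃ (C : Fin n → Set ℂ) (P D : Set ℂ),
      -- an intersecting triangle-saturated simple arrangement of `n` pseudocircles
      -- with a pentagonal cell `P`
      Pseudocircle.IsArrangement C ∧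
      Pseudocircle.IsSimple C ∧
      Pseudocircle.IsIntersecting C ∧
      Pseudocircle.IsTriangleSaturated C ∧
      Pseudocircle.IsGonalCell C 5 P ∧
      -- adding the pseudocircle `D` is a corona extension at `P`, and it yields
      -- a simple 4-chromatic arrangement
      Pseudocircle.IsCoronaExtension C P D ∧
      Pseudocircle.IsArrangement (Pseudocircle.addCurve C D) ∧
      Pseudocircle.IsSimple (Pseudocircle.addCurve C D) ∧
      (Pseudocircle.arrangementGraph (Pseudocircle.addCurve C D)).chromaticNumber = 4 := by
  intro n
  obtain ⟨N, hn, l, w, hN, hw⟩ := Wiring.exists_saturatedWord n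
  have h := hw.diagram hN
  exact ⟨N, hn, _, _, _, h.isArrangement, h.isSimple, h.isIntersecting, h.isTriangleSaturated,
    h.isGonalCell_five_inside, h.isCoronaExtension, h.isArrangement_addCurve, h.isSimple_addCurve,
    h.chromaticNumber_eq_four⟩
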